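/- Fix the norm $\|\cdot\|$ on $\mathbb R^2$ to be either the $\ell^1$- or the $\ell^2$-norm and let $B_r(x)$ be the open ball of radius $r$ around $x$. For a set $I$ let $|I|$ be the number of points of $\mathbb Z^2$ in it. **Model.** For $n\ge1$ one observes $$X_{ij}=\mu\,\mathbf 1_{\bigcup_{g=1}^m N_g}(i,j)+Z_{ij},\qquad i,j=1,\dots,n,$$ where the $Z_{ij}$ are i.i.d. standard normal and $N_1,\dots,N_m$ are mutually disjoint balls of the same radius $R=R_n$ with centres in $\{1,\dots,n\}^2\cap[R,n-R+1]^2$ (so they contain no point of $\mathbb Z^2$ outside the grid); their locations are uniformly distributed on all such configurations and independent of the noise. Here $|N_g|=n^{2\alpha}$ and $m=n^{2(1-\alpha-\beta)}$ up to rounding, i.e. $|N_g|/n^{2\alpha}\to1$ and $m/n^{2(1-\alpha-\beta)}\to1$ as $n\to\infty$, with $0\le\alpha<1$ and $0<\alpha+\beta\le1$. One tests $H_0:\mu=0$ against $H_1:\mu=\mu(n)>0$. **Statistics.** For $\ell=0,\dots,\ell_{max}=\lceil\log_2(n^2/8)\rceil$ let $\epsilon_\ell=1/\sqrt{\log_2(n^2/2^{\ell-1})}$,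 $d_\ell=\lceil\epsilon_\ell 2^{(\ell-1)/2}\rceil$ and $$\mathcal C_{app}(\ell)=\Big\{B_{r_i}(j,k):\ r_i^2=2^{\ell-1+i\epsilon_\ell},\ i=0,\dots,\lfloor 1/\epsilon_\ell\rfloor,\ j,k\in d_\ell\mathbb N\cap[r_i,n-r_i+1]\Big\},\qquad n_\ell=\#\mathcal C_{app}(\ell),$$ where balls with different centres or radii are counted as different. Let $p_{(1)}\le\dots\le p_{(n_\ell)}$ be the ordered one-sided p-values $\mathbb P(N(0,1)\ge\sum_{(i,j)\in I}X_{ij}/\sqrt{|I|})$, $I\in\mathcal C_{app}(\ell)$, and, with $N=n_\ell$, $$HC(\ell)=\max_{1\le i\le N/2}\sqrt N\,\frac{i/N-p_{(i)}}{\sqrt{p_{(i)}(1-p_{(i)})}},\qquad BJ(\ell)=\max_{1\le i\le N/2}\Big(i\log\frac{i}{Np_{(i)}}+(N-i)\log\frac{1-i/N}{1-p_{(i)}}\Big)\mathbf 1\big(p_{(i)}<i/N\big),$$ $$sHC_n^{(2)}=\max_{0\le\ell\le\ell_{max}}\sqrt{\frac{n^2}{2^\ell n_\ell}}\,HC(\ell),\qquad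 sBJ_n^{(2)}=\max_{0\le\ell\le\ell_{max}}\frac{n^2}{2^\ell n_\ell}\,BJ(\ell).$$ **Theorem.** (1) Under $H_0$ there is a constant $C>0$ such that $\mathbb P\big(sBJ_n^{(2)}/\log\log n>C+\delta\big)\to0$ for every $\delta>0$, and $sHC_n^{(2)}=O_p(\log^{5/2}n)$. Assume now the sparse case $\frac{\beta}{1-\alpha}>\frac12$ and the calibration $\mu(n)=\sqrt{2r\log n^2}/\sqrt{n^{2\alpha}}$ with $r>0$, and let $$\rho^*(\alpha,\beta)=\begin{cases}\beta-(1-\alpha)/2&\text{if }\beta/(1-\alpha)<\frac34,\\(\sqrt{1-\alpha}-\sqrt{1-\alpha-\beta})^2&\text{if }\beta/(1-\alpha)\ge\frac34.\end{cases}$$ (2) If $r<\rho^*(\alpha,\beta)$, then $H_0$ and $H_1$ merge asymptotically: the sum of the type I and type II errors tends to $1$ for any (sequence of, possibly randomized) tests. (3) If $r>\rho^*(\alpha,\beta)$, then $sHC_n^{(2)}$ and $sBJ_n^{(2)}$ have asymptotic power $1$: for each of the two statistics there are critical values $t_n$, not depending on $\alpha,\beta,r,m,R$, such that the probability that the statistic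 exceeds $t_n$ tends to $0$ under $H_0$ and to $1$ under $H_1$. -/

import Mathlib

open MeasureTheory ProbabilityTheory Filter Topology
open scoped ENNReal

noncomputable section

namespace NetworkClusters

/-! ### The lattice and its balls -/

/-- The vertices of the `n × n` lattice; `(j, k)` stands for the grid point `(j + 1, k + 1)`. -/
abbrev Site (n : ℕ) : Type := Fin n × Fin n

/-- The coordinate in `{1, …, n}` that an index in `{0, …, n - 1}` stands for. -/
def coord {n : ℕ} (j : Fin n) : ℝ := (j : ℕ) + 1

/-- The norm that defines the balls: `ℓ¹` or `ℓ²`. -/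
inductive PlaneNorm : Type
  | l1 : PlaneNorm
  | l2 : PlaneNorm

/-- The norm of the vector `(a, b)` of the plane. -/
def PlaneNorm.eval : PlaneNorm → ℝ → ℝ → ℝ
  | .l1, a, b => |a| + |b|
  | .l2, a, b => √(a ^ 2 + b ^ 2)

/-- The grid points in the open ball of radius `r` around the vertex `c`. -/
def ball (q : PlaneNorm) {n : ℕ} (c : Site n) (r : ℝ) : Finset (Site n) :=
  Finset.univ.filter fun x => q.eval (coord x.1 - coord c.1) (coord x.2 - coord c.2) < r

/-- Both coordinates of the centre `c` are in `[r, n - r + 1]`; equivalently, all points of `ℤ²` in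
the open ball of radius `r` around `c` are in `{1, …, n}²`. -/
def InGrid {n : ℕ} (r : ℝ) (c : Site n) : Prop :=
  coord c.1 ∈ Set.Icc r (n - r + 1) ∧ coord c.2 ∈ Set.Icc r (n - r + 1)

/-- The number of points of `ℤ²` in an open ball of radius `r` around a point of `ℤ²`. -/
def latticeBallCard (q : PlaneNorm) (r : ℝ) : ℕ :=
  Set.ncard {x : ℤ × ℤ | q.eval x.1 x.2 < r}

/-! ### The statistical model -/

/-- The law of `X_x = θ_x + Z_x` with `Z_x` i.i.d. standard normal, for a given mean field `θ`. -/
def obsLaw {n : ℕ} (θ : Site n → ℝ) : Measure (Site n → ℝ) :=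
  Measure.pi fun x => gaussianReal (θ x) 1

/-- The law of the observations under the null hypothesis: pure noise. -/
def nullLaw (n : ℕ) : Measure (Site n → ℝ) := obsLaw fun _ => 0

open Classical in
/-- The mean field `μ · 1_{⋃_g N_g}`, where `N_g` is the ball of radius `R` around `c g`. -/
def signal (q : PlaneNorm) {n m : ℕ} (R μ : ℝ) (c : Fin m → Site n) : Site n → ℝ :=
  fun x => if ∃ g, x ∈ ball q (c g) R then μ else 0

open Classical in
/-- The admissible locations: the centres of `m` mutually disjoint balls of radius `R` in the
grid. -/
def configs (q : PlaneNorm) (n m : ℕ) (R : ℝ) : Finset (Fin m → Site n) :=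
  Finset.univ.filter fun c =>
    (∀ g, InGrid R (c g)) ∧ ∀ g h, g ≠ h → Disjoint (ball q (c g) R) (ball q (c h) R)

/-- The law of the observations under the alternative: the locations of the `m` balls are uniformly
distributed on the admissible ones and independent of the noise. -/
def altLaw (q : PlaneNorm) (n m : ℕ) (R μ : ℝ) : Measure (Site n → ℝ) :=
  ((configs q n m R).card : ℝ≥0∞)⁻¹ • ∑ c ∈ configs q n m R, obsLaw (signal q R μ c)

/-- The calibration `√(2 r log n²) / √(n^{2α})` of the mean of the signal. -/
def signalMean (α r : ℝ) (n : ℕ) : ℝ :=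
  √(2 * r * Real.log ((n : ℝ) ^ 2)) / √((n : ℝ) ^ (2 * α))

/-- The detection boundary in the sparse case. -/
def detectionBoundary (α β : ℝ) : ℝ :=
  if β / (1 - α) < 3 / 4 then β - (1 - α) / 2 else (√(1 - α) - √(1 - α - β)) ^ 2

/-! ### Higher criticism and Berk-Jones statistic of a finite family of p-values -/

/-- The one-sided p-value of `y` under the standard normal law. -/
def pValue (y : ℝ) : ℝ := (gaussianReal 0 1).real (Set.Ici y)

/-- The `i`-th smallest of the numbers `p a`, `a ∈ A`, counted with multiplicity: the smallest `t`
such that at least `i` of them are at most `t` (for `1 ≤ i ≤ #A`). -/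
def orderStat {ι : Type*} (A : Finset ι) (p : ι → ℝ) (i : ℕ) : ℝ :=
  sInf {t : ℝ | i ≤ (A.filter fun a => p a ≤ t).card}

/-- The one-sided higher criticism of the p-values `p a`, `a ∈ A`: a maximum over
`1 ≤ i ≤ #A / 2`. -/
def higherCriticism {ι : Type*} (A : Finset ι) (p : ι → ℝ) : ℝ :=
  ⨆ i : Finset.Icc 1 (A.card / 2),
    √(A.card : ℝ) * (((i : ℕ) : ℝ) / A.card - orderStat A p i) /
      √(orderStat A p i * (1 - orderStat A p i))

/-- The Berk-Jones statistic of the p-values `p a`, `a ∈ A`: a maximum over `1 ≤ i ≤ #A / 2`. -/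
def berkJones {ι : Type*} (A : Finset ι) (p : ι → ℝ) : ℝ :=
  ⨆ i : Finset.Icc 1 (A.card / 2),
    if orderStat A p i < ((i : ℕ) : ℝ) / A.card then
      ((i : ℕ) : ℝ) * Real.log (((i : ℕ) : ℝ) / (A.card * orderStat A p i)) +
        ((A.card : ℝ) - ((i : ℕ) : ℝ)) *
          Real.log ((1 - ((i : ℕ) : ℝ) / A.card) / (1 - orderStat A p i))
    else 0

/-! ### The approximating sets and the structured statistics -/

/-- The largest level `⌈log₂ (n² / 8)⌉`. -/
def levelMax (n : ℕ) : ℕ := ⌈Real.logb 2 ((n : ℝ) ^ 2 / 8)⌉₊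

/-- The precision `1 / √(log₂ (n² / 2^{ℓ - 1}))`. -/
def precision (n ℓ : ℕ) : ℝ :=
  1 / √(Real.logb 2 ((n : ℝ) ^ 2 / (2 : ℝ) ^ ((ℓ : ℝ) - 1)))

/-- The spacing `⌈ε_ℓ 2^{(ℓ - 1) / 2}⌉` of the grid of centres. -/
def spacing (n ℓ : ℕ) : ℕ := ⌈precision n ℓ * (2 : ℝ) ^ (((ℓ : ℝ) - 1) / 2)⌉₊

/-- The radius `r_i`, where `r_i² = 2^{ℓ - 1 + i ε_ℓ}`. -/
def radius (n ℓ i : ℕ) : ℝ := √((2 : ℝ) ^ ((ℓ : ℝ) - 1 + i * precision n ℓ))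

open Classical in
/-- The approximating set of level `ℓ`. Its member `B_{r_i}(c)` is represented by `(i, c)`: balls of
the plane with different centres or radii are different. -/
def approxSet (n ℓ : ℕ) : Finset (ℕ × Site n) :=
  (Finset.range (⌊1 / precision n ℓ⌋₊ + 1) ×ˢ Finset.univ).filter fun b =>
    spacing n ℓ ∣ (b.2.1 : ℕ) + 1 ∧ spacing n ℓ ∣ (b.2.2 : ℕ) + 1 ∧ InGrid (radius n ℓ b.1) b.2

/-- The p-value of `∑_{x ∈ I} X_x / √|I|`, where `I` is the ball with index `b` of level `ℓ`. -/
def ballPValue (q : PlaneNorm) {n : ℕ} (X : Site n → ℝ) (ℓ : ℕ) (b : ℕ × Site n) : ℝ :=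
  pValue ((∑ x ∈ ball q b.2 (radius n ℓ b.1), X x) /
    √((ball q b.2 (radius n ℓ b.1)).card : ℝ))

/-- The structured higher criticism. -/
def sHC (q : PlaneNorm) (n : ℕ) (X : Site n → ℝ) : ℝ :=
  (Finset.range (levelMax n + 1)).sup' Finset.nonempty_range_add_one fun ℓ =>
    √((n : ℝ) ^ 2 / (2 ^ ℓ * (approxSet n ℓ).card)) *
      higherCriticism (approxSet n ℓ) (ballPValue q X ℓ)

/-- The structured Berk-Jones statistic. -/
def sBJ (q : PlaneNorm) (n : ℕ) (X : Site n → ℝ) : ℝ :=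
  (Finset.range (levelMax n + 1)).sup' Finset.nonempty_range_add_one fun ℓ =>
    (n : ℝ) ^ 2 / (2 ^ ℓ * (approxSet n ℓ).card) *
      berkJones (approxSet n ℓ) (ballPValue q X ℓ)

/-! ### Asymptotic notions -/

/-- `T_n` is asymptotically at most `C` in probability: `P_n(T_n > C + δ) → 0` for all `δ > 0`. -/
def AsympLeInProb {Ω : ℕ → Type*} [∀ n, MeasurableSpace (Ω n)] (P : ∀ n, Measure (Ω n))
    (T : ∀ n, Ω n → ℝ) (C : ℝ) : Prop :=
  ∀ δ : ℝ, 0 < δ → Tendsto (fun n => (P n).real {ω | C + δ < T n ω}) atTop (𝓝 0)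

/-- `T_n = O_p(a_n)`. -/
def IsBigOInProb {Ω : ℕ → Type*} [∀ n, MeasurableSpace (Ω n)] (P : ∀ n, Measure (Ω n))
    (T : ∀ n, Ω n → ℝ) (a : ℕ → ℝ) : Prop :=
  ∀ δ : ℝ, 0 < δ → ∃ M : ℝ, ∀ᶠ n in atTop, (P n).real {ω | M * a n < |T n ω|} ≤ δ

/-- The hypotheses `P_n` and `Q_n` merge asymptotically: for any (possibly randomized) tests `φ_n`,
where `φ_n(ω)` is the probability to reject `P_n` given `ω`, the sum of the errors of type I and
type II tends to 1. -/
def MergeAsymptotically {Ω : ℕ → Type*} [∀ n, MeasurableSpace (Ω n)]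
    (P Q : ∀ n, Measure (Ω n)) : Prop :=
  ∀ φ : ∀ n, Ω n → ℝ, (∀ n, Measurable (φ n)) → (∀ n ω, φ n ω ∈ Set.Icc (0 : ℝ) 1) →
    Tendsto (fun n => (∫ ω, φ n ω ∂(P n)) + (∫ ω, (1 - φ n ω) ∂(Q n))) atTop (𝓝 1)

/-- The parameters are admissible and in the sparse case; the number `m n` of balls is
`n^{2(1 - α - β)}` and the number of grid points in each ball is `n^{2α}`, where both are rounded in
an arbitrary way that is asymptotically negligible. -/
structure SparseClusterModel (q : PlaneNorm) (α β : ℝ) (m : ℕ → ℕ) (R : ℕ → ℝ) : Prop where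
  alpha_nonneg : 0 ≤ α
  alpha_lt_one : α < 1
  sum_pos : 0 < α + β
  sum_le_one : α + β ≤ 1
  sparse : 1 / 2 < β / (1 - α)
  number : Tendsto (fun n : ℕ => (m n : ℝ) / (n : ℝ) ^ (2 * (1 - α - β))) atTop (𝓝 1)
  size : Tendsto (fun n : ℕ => (latticeBallCard q (R n) : ℝ) / (n : ℝ) ^ (2 * α)) atTop (𝓝 1)

end NetworkClusters

end

noncomputable section

namespace NetworkClusters

/-! ### Standardized sums under the observation law -/

/-! Write A = 1 - α, B = 1 - α - β and L = log n². A level holds many overlapping balls, but they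
split into `classCount` classes of pairwise disjoint balls, and within a class the p-values are
independent and uniform under the null. Up to a constant, the weight n² / (2^ℓ n_ℓ) of a level is
the reciprocal of the number of its classes (`classCount_mul_le`); this makes the structured
statistics behave like those of a single independent family.

Null distribution. For independent uniforms, a martingale argument in decreasing t
(`maximal_inequality`) bounds the count of values below t simultaneously on a dyadic block, and
Legendre duality turns this into `PoissonBounded`: l · count - (e^l - 1) N t ≤ x for all t and l, up
to probability about e^(-x/2) per block. For fixed l and t this inequality is additive, so it passes
from the classes to the whole level with x multiplied by the number of classes, which the weight
cancels. Number of classes, blocks and levels are powers of log n, so x = 10 log log n suffices.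
Optimising over l bounds Berk-Jones by 3x. Higher criticism divides by the square root of the
p-value, so it also needs that no p-value is far below 1 / n_ℓ; this costs the power of log n.

Lower bound. The mixture density is bounded below after truncating the likelihood ratio of each
cluster at √(2AL), about the largest scan that noise produces. If S is the average truncated ratio
over all centres, the mixture over disjoint configurations is at least S^m minus a term for
overlapping pairs (`pow_sub_le_sum_prod`). Below the boundary the truncated second moment gives m|S
- 1| → 0 and a vanishing overlap term in probability (`nullLaw_bad_le`, `below_boundary`). Hence no
test loses more than o(1) of its null rejection probability under the alternative; applied to φ and
to 1 - φ this gives the merging.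

Power. Each cluster of radius R contains a fixed proportion of the balls of a suitable level that a
region of its size can carry, all with almost the full standardized mean (`exists_approximants`). At
a threshold √(2sL), the expected number of p-values below the tail probability t of that threshold
exceeds n_ℓ t by an amount e, and Chebyshev's inequality with local dependence preserves half of it.
One quantity Q bounds the failure probability by a multiple of Q and forces sHC ≥ 1 / (2√Q), sBJ ≥ 1
/ (8Q) (`obsLaw_signal_small_le`). Above the boundary some s makes Q a negative power of n
(`exists_exponents`). If B = 0 the number of clusters does not grow; then one cluster alone is
detected by a Markov argument. -/

instance {n : ℕ} (θ : Site n → ℝ) : IsProbabilityMeasure (obsLaw θ) := by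
  unfold obsLaw; infer_instance

instance (n : ℕ) : IsProbabilityMeasure (nullLaw n) := by
  unfold nullLaw; infer_instance

/-- The standardized sum of the observations in `I`. -/
def scan {n : ℕ} (I : Finset (Site n)) (X : Site n → ℝ) : ℝ := (∑ x ∈ I, X x) / √(I.card : ℝ)

lemma measurable_scan {n : ℕ} (I : Finset (Site n)) : Measurable (scan I) := by
  unfold scan; fun_prop

lemma obsLaw_map_eval {n : ℕ} (θ : Site n → ℝ) (x : Site n) :
    (obsLaw θ).map (fun X => X x) = gaussianReal (θ x) 1 :=
  (measurePreserving_eval (fun x => gaussianReal (θ x) 1) x).map_eq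

lemma iIndepFun_obsLaw {n : ℕ} (θ : Site n → ℝ) :
    iIndepFun (fun (x : Site n) (X : Site n → ℝ) => X x) (obsLaw θ) :=
  iIndepFun_pi (X := fun _ => id) (fun _ => aemeasurable_id)

lemma hasGaussianLaw_eval {n : ℕ} (θ : Site n → ℝ) (x : Site n) :
    HasGaussianLaw (fun X : Site n → ℝ => X x) (obsLaw θ) :=
  ⟨by rw [obsLaw_map_eval]; infer_instance⟩

lemma hasGaussianLaw_obsLaw {n : ℕ} (θ : Site n → ℝ) :
    HasGaussianLaw (fun X : Site n → ℝ => (X ·)) (obsLaw θ) :=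
  (iIndepFun_obsLaw θ).hasGaussianLaw (hasGaussianLaw_eval θ)

lemma integral_eval_obsLaw {n : ℕ} (θ : Site n → ℝ) (x : Site n) :
    ∫ X, X x ∂(obsLaw θ) = θ x := by
  have h := integral_map (μ := obsLaw θ) (φ := fun X : Site n → ℝ => X x) (f := fun y : ℝ => y)
    (measurable_pi_apply x).aemeasurable (by fun_prop)
  rw [← h, obsLaw_map_eval]
  exact integral_id_gaussianReal

lemma covariance_eval_obsLaw {n : ℕ} (θ : Site n → ℝ) (x y : Site n) :
    cov[fun X : Site n → ℝ => X x, fun X => X y; obsLaw θ] = if x = y then 1 else 0 := by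
  split_ifs with h
  · subst h
    rw [covariance_self (measurable_pi_apply x).aemeasurable]
    have h := variance_map (μ := obsLaw θ) (Y := fun X : Site n → ℝ => X x) (X := fun y : ℝ => y)
      (by fun_prop) (measurable_pi_apply x).aemeasurable
    rw [obsLaw_map_eval, variance_fun_id_gaussianReal] at h
    simpa [Function.comp_def] using h.symm
  · exact ((iIndepFun_obsLaw θ).indepFun h).covariance_eq_zero
      (hasGaussianLaw_eval θ x).memLp_two (hasGaussianLaw_eval θ y).memLp_two

lemma covariance_sum_obsLaw {n : ℕ} (θ : Site n → ℝ) (I J : Finset (Site n)) :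
    cov[fun X : Site n → ℝ => ∑ x ∈ I, X x, fun X => ∑ x ∈ J, X x; obsLaw θ] =
      ((I ∩ J).card : ℝ) := by
  rw [covariance_fun_sum_fun_sum' (fun x _ => (hasGaussianLaw_eval θ x).memLp_two)
    (fun x _ => (hasGaussianLaw_eval θ x).memLp_two)]
  simp_rw [covariance_eval_obsLaw]
  simp

/-- Joint normality is what later turns the vanishing covariance of sums over disjoint sets into
independence of the whole family. -/
lemma hasGaussianLaw_scans {n : ℕ} {κ : Type*} [Finite κ] (θ : Site n → ℝ)
    (I : κ → Finset (Site n)) :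
    HasGaussianLaw (fun (X : Site n → ℝ) => fun k => scan (I k) X) (obsLaw θ) := by
  have := Fintype.ofFinite κ
  have h := (hasGaussianLaw_obsLaw θ).map_fun (ContinuousLinearMap.pi fun k =>
    (√((I k).card : ℝ))⁻¹ • ∑ x ∈ I k, ContinuousLinearMap.proj (R := ℝ) (φ := fun _ => ℝ) x)
  have he : (fun (X : Site n → ℝ) => fun k => scan (I k) X) = fun X =>
      (ContinuousLinearMap.pi fun k => (√((I k).card : ℝ))⁻¹ •
        ∑ x ∈ I k, ContinuousLinearMap.proj (R := ℝ) (φ := fun _ => ℝ) x) fun x => X x := by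
    ext X k
    simp [scan, div_eq_inv_mul]
  rw [he]
  exact h

lemma scan_eq_mul {n : ℕ} (I : Finset (Site n)) :
    scan I = fun X => (√(I.card : ℝ))⁻¹ * ∑ x ∈ I, X x := by
  ext X; rw [scan, div_eq_inv_mul]

lemma covariance_scan {n : ℕ} (θ : Site n → ℝ) (I J : Finset (Site n)) :
    cov[scan I, scan J; obsLaw θ] =
      ((I ∩ J).card : ℝ) / (√(I.card : ℝ) * √(J.card : ℝ)) := by
  rw [scan_eq_mul, scan_eq_mul, covariance_const_mul_left, covariance_const_mul_right,
    covariance_sum_obsLaw]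
  field_simp

lemma obsLaw_map_scan {n : ℕ} (θ : Site n → ℝ) {I : Finset (Site n)} (hI : I.Nonempty) :
    (obsLaw θ).map (scan I) = gaussianReal (scan I θ) 1 := by
  have h := ((hasGaussianLaw_scans θ (fun _ : Unit => I)).eval ()).map_eq_gaussianReal
  have hc : (0 : ℝ) < I.card := by exact_mod_cast hI.card_pos
  have hm : ∫ X, scan I X ∂(obsLaw θ) = scan I θ := by
    simp_rw [scan]
    rw [integral_div, integral_finsetSum]
    · simp_rw [integral_eval_obsLaw]
    · exact fun x _ => (hasGaussianLaw_eval θ x).integrable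
  have hv : Var[scan I; obsLaw θ] = 1 := by
    rw [← covariance_self (measurable_scan I).aemeasurable, covariance_scan, Finset.inter_self,
      Real.mul_self_sqrt hc.le, div_self hc.ne']
  change (obsLaw θ).map (scan I) = gaussianReal (∫ X, scan I X ∂(obsLaw θ)) _ at h
  rw [h, hm]
  change gaussianReal _ (Var[scan I; obsLaw θ]).toNNReal = _
  rw [hv, Real.toNNReal_one]

lemma iIndepFun_scan {n : ℕ} {κ : Type*} [Finite κ] (θ : Site n → ℝ)
    (I : κ → Finset (Site n)) (hI : Pairwise fun k l => Disjoint (I k) (I l)) :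
    iIndepFun (fun k => scan (I k)) (obsLaw θ) := by
  refine (hasGaussianLaw_scans θ I).iIndepFun_of_covariance_eq_zero fun k l hkl => ?_
  rw [covariance_scan, Finset.disjoint_iff_inter_eq_empty.mp (hI hkl)]
  simp

/-! ### The p-value -/

lemma pValue_nonneg (y : ℝ) : 0 ≤ pValue y := measureReal_nonneg

lemma pValue_strictAnti : StrictAnti pValue := by
  intro a b hab
  have h1 : (gaussianReal 0 1).real (Set.Ici a) =
      (gaussianReal 0 1).real (Set.Ico a b) + (gaussianReal 0 1).real (Set.Ici b) := by
    rw [← measureReal_union (Set.disjoint_left.2 fun x h1 h2 => by simp at h1 h2; linarith)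
      measurableSet_Ici, Set.Ico_union_Ici_eq_Ici hab.le]
  have h2 : 0 < (gaussianReal 0 1).real (Set.Ico a b) := by
    rw [measureReal_def, ENNReal.toReal_pos_iff]
    refine ⟨?_, measure_lt_top _ _⟩
    rw [pos_iff_ne_zero]
    intro h
    have := gaussianReal_absolutelyContinuous' 0 (v := 1) (by simp) h
    simp [hab.not_ge] at this
  unfold pValue
  linarith

lemma pValue_pos (y : ℝ) : 0 < pValue y :=
  (pValue_nonneg (y + 1)).trans_lt (pValue_strictAnti (by linarith))

lemma pValue_lt_one (y : ℝ) : pValue y < 1 :=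
  (pValue_strictAnti (by linarith : y - 1 < y)).trans_le measureReal_le_one

lemma measurable_pValue : Measurable pValue := pValue_strictAnti.antitone.measurable

lemma pValue_eq_one_sub_cdf (y : ℝ) : pValue y = 1 - cdf (gaussianReal 0 1) y := by
  have := nullSingletonClass_gaussianReal (μ := 0) (v := 1) (by simp)
  rw [cdf_eq_real, pValue, ← measureReal_congr (Ioi_ae_eq_Ici (μ := gaussianReal 0 1)),
    ← Set.compl_Iic, probReal_compl_eq_one_sub measurableSet_Iic]

lemma continuous_pValue : Continuous pValue := by
  have := nullSingletonClass_gaussianReal (μ := 0) (v := 1) (by simp)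
  have h : pValue = fun y => 1 - cdf (gaussianReal 0 1) y := funext pValue_eq_one_sub_cdf
  rw [h]
  refine continuous_const.sub ?_
  rw [continuous_iff_continuousAt]
  intro x
  have hm := measure_cdf (gaussianReal 0 1)
  have hs : (cdf (gaussianReal 0 1)).measure {x} = 0 := by rw [hm]; exact measure_singleton x
  rw [StieltjesFunction.measure_singleton, ENNReal.ofReal_eq_zero] at hs
  rw [(cdf (gaussianReal 0 1)).mono.continuousAt_iff_leftLim_eq_rightLim,
    StieltjesFunction.rightLim_eq]
  exact le_antisymm ((cdf _).mono.leftLim_le le_rfl) (by linarith)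

lemma exists_pValue_eq {t : ℝ} (h0 : 0 < t) (h1 : t < 1) : ∃ y, pValue y = t := by
  have hb : Tendsto pValue atBot (𝓝 1) := by
    have := (tendsto_cdf_atBot (gaussianReal 0 1)).const_sub 1
    simpa [← pValue_eq_one_sub_cdf] using this
  have ht : Tendsto pValue atTop (𝓝 0) := by
    have := (tendsto_cdf_atTop (gaussianReal 0 1)).const_sub 1
    simpa [← pValue_eq_one_sub_cdf] using this
  obtain ⟨a, ha⟩ := (hb.eventually (lt_mem_nhds h1)).exists
  obtain ⟨b, hb⟩ := (ht.eventually (gt_mem_nhds h0)).exists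
  exact mem_range_of_exists_le_of_exists_ge continuous_pValue ⟨b, hb.le⟩ ⟨a, ha.le⟩

lemma obsLaw_scan_ge {n : ℕ} (θ : Site n → ℝ) {I : Finset (Site n)} (hI : I.Nonempty) (z : ℝ) :
    (obsLaw θ).real {X | z ≤ scan I X} = pValue (z - scan I θ) := by
  have h1 : {X | z ≤ scan I X} = scan I ⁻¹' Set.Ici z := rfl
  rw [h1, ← map_measureReal_apply (measurable_scan I) measurableSet_Ici, obsLaw_map_scan θ hI]
  have h2 : gaussianReal (scan I θ) 1 = (gaussianReal 0 1).map (fun x => x + scan I θ) := by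
    rw [gaussianReal_map_add_const, zero_add]
  rw [h2, map_measureReal_apply (by fun_prop) measurableSet_Ici, pValue]
  congr 1; ext x; simp

/-- The Gaussian tail is continuous and strictly decreasing with values filling (0, 1), so a p-value
is exactly uniform under the null. This is the hypothesis of the maximal inequality. -/
lemma nullLaw_pValue_scan_le {n : ℕ} {I : Finset (Site n)} (hI : I.Nonempty) {t : ℝ}
    (h0 : 0 < t) (h1 : t < 1) : (nullLaw n).real {X | pValue (scan I X) ≤ t} = t := by
  obtain ⟨z, hz⟩ := exists_pValue_eq h0 h1
  have : {X : Site n → ℝ | pValue (scan I X) ≤ t} = {X | z ≤ scan I X} := by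
    ext y; simp only [Set.mem_ofPred_eq, ← hz, pValue_strictAnti.le_iff_ge]
  rw [this, nullLaw, obsLaw_scan_ge _ hI]
  simpa [scan] using hz

/-! ### Gaussian tails -/

lemma pValue_le_exp {y : ℝ} (hy : 0 ≤ y) : pValue y ≤ Real.exp (-y ^ 2 / 2) := by
  have h := measure_ge_le_exp_mul_mgf (μ := gaussianReal 0 1) (X := id) y hy
    (integrable_exp_mul_gaussianReal y)
  rw [mgf_id_gaussianReal] at h
  refine h.trans_eq ?_
  simp only [zero_mul, NNReal.coe_one, one_mul, zero_add]
  rw [← Real.exp_add]; congr 1; ring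

/-- On [y, y + 1] the density is at least its value at y + 1. Compared with exp(-y²/2) this loses
exp(-y - 1/2), which for y of order √(log n) does not affect exponents. -/
lemma exp_le_pValue {y : ℝ} (hy : 0 ≤ y) :
    (√(2 * Real.pi))⁻¹ * Real.exp (-(y + 1) ^ 2 / 2) ≤ pValue y := by
  have h1 : ((gaussianReal 0 1) (Set.Icc y (y + 1))).toReal ≤ pValue y :=
    measureReal_mono Set.Icc_subset_Ici_self
  refine le_trans ?_ h1
  rw [gaussianReal_apply_eq_integral _ (by simp), ENNReal.toReal_ofReal
    (setIntegral_nonneg measurableSet_Icc fun x _ => gaussianPDFReal_nonneg _ _ _)]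
  have h2 := setIntegral_ge_of_const_le_real (μ := volume) (s := Set.Icc y (y + 1))
    (f := gaussianPDFReal 0 1)
    (c := (√(2 * Real.pi))⁻¹ * Real.exp (-(y + 1) ^ 2 / 2)) measurableSet_Icc (by simp)
    (fun x hx => by
      simp only [gaussianPDFReal, NNReal.coe_one, mul_one, sub_zero]
      gcongr
      · linarith [hx.1]
      · exact hx.2) (integrable_gaussianPDFReal 0 1).integrableOn
  simpa using h2

/-! ### Densities of product measures -/

/-- It suffices to compare on boxes, where the integrand is a product of functions of independent
coordinates. Used both for Gaussian likelihood ratios and for tilting the uniforms in the maximal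
inequality. -/
lemma pi_withDensity {ι : Type*} [Fintype ι] {α : ι → Type*} [∀ i, MeasurableSpace (α i)]
    (μ : ∀ i, Measure (α i)) [∀ i, IsProbabilityMeasure (μ i)] (f : ∀ i, α i → ℝ≥0∞)
    (hf : ∀ i, Measurable (f i)) [∀ i, SigmaFinite ((μ i).withDensity (f i))] :
    Measure.pi (fun i => (μ i).withDensity (f i)) =
      (Measure.pi μ).withDensity (fun x => ∏ i, f i (x i)) := by
  refine Measure.pi_eq fun s hs => ?_
  rw [withDensity_apply _ (MeasurableSet.univ_pi hs), ← lintegral_indicator (.univ_pi hs)]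
  have h1 : ∀ x : ∀ i, α i, (Set.univ.pi s).indicator (fun x => ∏ i, f i (x i)) x =
      ∏ i, (s i).indicator (f i) (x i) := by
    intro x
    by_cases hx : x ∈ Set.univ.pi s
    · rw [Set.indicator_of_mem hx]
      exact Finset.prod_congr rfl fun i _ => (Set.indicator_of_mem (hx i trivial) _).symm
    · rw [Set.indicator_of_notMem hx]
      obtain ⟨i, hi⟩ : ∃ i, x i ∉ s i := by simpa [Set.mem_pi] using hx
      exact (Finset.prod_eq_zero (Finset.mem_univ i) (Set.indicator_of_notMem hi _)).symm
  simp_rw [h1]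
  have h2 := lintegral_prod_eq_prod_lintegral_of_indepFun (μ := Measure.pi μ) Finset.univ
    (fun i x => (s i).indicator (f i) (x i))
    (iIndepFun_pi fun i => ((hf i).indicator (hs i)).aemeasurable)
    (fun i => ((hf i).indicator (hs i)).comp (measurable_pi_apply i))
  rw [h2]
  refine Finset.prod_congr rfl fun i _ => ?_
  rw [withDensity_apply _ (hs i), ← lintegral_indicator (hs i),
    ← (measurePreserving_eval μ i).map_eq, lintegral_map ((hf i).indicator (hs i))
      (measurable_pi_apply i)]

lemma gaussianReal_eq_withDensity (a : ℝ) :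
    gaussianReal a 1 =
      (gaussianReal 0 1).withDensity fun y => ENNReal.ofReal (Real.exp (a * y - a ^ 2 / 2)) := by
  rw [gaussianReal_of_var_ne_zero a one_ne_zero, gaussianReal_of_var_ne_zero 0 one_ne_zero,
    ← withDensity_mul _ (measurable_gaussianPDF 0 1) (by fun_prop)]
  congr 1
  ext y
  simp only [gaussianPDF, Pi.mul_apply]
  rw [← ENNReal.ofReal_mul (gaussianPDFReal_nonneg _ _ _)]
  simp only [gaussianPDFReal, NNReal.coe_one, mul_one, sub_zero]
  rw [mul_assoc, ← Real.exp_add]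
  congr 3
  ring

lemma obsLaw_eq_withDensity {n : ℕ} (θ : Site n → ℝ) :
    obsLaw θ = (nullLaw n).withDensity
      fun X => ENNReal.ofReal (Real.exp (∑ x, (θ x * X x - θ x ^ 2 / 2))) := by
  have hi : ∀ x : Site n, SigmaFinite ((gaussianReal 0 1).withDensity
      fun y => ENNReal.ofReal (Real.exp (θ x * y - θ x ^ 2 / 2))) := fun x => by
    rw [← gaussianReal_eq_withDensity]; infer_instance
  unfold nullLaw obsLaw
  simp_rw [gaussianReal_eq_withDensity (θ _)]
  rw [pi_withDensity _ _ (fun x => by fun_prop)]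
  congr 1
  ext X
  rw [Real.exp_sum, ENNReal.ofReal_prod_of_nonneg fun _ _ => (Real.exp_pos _).le]

/-! ### A maximal inequality for the empirical process -/

open Classical in
/-- The number of the values `U i` that are at most `t`. -/
def countLe {ι : Type*} [Fintype ι] (U : ι → ℝ) (t : ℝ) : ℕ :=
  (Finset.univ.filter fun i => U i ≤ t).card

lemma measurable_countLe {ι : Type*} [Fintype ι] (t : ℝ) :
    Measurable fun U : ι → ℝ => countLe U t := by
  classical
  have : (fun U : ι → ℝ => countLe U t) = fun U => ∑ i, if U i ≤ t then 1 else 0 := by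
    ext U; simp only [countLe, Finset.card_filter]
  rw [this]
  exact Finset.measurable_sum _ fun i _ =>
    Measurable.ite (measurableSet_le (measurable_pi_apply i) measurable_const) (by fun_prop)
      (by fun_prop)

lemma countLe_mono {ι : Type*} [Fintype ι] (U : ι → ℝ) {s t : ℝ} (h : s ≤ t) :
    countLe U s ≤ countLe U t := by
  classical
  exact Finset.card_le_card fun i hi => by simp at hi ⊢; linarith

lemma countLe_max {ι : Type*} [Fintype ι] (U : ι → ℝ) {s t : ℝ} (h : s ≤ t) :
    countLe (fun i => max (U i) s) t = countLe U t := by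
  simp [countLe, h]

section Maximal

variable {ι : Type*} [Fintype ι] (μ : ι → Measure ℝ) [∀ i, IsProbabilityMeasure (μ i)]

/-- The step density used for the exponential change of measure. -/
def stepDensity (s : ℝ) (v : ℝ≥0∞) (u : ℝ) : ℝ≥0∞ := 1 + (Set.Iic s).indicator (fun _ => v) u

lemma measurable_stepDensity (s : ℝ) (v : ℝ≥0∞) : Measurable (stepDensity s v) :=
  (measurable_const.indicator measurableSet_Iic).const_add 1

lemma withDensity_stepDensity_apply (ν : Measure ℝ) (s : ℝ) (v : ℝ≥0∞) {E : Set ℝ}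
    (hE : MeasurableSet E) :
    ν.withDensity (stepDensity s v) E = ν E + v * ν (E ∩ Set.Iic s) := by
  rw [withDensity_apply _ hE]
  unfold stepDensity
  rw [lintegral_add_left measurable_const, setLIntegral_one,
    lintegral_indicator measurableSet_Iic, setLIntegral_const,
    Measure.restrict_apply measurableSet_Iic, Set.inter_comm]

lemma isFiniteMeasure_stepDensity (ν : Measure ℝ) [IsProbabilityMeasure ν] (s : ℝ) {v : ℝ≥0∞}
    (hv : v ≠ ∞) : IsFiniteMeasure (ν.withDensity (stepDensity s v)) := by
  constructor
  rw [withDensity_stepDensity_apply _ _ _ MeasurableSet.univ]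
  exact ENNReal.add_lt_top.2 ⟨measure_lt_top _ _, ENNReal.mul_lt_top hv.lt_top (measure_lt_top _ _)⟩

/-- Seen through max(u, t), all values up to t are merged into one atom, so only the total extra
mass v · ν(-∞, s] of the tilt matters. This is the martingale property of the tilted densities as t
decreases. -/
lemma map_max_stepDensity (ν : Measure ℝ) {s t : ℝ} (hst : s ≤ t) {v w : ℝ≥0∞}
    (hvw : v * ν (Set.Iic s) = w * ν (Set.Iic t)) :
    (ν.withDensity (stepDensity s v)).map (fun u => max u t) =
      (ν.withDensity (stepDensity t w)).map (fun u => max u t) := by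
  ext E hE
  have hm : Measurable fun u : ℝ => max u t := by fun_prop
  rw [Measure.map_apply hm hE, Measure.map_apply hm hE,
    withDensity_stepDensity_apply _ _ _ (hm hE), withDensity_stepDensity_apply _ _ _ (hm hE)]
  congr 1
  by_cases ht : t ∈ E
  · have h1 : ∀ r ≤ t, (fun u => max u t) ⁻¹' E ∩ Set.Iic r = Set.Iic r := by
      intro r hr
      refine Set.inter_eq_right.2 fun u hu => ?_
      have : u ≤ t := le_trans hu hr
      simpa [this] using ht
    rw [h1 s hst, h1 t le_rfl, hvw]
  · have h1 : ∀ r ≤ t, (fun u => max u t) ⁻¹' E ∩ Set.Iic r = ∅ := by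
      intro r hr
      ext u
      simp only [Set.mem_inter_iff, Set.mem_preimage, Set.mem_Iic, Set.mem_empty_iff_false,
        iff_false, not_and]
      intro hu hur
      rw [max_eq_right (le_trans hur hr)] at hu
      exact ht hu
    rw [h1 s hst, h1 t le_rfl]; simp

/-- An event that depends only on the values max(U i, t) may be evaluated with the tilt at t, whose
product density is (1 + w)^(number of values up to t). -/
lemma measure_mul_le_of_stopped {s t : ℝ} (hst : s ≤ t) {v w : ℝ≥0∞} (hv : v ≠ ∞) (hw : w ≠ ∞)
    (hvw : ∀ i, v * μ i (Set.Iic s) = w * μ i (Set.Iic t)) {A : Set (ι → ℝ)}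
    (hA : MeasurableSet A) (hAt : (fun (U : ι → ℝ) i => max (U i) t) ⁻¹' A = A) {k : ℕ}
    (hk : ∀ U ∈ A, k ≤ countLe U t) :
    (1 + w) ^ k * Measure.pi μ A ≤
      Measure.pi (fun i => (μ i).withDensity (stepDensity s v)) A := by
  classical
  have hs := fun i => isFiniteMeasure_stepDensity (μ i) s hv
  have ht := fun i => isFiniteMeasure_stepDensity (μ i) t hw
  have hm : Measurable fun (U : ι → ℝ) i => max (U i) t := by fun_prop
  have h1 : Measure.pi (fun i => (μ i).withDensity (stepDensity s v)) A =
      Measure.pi (fun i => (μ i).withDensity (stepDensity t w)) A := by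
    rw [← hAt, ← Measure.map_apply hm hA, ← Measure.map_apply hm hA,
      Measure.pi_map_pi (f := fun _ u => max u t) (fun i => by fun_prop),
      Measure.pi_map_pi (f := fun _ u => max u t) (fun i => by fun_prop)]
    simp_rw [fun i => map_max_stepDensity (μ i) hst (hvw i)]
  rw [h1, pi_withDensity μ (fun _ => stepDensity t w) (fun _ => measurable_stepDensity t w),
    withDensity_apply _ hA, ← setLIntegral_const]
  refine setLIntegral_mono' hA fun U hU => ?_
  have h2 : ∀ i, stepDensity t w (U i) = if U i ≤ t then 1 + w else 1 := by
    intro i; by_cases h : U i ≤ t <;> simp [stepDensity, h]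
  simp_rw [h2]
  rw [Finset.prod_ite, Finset.prod_const, Finset.prod_const_one, mul_one]
  exact pow_le_pow_right₀ (by simp) (by have := hk U hU; unfold countLe at this; convert this)

/-- Doob's argument in the direction of decreasing t. The union is split according to the largest t
in `G` at which the count reaches `k t`; this event only involves the count at t and at larger
points, so it is visible through max(U, t). One and the same tilted measure then dominates `B` times
each of these disjoint events, and its total mass is the right-hand side. -/
lemma maximal_inequality_finset {s : ℝ} {v : ℝ≥0∞} (hv : v ≠ ∞) (G : Finset ℝ)
    (hG : ∀ t ∈ G, s ≤ t) (w : ℝ → ℝ≥0∞) (hw : ∀ t ∈ G, w t ≠ ∞)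
    (hvw : ∀ t ∈ G, ∀ i, v * μ i (Set.Iic s) = w t * μ i (Set.Iic t)) (k : ℝ → ℕ) {B : ℝ≥0∞}
    (hB : ∀ t ∈ G, B ≤ (1 + w t) ^ k t) :
    B * Measure.pi μ {U | ∃ t ∈ G, k t ≤ countLe U t} ≤ ∏ i, (1 + v * μ i (Set.Iic s)) := by
  classical
  let A : ℝ → Set (ι → ℝ) := fun t =>
    {U | k t ≤ countLe U t} ∩ ⋂ t' ∈ G.filter (t < ·), {U | countLe U t' < k t'}
  have hAm : ∀ t, MeasurableSet (A t) := fun t =>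
    (measurableSet_le measurable_const (measurable_countLe t)).inter
      (Finset.measurableSet_biInter _ fun t' _ =>
        measurableSet_lt (measurable_countLe t') measurable_const)
  have hcov : {U : ι → ℝ | ∃ t ∈ G, k t ≤ countLe U t} = ⋃ t ∈ G, A t := by
    ext U
    simp only [Set.mem_ofPred_eq, Set.mem_iUnion, exists_prop]
    constructor
    · rintro ⟨t, ht, h⟩
      have hne : (G.filter fun t => k t ≤ countLe U t).Nonempty := ⟨t, by simp [ht, h]⟩
      have hmem := Finset.max'_mem _ hne
      rw [Finset.mem_filter] at hmem
      refine ⟨_, hmem.1, hmem.2, ?_⟩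
      simp only [Finset.mem_filter, Set.mem_iInter, Set.mem_ofPred_eq, and_imp]
      intro t' ht' hlt
      by_contra hcon
      exact absurd (Finset.le_max' _ t' (by simp [ht', not_lt.1 hcon])) (not_le.2 hlt)
    · rintro ⟨t, ht, h⟩
      exact ⟨t, ht, h.1⟩
  have hdisj : (G : Set ℝ).PairwiseDisjoint A := by
    have key : ∀ t ∈ G, ∀ t' ∈ G, t < t' → Disjoint (A t) (A t') := by
      intro t _ t' ht' hlt
      refine Set.disjoint_left.2 fun U h h' => ?_
      have := h.2
      simp only [Finset.mem_filter, Set.mem_iInter, Set.mem_ofPred_eq, and_imp] at this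
      exact absurd h'.1 (not_le.2 (this t' ht' hlt))
    intro t ht t' ht' hne
    rcases lt_or_gt_of_ne hne with h | h
    · exact key t ht t' ht' h
    · exact (key t' ht' t ht h).symm
  have hs := fun i => isFiniteMeasure_stepDensity (μ i) s hv
  set Q := Measure.pi (fun i => (μ i).withDensity (stepDensity s v)) with hQ
  rw [hcov, measure_biUnion_finset hdisj fun t _ => hAm t, Finset.mul_sum]
  calc ∑ t ∈ G, B * Measure.pi μ (A t) ≤ ∑ t ∈ G, Q (A t) := by
        refine Finset.sum_le_sum fun t ht => ?_
        refine (mul_le_mul_left (hB t ht) _).trans (measure_mul_le_of_stopped μ (hG t ht) hv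
          (hw t ht) (hvw t ht) (hAm t) ?_ fun U hU => hU.1)
        ext U
        simp only [A, Set.mem_preimage, Set.mem_inter_iff, Set.mem_ofPred_eq, Set.mem_iInter,
          Finset.mem_filter, and_imp, countLe_max U le_rfl]
        refine and_congr_right fun _ => forall_congr' fun t' => forall_congr' fun _ =>
          forall_congr' fun h => ?_
        rw [countLe_max U h.le]
    _ = Q (⋃ t ∈ G, A t) := (measure_biUnion_finset hdisj fun t _ => hAm t).symm
    _ ≤ Q Set.univ := measure_mono (Set.subset_univ _)
    _ = ∏ i, (1 + v * μ i (Set.Iic s)) := by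
        rw [hQ, Measure.pi_univ]
        refine Finset.prod_congr rfl fun i _ => ?_
        rw [withDensity_stepDensity_apply _ _ _ MeasurableSet.univ, measure_univ, Set.univ_inter]

end Maximal

/-- The rate function `y log y - y + 1` of the Poisson law. -/
def poissonRate (y : ℝ) : ℝ := y * Real.log y - y + 1

/-- Fenchel-Young inequality: the rate function is conjugate to e^l - 1. It is e^x ≥ 1 + x at x = l
- log y. -/
lemma young_poissonRate {y : ℝ} (hy : 0 < y) (l : ℝ) :
    l * y - (Real.exp l - 1) ≤ poissonRate y := by
  have h := Real.add_one_le_exp (l - Real.log y)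
  rw [Real.exp_sub, Real.exp_log hy, le_div_iff₀ hy] at h
  unfold poissonRate
  nlinarith

lemma exists_poissonRate_eq {c : ℝ} (hc : 0 ≤ c) : ∃ y, 1 ≤ y ∧ poissonRate y = c := by
  have hcont : ContinuousOn poissonRate (Set.Icc 1 (Real.exp (1 + c))) := by
    unfold poissonRate
    exact ((continuousOn_id.mul (Real.continuousOn_log.mono fun x hx => by
      simp at hx ⊢; linarith)).sub continuousOn_id).add continuousOn_const
  -- At the right endpoint the rate equals c e^(1 + c) + 1 ≥ c; at 1 it vanishes.
  have h1 : (1 : ℝ) ≤ Real.exp (1 + c) := Real.one_le_exp (by linarith)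
  obtain ⟨y, hy, h⟩ := intermediate_value_Icc h1 hcont (show c ∈ Set.Icc _ _ by
    constructor
    · simpa [poissonRate] using hc
    · simp only [poissonRate, Real.log_exp]
      nlinarith)
  exact ⟨y, hy.1, h⟩

/-! ### Exponential bounds for independent uniform variables -/

section Uniform

variable {ι : Type*} [Fintype ι] (μ : ι → Measure ℝ) [∀ i, IsProbabilityMeasure (μ i)]

/-- The tilt y - 1 at s corresponds to w = (y - 1) s / t at t. Bernoulli's inequality for the
exponent s / t ≤ 1 gives 1 + w ≥ y^(s/t), so a count of at least y N t yields the factor y^(s y N)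
whatever t is. The total mass is at most exp(N (y - 1) s), and the quotient of the two is exp(-N s
(y log y - y + 1)). -/
lemma maximal_inequality_real_finset (hμ : ∀ i t, 0 < t → t < 1 → (μ i).real (Set.Iic t) = t)
    {s b y : ℝ} (hs : 0 < s) (hb : b < 1) (hy : 1 ≤ y) (G : Finset ℝ)
    (hG : ∀ t ∈ G, t ∈ Set.Icc s b) :
    (Measure.pi μ).real {U | ∃ t ∈ G, y * Fintype.card ι * t ≤ countLe U t} ≤
      Real.exp (-(Fintype.card ι * s * poissonRate y)) := by
  rcases G.eq_empty_or_nonempty with rfl | ⟨t₀, ht₀⟩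
  · simpa using (Real.exp_pos _).le
  have hsb : s ≤ b := (hG t₀ ht₀).1.trans (hG t₀ ht₀).2
  set N : ℝ := (Fintype.card ι : ℝ) with hN
  have hN0 : 0 ≤ N := by positivity
  have hμ' : ∀ i t, 0 < t → t < 1 → μ i (Set.Iic t) = ENNReal.ofReal t := by
    intro i t h0 h1
    rw [← ofReal_measureReal, hμ i t h0 h1]
  have key := maximal_inequality_finset μ (s := s) (v := ENNReal.ofReal (y - 1)) (by simp) G
    (fun t ht => (hG t ht).1) (fun t => ENNReal.ofReal ((y - 1) * s / t)) (fun t _ => by simp)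
    (fun t ht i => by
      have h0 : 0 < t := hs.trans_le (hG t ht).1
      rw [hμ' i s hs (by linarith), hμ' i t h0 (by linarith [(hG t ht).2]),
        ← ENNReal.ofReal_mul (by linarith),
        ← ENNReal.ofReal_mul (by have := sub_nonneg.2 hy; positivity)]
      congr 1
      field_simp)
    (fun t => ⌈y * N * t⌉₊) (B := ENNReal.ofReal (y ^ (s * y * N))) (fun t ht => by
      have h0 : 0 < t := hs.trans_le (hG t ht).1
      have hw : 0 ≤ (y - 1) * s / t := by have := sub_nonneg.2 hy; positivity
      rw [← ENNReal.ofReal_one, ← ENNReal.ofReal_add zero_le_one hw,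
        ← ENNReal.ofReal_pow (by linarith)]
      refine ENNReal.ofReal_le_ofReal ?_
      have h1 : y ^ (s / t) ≤ 1 + (y - 1) * s / t := by
        have := rpow_one_add_le_one_add_mul_self (s := y - 1) (p := s / t) (by linarith)
          (by positivity) ((div_le_one h0).2 (hG t ht).1)
        rw [add_sub_cancel] at this
        refine this.trans_eq ?_
        ring
      calc y ^ (s * y * N) = (y ^ (s / t)) ^ (y * N * t) := by
            rw [← Real.rpow_mul (by linarith)]; congr 1; field_simp
        _ ≤ (1 + (y - 1) * s / t) ^ (y * N * t) :=
            Real.rpow_le_rpow (by positivity) h1 (by positivity)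
        _ ≤ (1 + (y - 1) * s / t) ^ ((⌈y * N * t⌉₊ : ℕ) : ℝ) :=
            Real.rpow_le_rpow_of_exponent_le (by linarith) (Nat.le_ceil _)
        _ = _ := Real.rpow_natCast _ _)
  have hset : {U : ι → ℝ | ∃ t ∈ G, y * N * t ≤ countLe U t} =
      {U | ∃ t ∈ G, ⌈y * N * t⌉₊ ≤ countLe U t} := by
    ext U; simp [Nat.ceil_le]
  rw [hset]
  have h2 : ∏ i, (1 + ENNReal.ofReal (y - 1) * μ i (Set.Iic s)) =
      ENNReal.ofReal ((1 + (y - 1) * s) ^ Fintype.card ι) := by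
    have : ∀ i, 1 + ENNReal.ofReal (y - 1) * μ i (Set.Iic s) =
        ENNReal.ofReal (1 + (y - 1) * s) := by
      intro i
      rw [hμ' i s hs (by linarith), ← ENNReal.ofReal_mul (by linarith),
        ENNReal.ofReal_add zero_le_one (mul_nonneg (by linarith) hs.le), ENNReal.ofReal_one]
    simp_rw [this]
    rw [Finset.prod_const, Finset.card_univ,
      ENNReal.ofReal_pow (by nlinarith)]
  rw [h2] at key
  have key2 := ENNReal.toReal_mono ENNReal.ofReal_ne_top key
  rw [ENNReal.toReal_mul, ENNReal.toReal_ofReal (by positivity),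
    ENNReal.toReal_ofReal (by have := sub_nonneg.2 hy; positivity)] at key2
  change y ^ (s * y * N) * (Measure.pi μ).real _ ≤ _ at key2
  have h3 : (1 + (y - 1) * s) ^ Fintype.card ι ≤ Real.exp (N * ((y - 1) * s)) := by
    rw [Real.exp_nat_mul]
    exact pow_le_pow_left₀ (by have := sub_nonneg.2 hy; positivity)
      (by linarith [Real.add_one_le_exp ((y - 1) * s)]) _
  have h4 : Real.exp (-(N * s * poissonRate y)) * y ^ (s * y * N) =
      Real.exp (N * ((y - 1) * s)) := by
    rw [Real.rpow_def_of_pos (by linarith), ← Real.exp_add]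
    congr 1; unfold poissonRate; ring
  have h5 : (0 : ℝ) < y ^ (s * y * N) := Real.rpow_pos_of_pos (by linarith) _
  refine le_of_mul_le_mul_left ?_ h5
  rw [mul_comm _ (Real.exp _), h4]
  exact key2.trans h3

/-- A maximal inequality for the empirical distribution function of independent uniform
variables. -/
lemma maximal_inequality (hμ : ∀ i t, 0 < t → t < 1 → (μ i).real (Set.Iic t) = t)
    {s b y : ℝ} (hs : 0 < s) (hsb : s ≤ b) (hb : b < 1) (hy : 1 ≤ y) :
    (Measure.pi μ).real {U | ∃ t ∈ Set.Icc s b, y * Fintype.card ι * t < countLe U t} ≤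
      Real.exp (-(Fintype.card ι * s * poissonRate y)) := by
  set N : ℝ := (Fintype.card ι : ℝ) with hN
  set D : Set ℝ := (Set.range ((↑) : ℚ → ℝ) ∩ Set.Icc s b) ∪ {b} with hD
  have hDc : D.Countable := ((Set.countable_range _).mono Set.inter_subset_left).union
    (Set.countable_singleton b)
  obtain ⟨e, he⟩ := hDc.exists_eq_range ⟨b, Or.inr rfl⟩
  have hemem : ∀ j, e j ∈ Set.Icc s b := by
    intro j
    have : e j ∈ D := he ▸ Set.mem_range_self j
    rcases this with h | h
    · exact h.2
    · rw [Set.mem_singleton_iff.1 h]; exact ⟨hsb, le_rfl⟩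
  have hsub : {U : ι → ℝ | ∃ t ∈ Set.Icc s b, y * N * t < countLe U t} ⊆
      ⋃ k : ℕ, {U | ∃ t ∈ (Finset.range k).image e, y * N * t ≤ countLe U t} := by
    rintro U ⟨t, ht, h⟩
    obtain ⟨t', ht', hle⟩ : ∃ t' ∈ D, y * N * t' ≤ countLe U t' := by
      rcases ht.2.eq_or_lt with rfl | hlt
      · exact ⟨t, Or.inr rfl, h.le⟩
      · have hN0 : 0 ≤ y * N := by positivity
        have hd : 0 < (countLe U t - y * N * t) / (y * N + 1) := div_pos (by linarith) (by linarith)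
        obtain ⟨r, h1, h2⟩ := exists_rat_btwn (lt_min hlt (lt_add_of_pos_right t hd))
        have h3 : (r : ℝ) < b := h2.trans_le (min_le_left _ _)
        have h4 : (r : ℝ) - t < (countLe U t - y * N * t) / (y * N + 1) := by
          linarith [h2.trans_le (min_le_right _ _)]
        refine ⟨r, Or.inl ⟨⟨r, rfl⟩, by linarith [ht.1], h3.le⟩, ?_⟩
        rw [lt_div_iff₀ (by linarith)] at h4
        have h5 : ((countLe U t : ℕ) : ℝ) ≤ countLe U (r : ℝ) := by
          exact_mod_cast countLe_mono U h1.le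
        nlinarith
    rw [he] at ht'
    obtain ⟨j, rfl⟩ := ht'
    exact Set.mem_iUnion.2 ⟨j + 1, e j, Finset.mem_image_of_mem e (by simp), hle⟩
  have hmono : Monotone fun k : ℕ =>
      {U : ι → ℝ | ∃ t ∈ (Finset.range k).image e, y * N * t ≤ countLe U t} := by
    rintro k l hkl U ⟨t, ht, h⟩
    exact ⟨t, Finset.image_subset_image (Finset.range_mono hkl) ht, h⟩
  refine (measureReal_mono hsub).trans ?_
  refine ENNReal.toReal_le_of_le_ofReal (Real.exp_pos _).le ?_
  rw [hmono.measure_iUnion]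
  refine iSup_le fun k => ?_
  rw [← ofReal_measureReal]
  refine ENNReal.ofReal_le_ofReal (maximal_inequality_real_finset μ hμ hs hb hy _ fun t ht => ?_)
  obtain ⟨j, _, rfl⟩ := Finset.mem_image.1 ht
  exact hemem j

/-- The empirical process of the values `U` exceeds the Poisson boundary of height `x`. -/
def Exceeds (U : ι → ℝ) (x : ℝ) : Prop :=
  ∃ t, 0 < t ∧ t ≤ 1 / 2 ∧ ∃ l, 0 ≤ l ∧
    x < l * countLe U t - (Real.exp l - 1) * (Fintype.card ι * t)

/-- The height y is chosen so that the Poisson rate at y equals x / (2sN). If the count stays below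
y N t on the block, duality bounds the functional by N t times the rate, hence by x since t ≤ 2s;
the maximal inequality pays exp(-N s · rate) = exp(-x/2). -/
lemma measure_exceeds_block_le (hμ : ∀ i t, 0 < t → t < 1 → (μ i).real (Set.Iic t) = t)
    {s x : ℝ} (hs : 0 < s) (hs2 : s ≤ 1 / 4) (hx : 0 ≤ x) :
    (Measure.pi μ).real {U | ∃ t ∈ Set.Icc s (2 * s), ∃ l, 0 ≤ l ∧
      x < l * countLe U t - (Real.exp l - 1) * (Fintype.card ι * t)} ≤ Real.exp (-(x / 2)) := by
  rcases Nat.eq_zero_or_pos (Fintype.card ι) with h0 | hpos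
  · have : {U : ι → ℝ | ∃ t ∈ Set.Icc s (2 * s), ∃ l, 0 ≤ l ∧
        x < l * countLe U t - (Real.exp l - 1) * (Fintype.card ι * t)} = ∅ := by
      ext U
      have : ∀ t, countLe U t = 0 := fun t => Nat.le_zero.1 (by
        rw [← h0]; exact Finset.card_le_univ _)
      simp [this, h0, hx]
    rw [this, measureReal_empty]
    exact (Real.exp_pos _).le
  set N : ℝ := (Fintype.card ι : ℝ) with hN
  have hN0 : 0 < N := Nat.cast_pos.2 hpos
  obtain ⟨y, hy1, hy⟩ := exists_poissonRate_eq (c := x / (2 * s * N)) (by positivity)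
  refine (measureReal_mono ?_).trans ((maximal_inequality μ hμ hs (by linarith : s ≤ 2 * s)
    (by linarith) hy1).trans_eq ?_)
  · rintro U ⟨t, ht, l, hl, h⟩
    refine ⟨t, ht, ?_⟩
    by_contra hcon
    rw [not_lt] at hcon
    have ht0 : 0 < t := hs.trans_le ht.1
    have h1 := young_poissonRate (y := y) (by linarith) l
    have h2 : l * countLe U t ≤ l * (y * N * t) := mul_le_mul_of_nonneg_left hcon hl
    have h3 : N * t * (l * y - (Real.exp l - 1)) ≤ N * t * poissonRate y :=
      mul_le_mul_of_nonneg_left h1 (by positivity)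
    have h4 : N * t * poissonRate y ≤ N * (2 * s) * poissonRate y := by
      have : 0 ≤ poissonRate y := by rw [hy]; positivity
      have := ht.2
      gcongr
    have h5 : N * (2 * s) * poissonRate y = x := by rw [hy]; field_simp
    nlinarith
  · rw [← hN, hy]; congr 1; field_simp

/-- Dyadic blocks from 1/2 down to 2^(-(M+1)), with a union bound. Below the last block an excess of
a nonnegative x requires at least one value there, which is controlled directly. -/
lemma measure_exceeds_le (hμ : ∀ i t, 0 < t → t < 1 → (μ i).real (Set.Iic t) = t)
    {x : ℝ} (hx : 0 ≤ x) (M : ℕ) :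
    (Measure.pi μ).real {U | Exceeds U x} ≤
      M * Real.exp (-(x / 2)) + Fintype.card ι * (1 / 2) ^ (M + 1) := by
  have hsub : {U : ι → ℝ | Exceeds U x} ⊆
      (⋃ k ∈ Finset.range M, {U | ∃ t ∈ Set.Icc ((1 / 2 : ℝ) ^ (k + 2)) (2 * (1 / 2) ^ (k + 2)),
        ∃ l, 0 ≤ l ∧ x < l * countLe U t - (Real.exp l - 1) * (Fintype.card ι * t)}) ∪
      ⋃ i ∈ Finset.univ, {U | U i ≤ (1 / 2) ^ (M + 1)} := by
    rintro U ⟨t, ht0, ht, l, hl, h⟩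
    by_cases hM : t ≤ (1 / 2) ^ (M + 1)
    · right
      have hpos : 0 < countLe U t := by
        by_contra hcon
        have h1 : countLe U t = 0 := by omega
        rw [h1] at h
        have h2 : 0 ≤ (Real.exp l - 1) * (Fintype.card ι * t) :=
          mul_nonneg (by linarith [Real.add_one_le_exp l]) (by positivity)
        simp only [Nat.cast_zero, mul_zero, zero_sub] at h
        linarith
      obtain ⟨i, hi⟩ := Finset.card_pos.1 hpos
      simp only [Finset.mem_filter, Finset.mem_univ, true_and] at hi
      simp only [Finset.mem_univ, Set.iUnion_true, Set.mem_iUnion, Set.mem_ofPred_eq]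
      exact ⟨i, hi.trans hM⟩
    · left
      rw [not_le] at hM
      have hex : ∃ k, (1 / 2 : ℝ) ^ (k + 2) < t := ⟨M, lt_of_le_of_lt
        (pow_le_pow_of_le_one (by norm_num) (by norm_num) (by omega)) hM⟩
      classical
      have hk := Nat.find_spec hex
      set k := Nat.find hex with hkdef
      have hk2 : t ≤ 2 * (1 / 2) ^ (k + 2) := by
        rcases Nat.eq_zero_or_pos k with h0 | hp
        · rw [h0]; norm_num; linarith
        · have := Nat.find_min hex (m := k - 1) (by omega)
          rw [not_lt] at this
          refine this.trans_eq ?_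
          obtain ⟨j, hj⟩ := Nat.exists_eq_succ_of_ne_zero hp.ne'
          rw [hj]; simp only [Nat.succ_sub_one, Nat.succ_eq_add_one]; ring
      have hkM : k < M := by
        by_contra hcon
        rw [not_lt] at hcon
        have h1 : (2 : ℝ) * (1 / 2) ^ (k + 2) = (1 / 2) ^ (k + 1) := by ring
        have h2 : (1 / 2 : ℝ) ^ (k + 1) ≤ (1 / 2) ^ (M + 1) :=
          pow_le_pow_of_le_one (by norm_num) (by norm_num) (by omega)
        linarith
      simp only [Finset.mem_range, Set.mem_iUnion, exists_prop]
      exact ⟨k, hkM, t, ⟨hk.le, hk2⟩, l, hl, h⟩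
  refine (measureReal_mono hsub).trans ((measureReal_union_le _ _).trans (add_le_add ?_ ?_))
  · refine (measureReal_biUnion_finset_le _ _).trans ?_
    refine (Finset.sum_le_card_nsmul _ _ (Real.exp (-(x / 2))) fun k _ =>
      measure_exceeds_block_le μ hμ (by positivity) ?_ hx).trans_eq (by simp)
    calc (1 / 2 : ℝ) ^ (k + 2) ≤ (1 / 2) ^ 2 :=
          pow_le_pow_of_le_one (by norm_num) (by norm_num) (by omega)
      _ = 1 / 4 := by norm_num
  · refine (measureReal_biUnion_finset_le _ _).trans ?_
    refine (Finset.sum_le_card_nsmul _ _ ((1 / 2 : ℝ) ^ (M + 1)) fun i _ => ?_).trans_eq (by simp)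
    have h1 : {U : ι → ℝ | U i ≤ (1 / 2) ^ (M + 1)} =
      (fun U : ι → ℝ => U i) ⁻¹' Set.Iic ((1 / 2) ^ (M + 1)) := rfl
    rw [h1, ← map_measureReal_apply (measurable_pi_apply i) measurableSet_Iic,
      show (fun U : ι → ℝ => U i) = Function.eval i from rfl, (measurePreserving_eval μ i).map_eq,
      hμ i _ (by positivity) (pow_lt_one₀ (by norm_num) (by norm_num) (by omega))]

end Uniform

/-! ### Deterministic bounds for the two statistics in terms of the counts -/

section OrderStatistics

variable {ι : Type*}

/-- The number of the `p a`, `a ∈ A`, that are at most `t`. -/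
def numLe (A : Finset ι) (p : ι → ℝ) (t : ℝ) : ℕ := (A.filter fun a => p a ≤ t).card

variable {A : Finset ι} {p : ι → ℝ}

lemma bddBelow_orderStat (hp : ∀ a ∈ A, 0 ≤ p a) {i : ℕ} (hi : 1 ≤ i) :
    BddBelow {t : ℝ | i ≤ numLe A p t} := by
  refine ⟨0, fun t ht => ?_⟩
  obtain ⟨a, ha⟩ := Finset.card_pos.1 (lt_of_lt_of_le hi ht)
  rw [Finset.mem_filter] at ha
  exact (hp a ha.1).trans ha.2

lemma orderStat_le (hp : ∀ a ∈ A, 0 ≤ p a) {i : ℕ} (hi : 1 ≤ i) {t : ℝ} (h : i ≤ numLe A p t) :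
    orderStat A p i ≤ t :=
  csInf_le (bddBelow_orderStat hp hi) h

lemma exists_numLe_eq_card (A : Finset ι) (p : ι → ℝ) : ∃ t, numLe A p t = A.card := by
  obtain ⟨t, ht⟩ := (A.finite_toSet.image p).bddAbove
  exact ⟨t, by rw [numLe, Finset.filter_true_of_mem fun a ha => ht (Set.mem_image_of_mem p ha)]⟩

/-- The infimum is attained: finitely many values leave a gap to the right of it, on which the count
is constant. -/
lemma le_numLe_orderStat {i : ℕ} (hiA : i ≤ A.card) :
    i ≤ numLe A p (orderStat A p i) := by
  set s := orderStat A p i with hs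
  obtain ⟨t₁, ht₁⟩ := exists_numLe_eq_card A p
  have hne : {t : ℝ | i ≤ numLe A p t}.Nonempty := ⟨t₁, by
    change i ≤ numLe A p t₁; rw [ht₁]; exact hiA⟩
  obtain ⟨m, hm, hgap⟩ : ∃ m, s < m ∧ ∀ a ∈ A, p a < m → p a ≤ s := by
    rcases (A.filter fun a => s < p a).eq_empty_or_nonempty with he | hn
    · refine ⟨s + 1, by linarith, fun a ha _ => ?_⟩
      by_contra hcon
      have : a ∈ A.filter fun a => s < p a := by simp [ha, not_le.1 hcon]
      rw [he] at this
      simp at this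
    · obtain ⟨a₀, ha₀, hmin⟩ := Finset.exists_min_image _ p hn
      refine ⟨p a₀, (Finset.mem_filter.1 ha₀).2, fun a ha hlt => ?_⟩
      by_contra hcon
      exact absurd (hmin a (by simp [ha, not_le.1 hcon])) (not_le.2 hlt)
  obtain ⟨t, ht, htm⟩ := exists_lt_of_csInf_lt hne hm
  refine le_trans ht (Finset.card_le_card fun a ha => ?_)
  rw [Finset.mem_filter] at ha ⊢
  exact ⟨ha.1, hgap a ha.1 (ha.2.trans_lt htm)⟩

lemma le_orderStat {η : ℝ} (hη : ∀ a ∈ A, η ≤ p a) {i : ℕ} (hi : 1 ≤ i)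
    (hiA : i ≤ A.card) : η ≤ orderStat A p i := by
  obtain ⟨a, ha⟩ := Finset.card_pos.1 (lt_of_lt_of_le hi (le_numLe_orderStat hiA))
  rw [Finset.mem_filter] at ha
  exact (hη a ha.1).trans ha.2

lemma orderStat_pos (hp : ∀ a ∈ A, 0 < p a) {i : ℕ} (hi : 1 ≤ i) (hiA : i ≤ A.card) :
    0 < orderStat A p i := by
  obtain ⟨a, ha⟩ := Finset.card_pos.1
    (lt_of_lt_of_le hi (le_numLe_orderStat hiA))
  rw [Finset.mem_filter] at ha
  exact (hp a ha.1).trans_le ha.2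

/-- A Poisson type control of the empirical distribution function of the values `p a`. -/
def PoissonBounded (A : Finset ι) (p : ι → ℝ) (x : ℝ) : Prop :=
  ∀ t, 0 < t → t ≤ 1 / 2 → ∀ l, 0 ≤ l →
    l * numLe A p t - (Real.exp l - 1) * (A.card * t) ≤ x

/-- For fixed t and l the functional is linear in the count and in the number of p-values, so it
adds up over classes without any independence between them. This is why l is kept free in
`PoissonBounded`. -/
lemma PoissonBounded.of_fiberwise {κ : Type*} [DecidableEq κ] {T : Finset κ} {f : ι → κ}
    (hf : ∀ a ∈ A, f a ∈ T) {x : ℝ}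
    (h : ∀ k ∈ T, PoissonBounded (A.filter fun a => f a = k) p x) :
    PoissonBounded A p (T.card * x) := by
  intro t ht ht2 l hl
  have h1 : numLe A p t = ∑ k ∈ T, numLe (A.filter fun a => f a = k) p t := by
    rw [numLe, Finset.card_eq_sum_card_fiberwise (f := f) (t := T)
      (fun a ha => hf a (Finset.mem_filter.1 ha).1)]
    refine Finset.sum_congr rfl fun k _ => ?_
    rw [numLe, Finset.filter_filter, Finset.filter_filter]
    simp_rw [and_comm]
  have h2 : A.card = ∑ k ∈ T, (A.filter fun a => f a = k).card :=
    Finset.card_eq_sum_card_fiberwise hf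
  rw [h1, h2]
  push_cast
  rw [Finset.mul_sum, Finset.sum_mul, Finset.mul_sum, ← Finset.sum_sub_distrib,
    ← nsmul_eq_mul]
  exact Finset.sum_le_card_nsmul _ _ _ fun k hk => h k hk t ht ht2 l hl

/-- From log(1 + x) ≥ 2x / (2 + x) at x = (u - q) / q. The factor u + q keeps the bound valid when u
is much larger than q, which is where small p-values live. -/
lemma sq_sub_le_mul {u q : ℝ} (hq : 0 < q) (hqu : q ≤ u) :
    (u - q) ^ 2 ≤ (u + q) * (u * Real.log (u / q) - u + q) := by
  have h := Real.le_log_one_add_of_nonneg (x := (u - q) / q) (div_nonneg (by linarith) hq.le)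
  have h1 : 1 + (u - q) / q = u / q := by field_simp; ring
  have h2 : 2 * ((u - q) / q) / ((u - q) / q + 2) = 2 * (u - q) / (u + q) := by
    have : (u - q) / q + 2 = (u + q) / q := by field_simp; ring
    rw [this]; field_simp
  rw [h1, h2, div_le_iff₀ (by linarith)] at h
  nlinarith [mul_le_mul_of_nonneg_left h (by linarith : 0 ≤ u)]

/-- The optimal multiplier l = log(u / q) at t = q, where q is the i-th order statistic and u = i /
N; at least i p-values are at most q. -/
lemma PoissonBounded.entropy_le {x : ℝ} (h : PoissonBounded A p x) (hp : ∀ a ∈ A, 0 < p a) {i : ℕ}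
    (hi : 1 ≤ i) (hi2 : i ≤ A.card / 2) (hlt : orderStat A p i < (i : ℝ) / A.card) :
    A.card * ((i : ℝ) / A.card * Real.log ((i : ℝ) / A.card / orderStat A p i) -
      (i : ℝ) / A.card + orderStat A p i) ≤ x := by
  have hiA : i ≤ A.card := by omega
  have hN : (0 : ℝ) < A.card := by exact_mod_cast (by omega : 0 < A.card)
  set q := orderStat A p i with hq
  have hq0 : 0 < q := orderStat_pos hp hi hiA
  have hi0 : (0 : ℝ) < i := by exact_mod_cast hi
  have hu : (i : ℝ) / A.card ≤ 1 / 2 := by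
    rw [div_le_div_iff₀ hN two_pos]
    have : i * 2 ≤ 1 * A.card := by omega
    exact_mod_cast this
  have hl : 0 ≤ Real.log ((i : ℝ) / A.card / q) :=
    Real.log_nonneg ((one_le_div hq0).2 hlt.le)
  have h1 := h q hq0 (by linarith) _ hl
  rw [Real.exp_log (by positivity)] at h1
  have h2 : (i : ℝ) ≤ numLe A p q := by
    exact_mod_cast le_numLe_orderStat hiA
  have h3 := mul_le_mul_of_nonneg_left h2 hl
  have h4 : ((i : ℝ) / A.card / q - 1) * (A.card * q) = i - A.card * q := by field_simp
  rw [h4] at h1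
  have h5 : (A.card : ℝ) * ((i : ℝ) / A.card * Real.log ((i : ℝ) / A.card / q) -
      (i : ℝ) / A.card + q) = Real.log ((i : ℝ) / A.card / q) * i - i + A.card * q := by
    field_simp
  linarith

lemma half_of_le {i N : ℕ} (hi : 1 ≤ i) (h : i ≤ N / 2) : (i : ℝ) / N ≤ 1 / 2 := by
  have hN : (0 : ℝ) < N := by exact_mod_cast (by omega : 0 < N)
  rw [div_le_div_iff₀ hN two_pos]
  have : i * 2 ≤ 1 * N := by omega
  exact_mod_cast this

/-- With u = i / N and q the order statistic, the second term of Berk-Jones satisfies (1 - u) log((1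
- u)/(1 - q)) ≤ q - u + 2(u - q)², because q < 1/2. As u + q ≤ 1, the square is at most the entropy
u log(u/q) - u + q, so the sum is at most three entropies. -/
lemma PoissonBounded.berkJones_le {x : ℝ} (h : PoissonBounded A p x) (hx : 0 ≤ x)
    (hp : ∀ a ∈ A, 0 < p a) : berkJones A p ≤ 3 * x := by
  -- With fewer than two p-values the index set is empty and the supremum is 0, whence the need for
  -- a nonnegative bound.
  refine Real.iSup_le (fun ⟨i, hi⟩ => ?_) (by linarith)
  rw [Finset.mem_Icc] at hi
  obtain ⟨hi1, hi2⟩ := hi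
  dsimp only
  split_ifs with hlt
  · have hN : (0 : ℝ) < A.card := by exact_mod_cast (by omega : 0 < A.card)
    have hent := h.entropy_le hp hi1 hi2 hlt
    have hu2 := half_of_le hi1 hi2
    set q := orderStat A p i with hq
    have hq0 : 0 < q := orderStat_pos hp hi1 (by omega)
    set u : ℝ := (i : ℝ) / A.card with hu
    have hiu : (i : ℝ) = A.card * u := by
      rw [hu, mul_div_assoc', mul_div_cancel_left₀ _ hN.ne']
    have hsq := sq_sub_le_mul hq0 hlt.le
    have hu0 : 0 < u := hq0.trans hlt
    have ha : 0 ≤ u * Real.log (u / q) - u + q :=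
      nonneg_of_mul_nonneg_right ((sq_nonneg _).trans hsq) (by linarith)
    have hlog : Real.log ((1 - u) / (1 - q)) ≤ (q - u) / (1 - q) := by
      refine (Real.log_le_sub_one_of_pos (div_pos (by linarith) (by linarith))).trans_eq ?_
      have : 1 - q ≠ 0 := by linarith
      field_simp
      ring
    have h1 : (i : ℝ) / (A.card * q) = u / q := by rw [hu, div_div]
    rw [h1, hiu]
    have h2 : (1 - u) * Real.log ((1 - u) / (1 - q)) ≤ q - u + 2 * (u - q) ^ 2 := by
      refine (mul_le_mul_of_nonneg_left hlog (by linarith)).trans ?_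
      rw [← mul_div_assoc, div_le_iff₀ (by linarith)]
      nlinarith [sq_nonneg (u - q)]
    have h3 : (u + q) * (u * Real.log (u / q) - u + q) ≤ u * Real.log (u / q) - u + q :=
      mul_le_of_le_one_left ha (by linarith)
    calc A.card * u * Real.log (u / q) + (A.card - A.card * u) * Real.log ((1 - u) / (1 - q))
        = A.card * (u * Real.log (u / q) + (1 - u) * Real.log ((1 - u) / (1 - q))) := by ring
      _ ≤ A.card * (3 * (u * Real.log (u / q) - u + q)) := by
          refine mul_le_mul_of_nonneg_left ?_ hN.le
          linarith
      _ ≤ 3 * x := by linarith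
  · linarith

/-- The squared statistic is at most 2 (u + q) x / q. Either u ≤ 2q, or the quadratic entropy bound
forces N u ≤ 6x and then u / q ≤ 6x / (Nη). The floor η on the p-values enters only in the second
case. -/
lemma PoissonBounded.higherCriticism_le {x η : ℝ} (h : PoissonBounded A p x) (hx : 0 ≤ x)
    (hη : 0 < η) (hp : ∀ a ∈ A, η ≤ p a) :
    higherCriticism A p ≤ √(2 * (3 + 6 * x / (A.card * η)) * x) := by
  have hp0 : ∀ a ∈ A, 0 < p a := fun a ha => hη.trans_le (hp a ha)
  refine Real.iSup_le (fun ⟨i, hi⟩ => ?_) (Real.sqrt_nonneg _)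
  rw [Finset.mem_Icc] at hi
  obtain ⟨hi1, hi2⟩ := hi
  dsimp only
  have hN : (0 : ℝ) < A.card := by exact_mod_cast (by omega : 0 < A.card)
  have hηq : η ≤ orderStat A p i := le_orderStat hp hi1 (by omega)
  rcases lt_or_ge (orderStat A p i) ((i : ℝ) / A.card) with hlt | hge
  · have hent := h.entropy_le hp0 hi1 hi2 hlt
    have hu2 := half_of_le hi1 hi2
    set q := orderStat A p i with hq
    have hq0 : 0 < q := orderStat_pos hp0 hi1 (by omega)
    set u : ℝ := (i : ℝ) / A.card with hu
    have hu0 : 0 < u := hq0.trans hlt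
    have hsq := sq_sub_le_mul hq0 hlt.le
    have h1 : A.card * (u - q) ^ 2 ≤ (u + q) * x := by
      calc A.card * (u - q) ^ 2
          ≤ A.card * ((u + q) * (u * Real.log (u / q) - u + q)) :=
            mul_le_mul_of_nonneg_left hsq hN.le
        _ = (u + q) * (A.card * (u * Real.log (u / q) - u + q)) := by ring
        _ ≤ (u + q) * x := mul_le_mul_of_nonneg_left hent (by linarith)
    have h2 : u / q ≤ 2 + 6 * x / (A.card * η) := by
      rcases le_or_gt u (2 * q) with hle | hgt
      · have : u / q ≤ 2 := (div_le_iff₀ hq0).2 hle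
        have : 0 ≤ 6 * x / (A.card * η) := by positivity
        linarith
      · have h3 : A.card * u ≤ 6 * x := by
          have h4 : A.card * (u / 2) ^ 2 ≤ (u + u / 2) * x := by
            refine le_trans ?_ (h1.trans ?_)
            · have : u / 2 ≤ u - q := by linarith
              gcongr
            · gcongr; linarith
          have h5 : u * (A.card * u) ≤ u * (6 * x) := by nlinarith
          exact le_of_mul_le_mul_left h5 hu0
        have h6 : u / q ≤ 6 * x / (A.card * η) := by
          rw [div_le_div_iff₀ hq0 (by positivity)]
          calc u * (A.card * η) = A.card * u * η := by ring
            _ ≤ 6 * x * q := by gcongr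
        linarith
    refine Real.le_sqrt_of_sq_le ?_
    rw [div_pow, mul_pow, Real.sq_sqrt hN.le, Real.sq_sqrt (mul_nonneg hq0.le (by linarith)),
      div_le_iff₀ (mul_pos hq0 (by linarith))]
    have h7 : (u + q) * x ≤ (3 + 6 * x / (A.card * η)) * x * q := by
      have : u + q ≤ (3 + 6 * x / (A.card * η)) * q := by
        have := (div_le_iff₀ hq0).1 h2
        linarith
      calc (u + q) * x ≤ ((3 + 6 * x / (A.card * η)) * q) * x := by gcongr
        _ = _ := by ring
    have h8 : 0 ≤ (3 + 6 * x / (A.card * η)) * x * q := by positivity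
    nlinarith
  · refine (div_nonpos_of_nonpos_of_nonneg ?_ (Real.sqrt_nonneg _)).trans (Real.sqrt_nonneg _)
    exact mul_nonpos_of_nonneg_of_nonpos (Real.sqrt_nonneg _) (by linarith)

/-- Only an upper bound t for the order statistic q is known. Replacing q by t loses nothing: u
log(t/q) ≥ t - q because u > t ≥ q, and (1 - u) log((1 - u)/(1 - q)) ≥ q - u, so the terms in q
cancel. -/
lemma le_berkJones (hp : ∀ a ∈ A, 0 < p a) {i : ℕ} (hi : 1 ≤ i) (hi2 : i ≤ A.card / 2) {t : ℝ}
    (hit : i ≤ numLe A p t) (ht : t < (i : ℝ) / A.card) :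
    A.card * ((i : ℝ) / A.card * Real.log ((i : ℝ) / A.card / t) - (i : ℝ) / A.card + t) ≤
      berkJones A p := by
  refine le_trans ?_ (le_ciSup (Set.finite_range _).bddAbove
    (⟨i, Finset.mem_Icc.2 ⟨hi, hi2⟩⟩ : Finset.Icc 1 (A.card / 2)))
  dsimp only
  have hN : (0 : ℝ) < A.card := by exact_mod_cast (by omega : 0 < A.card)
  have hu2 := half_of_le hi hi2
  have hqt : orderStat A p i ≤ t := orderStat_le (fun a ha => (hp a ha).le) hi hit
  rw [if_pos (hqt.trans_lt ht)]
  set q := orderStat A p i with hq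
  have hq0 : 0 < q := orderStat_pos hp hi (by omega)
  set u : ℝ := (i : ℝ) / A.card with hu
  have hiu : (i : ℝ) = A.card * u := by
      rw [hu, mul_div_assoc', mul_div_cancel_left₀ _ hN.ne']
  have ht0 : 0 < t := hq0.trans_le hqt
  have hu0 : 0 < u := ht0.trans ht
  have h1 : (i : ℝ) / (A.card * q) = u / q := by rw [hu, div_div]
  rw [h1, hiu]
  have h2 : q - u ≤ (1 - u) * Real.log ((1 - u) / (1 - q)) := by
    have := Real.one_sub_inv_le_log_of_pos (x := (1 - u) / (1 - q))
      (div_pos (by linarith) (by linarith))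
    have h3 : 1 - ((1 - u) / (1 - q))⁻¹ = (q - u) / (1 - u) := by
      have : 1 - u ≠ 0 := by linarith
      rw [inv_div]; field_simp; ring
    rw [h3, div_le_iff₀ (by linarith)] at this
    linarith
  have h4 : t - q ≤ u * Real.log (t / q) := by
    have := Real.one_sub_inv_le_log_of_pos (x := t / q) (by positivity)
    rw [inv_div] at this
    have h5 : t - q = t * (1 - q / t) := by
      rw [mul_sub, mul_one, mul_div_assoc', mul_div_cancel_left₀ _ ht0.ne']
    have h6 : 0 ≤ 1 - q / t := by rw [sub_nonneg, div_le_one ht0]; exact hqt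
    rw [h5]
    exact mul_le_mul ht.le this h6 hu0.le
  have h7 : Real.log (u / q) = Real.log (u / t) + Real.log (t / q) := by
    rw [← Real.log_mul (div_pos hu0 ht0).ne' (div_pos ht0 hq0).ne', div_mul_div_cancel₀ ht0.ne']
  calc A.card * (u * Real.log (u / t) - u + t)
      ≤ A.card * (u * Real.log (u / q) + (1 - u) * Real.log ((1 - u) / (1 - q))) := by
        refine mul_le_mul_of_nonneg_left ?_ hN.le
        rw [h7, mul_add]
        linarith
    _ = _ := by ring

lemma le_higherCriticism (hp : ∀ a ∈ A, 0 < p a) {i : ℕ} (hi : 1 ≤ i) (hi2 : i ≤ A.card / 2)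
    {t : ℝ} (hit : i ≤ numLe A p t) (ht : t < (i : ℝ) / A.card) :
    √(A.card : ℝ) * ((i : ℝ) / A.card - t) / √t ≤ higherCriticism A p := by
  refine le_trans ?_ (le_ciSup (Set.finite_range _).bddAbove
    (⟨i, Finset.mem_Icc.2 ⟨hi, hi2⟩⟩ : Finset.Icc 1 (A.card / 2)))
  dsimp only
  have hu2 := half_of_le hi hi2
  have hqt : orderStat A p i ≤ t := orderStat_le (fun a ha => (hp a ha).le) hi hit
  have hq0 : 0 < orderStat A p i := orderStat_pos hp hi (by omega)
  have h1 : 0 < orderStat A p i * (1 - orderStat A p i) := mul_pos hq0 (by linarith)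
  refine div_le_div₀ (mul_nonneg (Real.sqrt_nonneg _) (by linarith)) ?_ (Real.sqrt_pos.2 h1) ?_
  · exact mul_le_mul_of_nonneg_left (by linarith) (Real.sqrt_nonneg _)
  · exact Real.sqrt_le_sqrt (by nlinarith)

/-- The term i = 1 is at least -√(N q / (1 - q)), and the smallest p-value q is at most 1 - η. This
gives the lower side of the bound for the absolute value of the statistic. -/
lemma neg_le_higherCriticism (hp : ∀ a ∈ A, 0 < p a) {a : ι} (ha : a ∈ A) {η : ℝ} (hη : 0 < η)
    (hpa : p a ≤ 1 - η) : -√(A.card / η) ≤ higherCriticism A p := by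
  rcases lt_or_ge A.card 2 with h2 | h2
  · have : IsEmpty (Finset.Icc 1 (A.card / 2)) := by
      rw [Finset.isEmpty_coe_sort, Finset.Icc_eq_empty_iff]; omega
    rw [higherCriticism, Real.iSup_of_isEmpty]
    exact neg_nonpos.2 (Real.sqrt_nonneg _)
  refine le_trans ?_ (le_ciSup (Set.finite_range _).bddAbove
    (⟨1, Finset.mem_Icc.2 ⟨le_rfl, by omega⟩⟩ : Finset.Icc 1 (A.card / 2)))
  dsimp only
  have hqt : orderStat A p 1 ≤ p a := orderStat_le (fun a ha => (hp a ha).le) le_rfl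
    (Finset.card_pos.2 ⟨a, by simp [ha]⟩)
  have hq0 : 0 < orderStat A p 1 := orderStat_pos hp le_rfl (by omega)
  set q := orderStat A p 1
  have hs : 0 < √(q * (1 - q)) := Real.sqrt_pos.2 (mul_pos hq0 (by linarith))
  rw [le_div_iff₀ hs, neg_mul, ← Real.sqrt_mul (by positivity)]
  have h3 : √(A.card : ℝ) * q ≤ √(A.card / η * (q * (1 - q))) := by
    refine Real.le_sqrt_of_sq_le ?_
    rw [mul_pow, Real.sq_sqrt (Nat.cast_nonneg _)]
    have h4 : q ≤ (1 - q) / η := (le_div_iff₀ hη).2 (by nlinarith)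
    calc (A.card : ℝ) * q ^ 2 = A.card * q * q := by ring
      _ ≤ A.card * q * ((1 - q) / η) := by gcongr
      _ = _ := by ring
  have h5 : 0 ≤ √(A.card : ℝ) * (((1 : ℕ) : ℝ) / A.card) := by positivity
  nlinarith

end OrderStatistics

/-! ### Geometry of the balls -/

lemma PlaneNorm.l2_eval_eq_norm (a b : ℝ) :
    PlaneNorm.l2.eval a b = ‖(a + b * Complex.I : ℂ)‖ := by
  rw [Complex.norm_add_mul_I]; rfl

lemma PlaneNorm.abs_fst_le (q : PlaneNorm) (a b : ℝ) : |a| ≤ q.eval a b := by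
  cases q
  · exact le_add_of_nonneg_right (abs_nonneg b)
  · exact Real.abs_le_sqrt (by nlinarith [sq_nonneg b])

lemma PlaneNorm.abs_snd_le (q : PlaneNorm) (a b : ℝ) : |b| ≤ q.eval a b := by
  cases q
  · exact le_add_of_nonneg_left (abs_nonneg a)
  · exact Real.abs_le_sqrt (by nlinarith [sq_nonneg a])

lemma PlaneNorm.eval_le (q : PlaneNorm) (a b : ℝ) : q.eval a b ≤ |a| + |b| := by
  cases q
  · exact le_rfl
  · refine Real.sqrt_le_iff.2 ⟨by positivity, ?_⟩
    nlinarith [sq_abs a, sq_abs b, mul_nonneg (abs_nonneg a) (abs_nonneg b)]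

lemma PlaneNorm.eval_add_le (q : PlaneNorm) (a b c d : ℝ) :
    q.eval (a + c) (b + d) ≤ q.eval a b + q.eval c d := by
  cases q
  · simp only [PlaneNorm.eval]
    linarith [abs_add_le a c, abs_add_le b d]
  · simp only [PlaneNorm.l2_eval_eq_norm]
    refine le_trans (le_of_eq ?_) (norm_add_le _ _)
    congr 1; push_cast; ring

lemma PlaneNorm.eval_mul (q : PlaneNorm) (t a b : ℝ) :
    q.eval (t * a) (t * b) = |t| * q.eval a b := by
  cases q
  · simp only [PlaneNorm.eval, abs_mul]; ring
  · simp only [PlaneNorm.eval, mul_pow, ← mul_add]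
    rw [Real.sqrt_mul (sq_nonneg t), Real.sqrt_sq_eq_abs]

lemma PlaneNorm.eval_zero (q : PlaneNorm) : q.eval 0 0 = 0 := by
  simpa using q.eval_mul 0 0 0

lemma mem_ball {q : PlaneNorm} {n : ℕ} {c x : Site n} {r : ℝ} :
    x ∈ ball q c r ↔ q.eval (coord x.1 - coord c.1) (coord x.2 - coord c.2) < r := by
  simp [ball]

lemma ball_nonempty (q : PlaneNorm) {n : ℕ} (c : Site n) {r : ℝ} (hr : 0 < r) :
    (ball q c r).Nonempty :=
  ⟨c, by simpa [mem_ball, q.eval_zero] using hr⟩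

lemma abs_coord_sub_lt_of_not_disjoint {q : PlaneNorm} {n : ℕ} {c c' : Site n} {r r' : ℝ}
    (h : ¬Disjoint (ball q c r) (ball q c' r')) :
    |coord c.1 - coord c'.1| < r + r' ∧ |coord c.2 - coord c'.2| < r + r' := by
  rw [Finset.not_disjoint_iff] at h
  obtain ⟨x, h1, h2⟩ := h
  rw [mem_ball] at h1 h2
  constructor
  · have h3 := (q.abs_fst_le _ _).trans_lt h1
    have h4 := (q.abs_fst_le _ _).trans_lt h2
    rw [abs_lt] at *
    constructor <;> linarith
  · have h3 := (q.abs_snd_le _ _).trans_lt h1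
    have h4 := (q.abs_snd_le _ _).trans_lt h2
    rw [abs_lt] at *
    constructor <;> linarith

/-! ### Levels -/

/-- The reciprocal of the precision of a level. -/
def levelRate (n ℓ : ℕ) : ℝ := √(Real.logb 2 ((n : ℝ) ^ 2 / (2 : ℝ) ^ ((ℓ : ℝ) - 1)))

/-- The largest radius `2^{ℓ / 2}` of a level. -/
def maxRadius (ℓ : ℕ) : ℝ := √((2 : ℝ) ^ ℓ)

/-- The number of radii of a level. -/
def radiiCount (n ℓ : ℕ) : ℕ := ⌊levelRate n ℓ⌋₊ + 1

/-- The distance, in multiples of the spacing, beyond which balls of a level are disjoint. -/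
def separation (n ℓ : ℕ) : ℕ := ⌈2 * maxRadius ℓ / spacing n ℓ⌉₊

/-- The number of classes of pairwise disjoint balls into which a level is divided. -/
def classCount (n ℓ : ℕ) : ℕ := radiiCount n ℓ * separation n ℓ ^ 2

lemma precision_eq (n ℓ : ℕ) : precision n ℓ = 1 / levelRate n ℓ := rfl

lemma one_div_precision (n ℓ : ℕ) : 1 / precision n ℓ = levelRate n ℓ := by
  rw [precision_eq, one_div_one_div]

lemma two_rpow_sub_one (ℓ : ℕ) : (2 : ℝ) ^ ((ℓ : ℝ) - 1) = 2 ^ ℓ / 2 := by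
  rw [Real.rpow_sub two_pos, Real.rpow_natCast, Real.rpow_one]

lemma maxRadius_sq (ℓ : ℕ) : maxRadius ℓ ^ 2 = 2 ^ ℓ := Real.sq_sqrt (by positivity)

lemma one_le_maxRadius (ℓ : ℕ) : 1 ≤ maxRadius ℓ :=
  Real.one_le_sqrt.2 (one_le_pow₀ one_le_two)

lemma two_rpow_half (ℓ : ℕ) : (2 : ℝ) ^ (((ℓ : ℝ) - 1) / 2) = maxRadius ℓ / √2 := by
  rw [div_eq_mul_one_div, Real.rpow_mul zero_le_two, two_rpow_sub_one, ← Real.sqrt_eq_rpow,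
    Real.sqrt_div (by positivity)]
  rfl

section Level

variable {n ℓ : ℕ}

/-- The ceiling costs a factor 2 over n² / 8. For n ≥ 3 the logarithm is nonnegative, so the
natural-number ceiling does not truncate. -/
lemma four_mul_two_pow_le (hn : 3 ≤ n) (hℓ : ℓ ≤ levelMax n) : (4 : ℝ) * 2 ^ ℓ ≤ n ^ 2 := by
  have hn' : (3 : ℝ) ≤ n := by exact_mod_cast hn
  have h1 : (1 : ℝ) ≤ (n : ℝ) ^ 2 / 8 := by rw [le_div_iff₀ (by norm_num)]; nlinarith
  have h2 : (ℓ : ℝ) < Real.logb 2 ((n : ℝ) ^ 2 / 8) + 1 :=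
    lt_of_le_of_lt (Nat.cast_le.2 hℓ) (Nat.ceil_lt_add_one (Real.logb_nonneg one_lt_two h1))
  have h3 := Real.rpow_le_rpow_of_exponent_le (x := 2) one_le_two h2.le
  rw [Real.rpow_natCast, Real.rpow_add two_pos, Real.rpow_one,
    Real.rpow_logb two_pos (by norm_num) (by linarith)] at h3
  linarith

lemma levelRate_sq (hn : 3 ≤ n) (hℓ : ℓ ≤ levelMax n) :
    levelRate n ℓ ^ 2 = Real.logb 2 (2 * n ^ 2 / 2 ^ ℓ) := by
  have h := four_mul_two_pow_le hn hℓ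
  have h0 : (0 : ℝ) < 2 ^ ℓ := by positivity
  rw [levelRate, two_rpow_sub_one, div_div_eq_mul_div, mul_comm _ (2 : ℝ), Real.sq_sqrt]
  refine Real.logb_nonneg one_lt_two ?_
  rw [one_le_div h0]
  linarith

lemma three_le_levelRate_sq (hn : 3 ≤ n) (hℓ : ℓ ≤ levelMax n) : 3 ≤ levelRate n ℓ ^ 2 := by
  have h := four_mul_two_pow_le hn hℓ
  have h0 : (0 : ℝ) < 2 ^ ℓ := by positivity
  have h8 : (8 : ℝ) ≤ 2 * n ^ 2 / 2 ^ ℓ := by rw [le_div_iff₀ h0]; linarith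
  rw [levelRate_sq hn hℓ, Real.le_logb_iff_rpow_le one_lt_two (by linarith)]
  norm_num
  exact h8

lemma levelRate_nonneg : 0 ≤ levelRate n ℓ := Real.sqrt_nonneg _

lemma one_le_levelRate (hn : 3 ≤ n) (hℓ : ℓ ≤ levelMax n) : 1 ≤ levelRate n ℓ := by
  have := three_le_levelRate_sq hn hℓ
  have h0 : 0 ≤ levelRate n ℓ := levelRate_nonneg
  nlinarith

lemma levelRate_sq_le (hn : 3 ≤ n) (hℓ : ℓ ≤ levelMax n) :
    levelRate n ℓ ^ 2 ≤ Real.logb 2 (2 * n ^ 2) := by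
  rw [levelRate_sq hn hℓ]
  have hn' : (3 : ℝ) ≤ n := by exact_mod_cast hn
  refine Real.logb_le_logb_of_le one_lt_two (by positivity) ?_
  exact div_le_self (by positivity) (one_le_pow₀ one_le_two)

lemma radiiCount_le (hn : 3 ≤ n) (hℓ : ℓ ≤ levelMax n) :
    (radiiCount n ℓ : ℝ) ≤ 2 * levelRate n ℓ := by
  have := one_le_levelRate hn hℓ
  have := Nat.floor_le (levelRate_nonneg (n := n) (ℓ := ℓ))
  unfold radiiCount
  push_cast
  linarith

lemma one_le_radiiCount : 1 ≤ radiiCount n ℓ := by unfold radiiCount; omega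

lemma spacing_eq : spacing n ℓ = ⌈maxRadius ℓ / (√2 * levelRate n ℓ)⌉₊ := by
  rw [spacing, two_rpow_half, precision_eq, one_div_mul_eq_div, div_div]

lemma le_spacing : maxRadius ℓ / (√2 * levelRate n ℓ) ≤ spacing n ℓ := by
  rw [spacing_eq]; exact Nat.le_ceil _

lemma spacing_lt : (spacing n ℓ : ℝ) < maxRadius ℓ / (√2 * levelRate n ℓ) + 1 := by
  rw [spacing_eq]
  have := one_le_maxRadius ℓ
  exact Nat.ceil_lt_add_one (div_nonneg (by linarith)
    (mul_nonneg (Real.sqrt_nonneg _) levelRate_nonneg))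

lemma spacing_pos (hn : 3 ≤ n) (hℓ : ℓ ≤ levelMax n) : 0 < spacing n ℓ := by
  have := one_le_levelRate hn hℓ
  have := one_le_maxRadius ℓ
  rw [spacing_eq, Nat.ceil_pos]
  positivity

lemma spacing_le (hn : 3 ≤ n) (hℓ : ℓ ≤ levelMax n) : (spacing n ℓ : ℝ) ≤ 2 * maxRadius ℓ := by
  have h1 := one_le_levelRate hn hℓ
  have h2 := one_le_maxRadius ℓ
  have h3 : (1 : ℝ) ≤ √2 := Real.one_le_sqrt.2 one_le_two
  have h4 : maxRadius ℓ / (√2 * levelRate n ℓ) ≤ maxRadius ℓ :=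
    div_le_self (by linarith) (one_le_mul_of_one_le_of_one_le h3 h1)
  linarith [spacing_lt (n := n) (ℓ := ℓ)]

lemma separation_pos (hn : 3 ≤ n) (hℓ : ℓ ≤ levelMax n) : 0 < separation n ℓ := by
  have h0 : (0 : ℝ) < spacing n ℓ := by exact_mod_cast spacing_pos hn hℓ
  have := one_le_maxRadius ℓ
  rw [separation, Nat.ceil_pos]
  positivity

lemma two_mul_maxRadius_le (hn : 3 ≤ n) (hℓ : ℓ ≤ levelMax n) :
    2 * maxRadius ℓ ≤ separation n ℓ * spacing n ℓ := by
  have h0 : (0 : ℝ) < spacing n ℓ := by exact_mod_cast spacing_pos hn hℓ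
  rw [← div_le_iff₀ h0]
  exact Nat.le_ceil _

lemma separation_le (hn : 3 ≤ n) (hℓ : ℓ ≤ levelMax n) :
    (separation n ℓ : ℝ) ≤ 4 * maxRadius ℓ / spacing n ℓ := by
  have h0 : (0 : ℝ) < spacing n ℓ := by exact_mod_cast spacing_pos hn hℓ
  have h1 := one_le_maxRadius ℓ
  have h2 : (separation n ℓ : ℝ) < 2 * maxRadius ℓ / spacing n ℓ + 1 :=
    Nat.ceil_lt_add_one (by positivity)
  have h3 : 1 ≤ 2 * maxRadius ℓ / spacing n ℓ := (one_le_div h0).2 (spacing_le hn hℓ)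
  have h4 : 4 * maxRadius ℓ / spacing n ℓ = 2 * (2 * maxRadius ℓ / spacing n ℓ) := by ring
  linarith

lemma classCount_le (hn : 3 ≤ n) (hℓ : ℓ ≤ levelMax n) :
    (classCount n ℓ : ℝ) ≤ radiiCount n ℓ * (4 * maxRadius ℓ / spacing n ℓ) ^ 2 := by
  unfold classCount
  push_cast
  have := separation_le hn hℓ
  gcongr

/-- With L the level rate, there are at most 2L radii, and the separation is at most 4√2 L in each
of the two coordinates. -/
lemma classCount_le_levelRate (hn : 3 ≤ n) (hℓ : ℓ ≤ levelMax n) :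
    (classCount n ℓ : ℝ) ≤ 64 * levelRate n ℓ ^ 3 := by
  refine (classCount_le hn hℓ).trans ?_
  have h1 := one_le_levelRate hn hℓ
  have h2 := one_le_maxRadius ℓ
  have h0 : (0 : ℝ) < spacing n ℓ := by exact_mod_cast spacing_pos hn hℓ
  have h3 : maxRadius ℓ / spacing n ℓ ≤ √2 * levelRate n ℓ := by
    have := le_spacing (n := n) (ℓ := ℓ)
    rw [div_le_iff₀ (by positivity)] at this
    rw [div_le_iff₀ h0]
    linarith
  have h4 : (4 * maxRadius ℓ / spacing n ℓ) ^ 2 ≤ 32 * levelRate n ℓ ^ 2 := by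
    rw [mul_div_assoc, mul_pow]
    calc (4 : ℝ) ^ 2 * (maxRadius ℓ / spacing n ℓ) ^ 2 ≤ 4 ^ 2 * (√2 * levelRate n ℓ) ^ 2 := by
          gcongr
      _ = 32 * levelRate n ℓ ^ 2 := by rw [mul_pow, Real.sq_sqrt zero_le_two]; ring
  calc (radiiCount n ℓ : ℝ) * (4 * maxRadius ℓ / spacing n ℓ) ^ 2
      ≤ (2 * levelRate n ℓ) * (32 * levelRate n ℓ ^ 2) :=
        mul_le_mul (radiiCount_le hn hℓ) h4 (by positivity) (by positivity)
    _ = _ := by ring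

lemma radius_pos (i : ℕ) : 0 < radius n ℓ i := Real.sqrt_pos.2 (by positivity)

lemma radius_le_maxRadius (hn : 3 ≤ n) (hℓ : ℓ ≤ levelMax n) {i : ℕ} (hi : i < radiiCount n ℓ) :
    radius n ℓ i ≤ maxRadius ℓ := by
  have h1 := one_le_levelRate hn hℓ
  have hi' : (i : ℝ) ≤ levelRate n ℓ := by
    have : i ≤ ⌊levelRate n ℓ⌋₊ := by unfold radiiCount at hi; omega
    exact (Nat.cast_le.2 this).trans (Nat.floor_le levelRate_nonneg)
  refine Real.sqrt_le_sqrt ?_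
  rw [← Real.rpow_natCast]
  refine Real.rpow_le_rpow_of_exponent_le one_le_two ?_
  have : (i : ℝ) * precision n ℓ ≤ 1 := by
    rw [precision_eq, mul_one_div]; exact (div_le_one (by linarith)).2 hi'
  linarith

lemma mem_approxSet {b : ℕ × Site n} :
    b ∈ approxSet n ℓ ↔ b.1 < radiiCount n ℓ ∧ spacing n ℓ ∣ (b.2.1 : ℕ) + 1 ∧
      spacing n ℓ ∣ (b.2.2 : ℕ) + 1 ∧ InGrid (radius n ℓ b.1) b.2 := by
  classical
  simp [approxSet, radiiCount, ← one_div_precision]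

/-- The class of a ball of a level; the balls of a class are pairwise disjoint. -/
def ballClass (n ℓ : ℕ) (b : ℕ × Site n) : ℕ × ℕ × ℕ :=
  (b.1, ((b.2.1 : ℕ) + 1) / spacing n ℓ % separation n ℓ,
    ((b.2.2 : ℕ) + 1) / spacing n ℓ % separation n ℓ)

/-- The range of `ballClass`. -/
def ballClasses (n ℓ : ℕ) : Finset (ℕ × ℕ × ℕ) :=
  Finset.range (radiiCount n ℓ) ×ˢ Finset.range (separation n ℓ) ×ˢ Finset.range (separation n ℓ)

lemma card_ballClasses : (ballClasses n ℓ).card = classCount n ℓ := by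
  simp [ballClasses, classCount, sq]

lemma ballClass_mem (hn : 3 ≤ n) (hℓ : ℓ ≤ levelMax n) {b : ℕ × Site n}
    (hb : b ∈ approxSet n ℓ) : ballClass n ℓ b ∈ ballClasses n ℓ := by
  rw [mem_approxSet] at hb
  simp only [ballClasses, ballClass, Finset.mem_product, Finset.mem_range]
  exact ⟨hb.1, Nat.mod_lt _ (separation_pos hn hℓ), Nat.mod_lt _ (separation_pos hn hℓ)⟩

lemma le_abs_sub_of_mod_eq {d w a b : ℕ} (hd : 0 < d) (ha : d ∣ a) (hb : d ∣ b)
    (h : a / d % w = b / d % w) (hab : a ≠ b) : (w * d : ℝ) ≤ |(a : ℝ) - b| := by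
  obtain ⟨x, rfl⟩ := ha
  obtain ⟨y, rfl⟩ := hb
  rw [Nat.mul_div_cancel_left _ hd, Nat.mul_div_cancel_left _ hd] at h
  have hxy : x ≠ y := fun h => hab (by rw [h])
  have h1 : (w : ℤ) ∣ (x : ℤ) - y := by
    have : (y : ℤ) ≡ x [ZMOD w] := by exact_mod_cast h.symm
    exact this.dvd
  have h2 : (w : ℤ) ≤ |(x : ℤ) - y| :=
    Int.le_of_dvd (abs_pos.2 (by omega)) ((dvd_abs _ _).2 h1)
  have h3 : (w : ℝ) ≤ |(x : ℝ) - y| := by exact_mod_cast h2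
  push_cast
  rw [← mul_sub, abs_mul, abs_of_nonneg (Nat.cast_nonneg d : (0 : ℝ) ≤ d), mul_comm]
  gcongr

/-- Two distinct balls of a class have the same radius index, so some coordinate of their centres
differs, and then by at least separation times spacing, which is at least two maximal radii. -/
lemma disjoint_of_ballClass_eq (q : PlaneNorm) (hn : 3 ≤ n) (hℓ : ℓ ≤ levelMax n)
    {b b' : ℕ × Site n} (hb : b ∈ approxSet n ℓ) (hb' : b' ∈ approxSet n ℓ)
    (h : ballClass n ℓ b = ballClass n ℓ b') (hne : b ≠ b') :
    Disjoint (ball q b.2 (radius n ℓ b.1)) (ball q b'.2 (radius n ℓ b'.1)) := by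
  by_contra hcon
  obtain ⟨h1, h2⟩ := abs_coord_sub_lt_of_not_disjoint hcon
  rw [mem_approxSet] at hb hb'
  have hr := radius_le_maxRadius hn hℓ hb.1
  have hr' := radius_le_maxRadius hn hℓ hb'.1
  have hw := two_mul_maxRadius_le hn hℓ
  simp only [ballClass, Prod.mk.injEq] at h
  have hd := spacing_pos hn hℓ
  by_cases hj : b.2.1 = b'.2.1
  · by_cases hk : b.2.2 = b'.2.2
    · exact hne (Prod.ext h.1 (Prod.ext hj hk))
    · have := le_abs_sub_of_mod_eq hd hb.2.2.1 hb'.2.2.1 h.2.2 (by omega)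
      simp only [coord] at h2
      push_cast at this
      linarith
  · have := le_abs_sub_of_mod_eq hd hb.2.1 hb'.2.1 h.2.1 (by omega)
    simp only [coord] at h1
    push_cast at this
    linarith

open Classical in
-- Counts the neighbours in the dependency graph of a level: for each radius, the quotients of the
-- centre by the spacing lie in a window of fewer than two separations in each coordinate.
lemma card_not_disjoint_le (q : PlaneNorm) (hn : 3 ≤ n) (hℓ : ℓ ≤ levelMax n)
    {b : ℕ × Site n} (hb : b ∈ approxSet n ℓ) :
    ((approxSet n ℓ).filter fun b' =>
      ¬Disjoint (ball q b.2 (radius n ℓ b.1)) (ball q b'.2 (radius n ℓ b'.1))).card ≤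
      4 * classCount n ℓ := by
  have hd := spacing_pos hn hℓ
  have hd0 : (0 : ℝ) < spacing n ℓ := by exact_mod_cast hd
  set d := spacing n ℓ with hdd
  set w := separation n ℓ with hw
  set x := ((b.2.1 : ℕ) + 1) / d
  set y := ((b.2.2 : ℕ) + 1) / d
  have hcard : (Finset.range (radiiCount n ℓ) ×ˢ Finset.Ico (x + 1 - w) (x + w) ×ˢ
      Finset.Ico (y + 1 - w) (y + w)).card ≤ 4 * classCount n ℓ := by
    rw [Finset.card_product, Finset.card_product, Finset.card_range, Nat.card_Ico, Nat.card_Ico,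
      classCount]
    calc radiiCount n ℓ * ((x + w - (x + 1 - w)) * (y + w - (y + 1 - w)))
        ≤ radiiCount n ℓ * ((2 * w) * (2 * w)) := by
          gcongr <;> omega
      _ = _ := by rw [← hw]; ring
  refine le_trans (Finset.card_le_card_of_injOn
    (fun b' => (b'.1, ((b'.2.1 : ℕ) + 1) / d, ((b'.2.2 : ℕ) + 1) / d)) ?_ ?_) hcard
  · have key : ∀ a c : ℕ, d ∣ a → d ∣ c → |(a : ℝ) - c| < w * d →
        c / d ∈ Finset.Ico (a / d + 1 - w) (a / d + w) := by
      rintro a c ⟨u, rfl⟩ ⟨v, rfl⟩ h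
      rw [Nat.mul_div_cancel_left _ hd, Nat.mul_div_cancel_left _ hd, Finset.mem_Ico]
      push_cast at h
      rw [← mul_sub, abs_mul, abs_of_pos hd0, mul_comm] at h
      have h1 : |(u : ℝ) - v| < w := lt_of_mul_lt_mul_right h hd0.le
      have h2 : |(u : ℤ) - v| < w := by exact_mod_cast h1
      rw [abs_lt] at h2
      omega
    intro b' hb'
    simp only [Finset.coe_filter, Set.mem_ofPred_eq] at hb'
    obtain ⟨hb', hnd⟩ := hb'
    obtain ⟨h1, h2⟩ := abs_coord_sub_lt_of_not_disjoint hnd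
    rw [mem_approxSet] at hb hb'
    have hr := radius_le_maxRadius hn hℓ hb.1
    have hr' := radius_le_maxRadius hn hℓ hb'.1
    have hww := two_mul_maxRadius_le hn hℓ
    simp only [Finset.coe_product, Set.mem_prod, Finset.mem_coe, Finset.mem_range]
    refine ⟨hb'.1, key _ _ hb.2.1 hb'.2.1 ?_, key _ _ hb.2.2.1 hb'.2.2.1 ?_⟩
    · simp only [coord] at h1
      push_cast
      linarith
    · simp only [coord] at h2
      push_cast
      linarith
  · intro b₁ h₁ b₂ h₂ he
    simp only [Finset.coe_filter, Set.mem_ofPred_eq, mem_approxSet] at h₁ h₂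
    simp only [Prod.mk.injEq] at he
    have key : ∀ a c : ℕ, d ∣ a → d ∣ c → a / d = c / d → a = c := fun a c ha hc h => by
      rw [← Nat.div_mul_cancel ha, h, Nat.div_mul_cancel hc]
    have e1 := key _ _ h₁.1.2.1 h₂.1.2.1 he.2.1
    have e2 := key _ _ h₁.1.2.2.1 h₂.1.2.2.1 he.2.2
    exact Prod.ext he.1 (Prod.ext (Fin.ext (by omega)) (Fin.ext (by omega)))

end Level

open Classical in
/-- The indices of the coordinates in `[a, b]` that are multiples of `d`. -/
def multiplesIn (n d : ℕ) (a b : ℝ) : Finset (Fin n) :=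
  Finset.univ.filter fun j => d ∣ (j : ℕ) + 1 ∧ a ≤ coord j ∧ coord j ≤ b

lemma mem_multiplesIn {n d : ℕ} {a b : ℝ} {j : Fin n} :
    j ∈ multiplesIn n d a b ↔ d ∣ (j : ℕ) + 1 ∧ a ≤ coord j ∧ coord j ≤ b := by
  simp [multiplesIn]

lemma le_card_multiplesIn {n d : ℕ} (hd : 0 < d) {a b : ℝ} (ha : 0 < a) (hb : b ≤ n) :
    (b - a) / d - 1 ≤ (multiplesIn n d a b).card := by
  classical
  have hd0 : (0 : ℝ) < d := by exact_mod_cast hd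
  rcases le_or_gt b 0 with hb0 | hb0
  · have : (b - a) / d ≤ 0 := div_nonpos_of_nonpos_of_nonneg (by linarith) hd0.le
    have h2 : (0 : ℝ) ≤ (multiplesIn n d a b).card := Nat.cast_nonneg _
    linarith
  have hinj : (Finset.Icc ⌈a / d⌉₊ ⌊b / d⌋₊).card ≤ (multiplesIn n d a b).card := by
    have hm : ∀ m ∈ Finset.Icc ⌈a / d⌉₊ ⌊b / d⌋₊, 1 ≤ m * d ∧ m * d ≤ n ∧
        a ≤ (m * d : ℝ) ∧ (m * d : ℝ) ≤ b := by
      intro m hm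
      rw [Finset.mem_Icc, Nat.ceil_le, Nat.le_floor_iff (by positivity), div_le_iff₀ hd0,
        le_div_iff₀ hd0] at hm
      have h1 : (0 : ℝ) < (m * d : ℕ) := by push_cast; linarith [hm.1]
      refine ⟨by exact_mod_cast h1, ?_, hm.1, hm.2⟩
      have : ((m * d : ℕ) : ℝ) ≤ n := by push_cast; linarith [hm.2]
      exact_mod_cast this
    refine Finset.card_le_card_of_injOn
      -- Indices start at 0, so the coordinate m d has index m d - 1. The second branch never
      -- occurs, since 1 ≤ m d ≤ n on the interval.
      (fun m => if h : m * d - 1 < n then (⟨m * d - 1, h⟩ : Fin n) else ⟨0, by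
        rcases Nat.eq_zero_or_pos n with h0 | h0
        · exfalso; rw [h0] at hb; simp at hb; linarith
        · exact h0⟩) ?_ ?_
    · intro m hmem
      obtain ⟨h1, h2, h3, h4⟩ := hm m hmem
      have hlt : m * d - 1 < n := by omega
      simp only [hlt, dite_true, Finset.mem_coe, mem_multiplesIn, coord]
      rw [Nat.sub_add_cancel h1, Nat.cast_sub h1]
      push_cast
      exact ⟨dvd_mul_left _ _, by linarith, by linarith⟩
    · intro m hmem m' hmem' he
      obtain ⟨h1, h2, -, -⟩ := hm m hmem
      obtain ⟨h1', h2', -, -⟩ := hm m' hmem'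
      have hlt : m * d - 1 < n := by omega
      have hlt' : m' * d - 1 < n := by omega
      simp only [hlt, hlt', dite_true, Fin.mk.injEq] at he
      exact Nat.eq_of_mul_eq_mul_right hd (by omega)
  have h1 : (⌊b / d⌋₊ : ℝ) + 1 - ⌈a / d⌉₊ ≤ ((Finset.Icc ⌈a / d⌉₊ ⌊b / d⌋₊).card : ℝ) := by
    rw [Nat.card_Icc]
    have : (⌊b / d⌋₊ + 1 : ℕ) ≤ (⌊b / d⌋₊ + 1 - ⌈a / d⌉₊) + ⌈a / d⌉₊ := by omega
    have : ((⌊b / d⌋₊ + 1 : ℕ) : ℝ) ≤ ((⌊b / d⌋₊ + 1 - ⌈a / d⌉₊ : ℕ) : ℝ) + ⌈a / d⌉₊ := by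
      exact_mod_cast this
    push_cast at this
    linarith
  have h2 : ((Finset.Icc ⌈a / d⌉₊ ⌊b / d⌋₊).card : ℝ) ≤ (multiplesIn n d a b).card := by
    exact_mod_cast hinj
  have h3 := Nat.lt_floor_add_one (b / (d : ℝ))
  have h4 := Nat.ceil_lt_add_one (show 0 ≤ a / (d : ℝ) by positivity)
  rw [sub_div]
  linarith

/-! ### The number of balls of a level and its weight -/

section Level

variable {n ℓ : ℕ}

lemma card_approxSet_le (hn : 3 ≤ n) (hℓ : ℓ ≤ levelMax n) :
    ((approxSet n ℓ).card : ℝ) ≤ radiiCount n ℓ * (n / spacing n ℓ) ^ 2 := by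
  have hd := spacing_pos hn hℓ
  set d := spacing n ℓ with hdd
  have h1 : (approxSet n ℓ).card ≤ (Finset.range (radiiCount n ℓ) ×ˢ
      Finset.Icc 1 (n / d) ×ˢ Finset.Icc 1 (n / d)).card := by
    refine Finset.card_le_card_of_injOn
      (fun b => (b.1, ((b.2.1 : ℕ) + 1) / d, ((b.2.2 : ℕ) + 1) / d)) ?_ ?_
    · intro b hb
      rw [Finset.mem_coe, mem_approxSet] at hb
      simp only [Finset.coe_product, Set.mem_prod, Finset.mem_coe, Finset.mem_range,
        Finset.mem_Icc]
      have key : ∀ j : Fin n, d ∣ (j : ℕ) + 1 → 1 ≤ ((j : ℕ) + 1) / d ∧ ((j : ℕ) + 1) / d ≤ n / d :=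
        fun j hj => ⟨Nat.div_pos (Nat.le_of_dvd (by omega) hj) hd,
          Nat.div_le_div_right (by omega)⟩
      exact ⟨hb.1, key _ hb.2.1, key _ hb.2.2.1⟩
    · intro b₁ h₁ b₂ h₂ he
      rw [Finset.mem_coe, mem_approxSet] at h₁ h₂
      simp only [Prod.mk.injEq] at he
      have key : ∀ a c : ℕ, d ∣ a → d ∣ c → a / d = c / d → a = c := fun a c ha hc h => by
        rw [← Nat.div_mul_cancel ha, h, Nat.div_mul_cancel hc]
      have e1 := key _ _ h₁.2.1 h₂.2.1 he.2.1
      have e2 := key _ _ h₁.2.2.1 h₂.2.2.1 he.2.2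
      exact Prod.ext he.1 (Prod.ext (Fin.ext (by omega)) (Fin.ext (by omega)))
  simp only [Finset.card_product, Finset.card_range, Nat.card_Icc, Nat.add_sub_cancel] at h1
  have h2 : ((approxSet n ℓ).card : ℝ) ≤
      radiiCount n ℓ * (((n / d : ℕ) : ℝ) * ((n / d : ℕ) : ℝ)) := by
    exact_mod_cast h1
  have h3 : ((n / d : ℕ) : ℝ) ≤ n / d := Nat.cast_div_le
  rw [sq]
  refine h2.trans ?_
  gcongr

/-- A product family of balls of a level gives a lower bound for the size of the level. -/
lemma le_card_approxSet (hn : 3 ≤ n) (hℓ : ℓ ≤ levelMax n) (h64 : (64 : ℝ) * 2 ^ ℓ ≤ n ^ 2) :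
    radiiCount n ℓ * (n / (2 * spacing n ℓ) : ℝ) ^ 2 ≤ (approxSet n ℓ).card := by
  classical
  have hd := spacing_pos hn hℓ
  have hd0 : (0 : ℝ) < spacing n ℓ := by exact_mod_cast hd
  have hρ1 := one_le_maxRadius ℓ
  have hρ : 8 * maxRadius ℓ ≤ n := by
    rw [← maxRadius_sq] at h64
    have hn0 : (0 : ℝ) ≤ n := Nat.cast_nonneg n
    nlinarith
  have hdρ := spacing_le hn hℓ
  set d := spacing n ℓ
  set J := multiplesIn n d (maxRadius ℓ) (n - maxRadius ℓ) with hJ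
  have hJc : (n : ℝ) / (2 * d) ≤ J.card := by
    refine le_trans ?_ (le_card_multiplesIn hd (by linarith) (by linarith))
    rw [le_sub_iff_add_le, div_add_one (by positivity), div_le_div_iff₀ (by positivity) hd0]
    nlinarith
  have hsub : Finset.range (radiiCount n ℓ) ×ˢ J ×ˢ J ⊆ approxSet n ℓ := by
    intro b hb
    simp only [Finset.mem_product, Finset.mem_range, hJ, mem_multiplesIn] at hb
    rw [mem_approxSet]
    have hr := radius_le_maxRadius hn hℓ hb.1
    exact ⟨hb.1, hb.2.1.1, hb.2.2.1,
      ⟨by linarith [hb.2.1.2.1], by linarith [hb.2.1.2.2]⟩,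
      ⟨by linarith [hb.2.2.2.1], by linarith [hb.2.2.2.2]⟩⟩
  have hc := Finset.card_le_card hsub
  simp only [Finset.card_product, Finset.card_range] at hc
  have hc' : (radiiCount n ℓ : ℝ) * (J.card * J.card) ≤ (approxSet n ℓ).card := by
    exact_mod_cast hc
  refine le_trans ?_ hc'
  rw [sq]
  gcongr

/-- The number of classes of a level, times its weight in the structured statistics, is bounded. -/
lemma classCount_mul_le (hn : 3 ≤ n) (hℓ : ℓ ≤ levelMax n) (h : 0 < (approxSet n ℓ).card) :
    (classCount n ℓ : ℝ) * n ^ 2 ≤ 110592 * (2 ^ ℓ * (approxSet n ℓ).card) := by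
  have hd0 : (0 : ℝ) < spacing n ℓ := by exact_mod_cast spacing_pos hn hℓ
  -- If the radii are at most n / 8, a fixed proportion of the multiples of the spacing are
  -- admissible centres for every radius. Otherwise the level rate is at most 3, there are at most
  -- 64 · 3³ = 1728 classes, and a single ball in the level is enough: 110592 = 1728 · 64.
  rcases le_or_gt ((64 : ℝ) * 2 ^ ℓ) (n ^ 2) with h64 | h64
  · have h1 := le_card_approxSet hn hℓ h64
    have h2 := classCount_le hn hℓ
    have h4 : (radiiCount n ℓ : ℝ) * (4 * maxRadius ℓ / spacing n ℓ) ^ 2 * n ^ 2 =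
        64 * (2 ^ ℓ * (radiiCount n ℓ * (n / (2 * spacing n ℓ) : ℝ) ^ 2)) := by
      rw [div_pow, mul_pow, maxRadius_sq]
      field_simp
      ring
    calc (classCount n ℓ : ℝ) * n ^ 2
        ≤ radiiCount n ℓ * (4 * maxRadius ℓ / spacing n ℓ) ^ 2 * n ^ 2 := by gcongr
      _ ≤ 64 * (2 ^ ℓ * ((approxSet n ℓ).card : ℝ)) := by rw [h4]; gcongr
      _ ≤ _ := by gcongr; norm_num
  · have hE : levelRate n ℓ ^ 2 ≤ 9 := by
      rw [levelRate_sq hn hℓ]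
      have h0 : (0 : ℝ) < 2 ^ ℓ := by positivity
      have hn' : (0 : ℝ) < n := by exact_mod_cast (by omega : 0 < n)
      rw [Real.logb_le_iff_le_rpow one_lt_two (by positivity), div_le_iff₀ h0]
      norm_num
      linarith
    have hE0 : 0 ≤ levelRate n ℓ := levelRate_nonneg
    have hE3 : levelRate n ℓ ≤ 3 := by nlinarith
    have h1 : (classCount n ℓ : ℝ) ≤ 1728 := by
      refine (classCount_le_levelRate hn hℓ).trans ?_
      calc 64 * levelRate n ℓ ^ 3 ≤ 64 * 3 ^ 3 := by gcongr
        _ = 1728 := by norm_num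
    have h2 : (1 : ℝ) ≤ (approxSet n ℓ).card := by exact_mod_cast h
    calc (classCount n ℓ : ℝ) * n ^ 2 ≤ 1728 * (64 * 2 ^ ℓ) := by gcongr
      _ = 110592 * (2 ^ ℓ * 1) := by ring
      _ ≤ _ := by gcongr

end Level

/-! ### The null distribution -/

lemma countLe_subtype {ι : Type*} (A : Finset ι) (p : ι → ℝ) (t : ℝ) :
    countLe (fun a : A => p a) t = numLe A p t := by
  classical
  rw [countLe, numLe, ← Finset.card_map (Function.Embedding.subtype _)]
  congr 1
  ext a
  simp only [Finset.mem_map, Finset.mem_filter, Finset.mem_univ, true_and,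
    Function.Embedding.coe_subtype, Subtype.exists, exists_and_right, exists_eq_right]
  exact ⟨fun ⟨h1, h2⟩ => ⟨h1, h2⟩, fun ⟨h1, h2⟩ => ⟨h1, h2⟩⟩

lemma ballPValue_eq (q : PlaneNorm) {n : ℕ} (X : Site n → ℝ) (ℓ : ℕ) (b : ℕ × Site n) :
    ballPValue q X ℓ b = pValue (scan (ball q b.2 (radius n ℓ b.1)) X) := rfl

/-- Disjoint balls have independent, exactly uniform p-values, so their joint law is the product
measure to which the bound for uniforms applies. -/
lemma nullLaw_not_poissonBounded_le (q : PlaneNorm) {n ℓ : ℕ} (A : Finset (ℕ × Site n))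
    (hA : ∀ b ∈ A, ∀ b' ∈ A, b ≠ b' →
      Disjoint (ball q b.2 (radius n ℓ b.1)) (ball q b'.2 (radius n ℓ b'.1)))
    {x : ℝ} (hx : 0 ≤ x) (M : ℕ) :
    (nullLaw n).real {X | ¬PoissonBounded A (ballPValue q X ℓ) x} ≤
      M * Real.exp (-(x / 2)) + A.card * (1 / 2) ^ (M + 1) := by
  let U : A → (Site n → ℝ) → ℝ := fun b X => ballPValue q X ℓ b
  have hUm : ∀ b, Measurable (U b) := fun b =>
    measurable_pValue.comp (measurable_scan (ball q b.1.2 (radius n ℓ b.1.1)))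
  have hind : iIndepFun U (nullLaw n) := by
    have := iIndepFun_scan (fun _ => 0) (fun b : A => ball q b.1.2 (radius n ℓ b.1.1))
      (fun b b' h => hA b.1 b.2 b'.1 b'.2 (fun e => h (Subtype.ext e)))
    exact this.comp (fun _ => pValue) (fun _ => measurable_pValue)
  have hprob : ∀ b, IsProbabilityMeasure ((nullLaw n).map (U b)) := fun b =>
    Measure.isProbabilityMeasure_map (hUm b).aemeasurable
  have hlaw := (iIndepFun_iff_map_fun_eq_pi_map fun b => (hUm b).aemeasurable).1 hind
  have hunif : ∀ (b : A) t, 0 < t → t < 1 → ((nullLaw n).map (U b)).real (Set.Iic t) = t := by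
    intro b t h0 h1
    rw [map_measureReal_apply (hUm b) measurableSet_Iic]
    exact nullLaw_pValue_scan_le (ball_nonempty q _ (radius_pos _)) h0 h1
  have key := measure_exceeds_le (fun b => (nullLaw n).map (U b)) hunif hx M
  rw [Fintype.card_coe] at key
  refine le_trans ?_ key
  rw [← hlaw]
  have hsub : {X : Site n → ℝ | ¬PoissonBounded A (ballPValue q X ℓ) x} ⊆
      (fun X b => U b X) ⁻¹' {V | Exceeds V x} := by
    intro X hX
    simp only [PoissonBounded, Set.mem_ofPred_eq, not_forall, not_le] at hX
    obtain ⟨t, h1, h2, l, h3, h4⟩ := hX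
    refine ⟨t, h1, h2, l, h3, ?_⟩
    rw [Fintype.card_coe, countLe_subtype A (ballPValue q X ℓ)]
    exact h4
  refine (measureReal_mono hsub (measure_ne_top _ _)).trans ?_
  -- The exceedance set involves uncountably many t and l; the inequality between a preimage and its
  -- image measure holds without measurability.
  exact ENNReal.toReal_mono (measure_ne_top _ _)
    (Measure.le_map_apply (measurable_pi_lambda _ hUm).aemeasurable _)

/-- The bound `log₂ (2 n²)` for the squared precisions. -/
def logScale (n : ℕ) : ℝ := Real.logb 2 (2 * n ^ 2)

section Level

variable {n ℓ : ℕ}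

lemma three_le_logScale (hn : 3 ≤ n) : 3 ≤ logScale n :=
  (three_le_levelRate_sq hn (Nat.zero_le _)).trans (levelRate_sq_le hn (Nat.zero_le _))

lemma levelRate_le_logScale (hn : 3 ≤ n) (hℓ : ℓ ≤ levelMax n) : levelRate n ℓ ≤ logScale n := by
  have h1 := one_le_levelRate hn hℓ
  have h2 : levelRate n ℓ ^ 2 ≤ logScale n := levelRate_sq_le hn hℓ
  nlinarith

lemma classCount_le_logScale (hn : 3 ≤ n) (hℓ : ℓ ≤ levelMax n) :
    (classCount n ℓ : ℝ) ≤ 64 * logScale n ^ 2 := by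
  have h1 := one_le_levelRate hn hℓ
  have h2 : levelRate n ℓ ^ 2 ≤ logScale n := levelRate_sq_le hn hℓ
  have h3 := levelRate_le_logScale hn hℓ
  have h0 : 0 ≤ logScale n := by linarith
  refine (classCount_le_levelRate hn hℓ).trans ?_
  calc 64 * levelRate n ℓ ^ 3 = 64 * (levelRate n ℓ ^ 2 * levelRate n ℓ) := by ring
    _ ≤ 64 * (logScale n * logScale n) := by gcongr
    _ = _ := by ring

lemma levelMax_add_one_le (hn : 3 ≤ n) : ((levelMax n + 1 : ℕ) : ℝ) ≤ logScale n := by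
  have hn' : (3 : ℝ) ≤ n := by exact_mod_cast hn
  have h1 : (1 : ℝ) ≤ (n : ℝ) ^ 2 / 8 := by rw [le_div_iff₀ (by norm_num)]; nlinarith
  have h2 : (levelMax n : ℝ) < Real.logb 2 ((n : ℝ) ^ 2 / 8) + 1 :=
    Nat.ceil_lt_add_one (Real.logb_nonneg one_lt_two h1)
  have h3 : logScale n = Real.logb 2 ((n : ℝ) ^ 2 / 8) + 4 := by
    have h4 : (2 : ℝ) * n ^ 2 = n ^ 2 / 8 * 2 ^ (4 : ℕ) := by ring
    rw [logScale, h4, Real.logb_mul (by positivity) (by norm_num), Real.logb_pow,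
      Real.logb_self_eq_one one_lt_two]
    norm_num
  push_cast
  linarith

lemma card_approxSet_le_logScale (hn : 3 ≤ n) (hℓ : ℓ ≤ levelMax n) :
    ((approxSet n ℓ).card : ℝ) ≤ 2 * logScale n * n ^ 2 := by
  have hd0 : (1 : ℝ) ≤ spacing n ℓ := by exact_mod_cast spacing_pos hn hℓ
  have h1 : (n / spacing n ℓ : ℝ) ≤ n := div_le_self (Nat.cast_nonneg n) hd0
  refine (card_approxSet_le hn hℓ).trans ?_
  have h2 := (radiiCount_le hn hℓ).trans
    (mul_le_mul_of_nonneg_left (levelRate_le_logScale hn hℓ) zero_le_two)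
  have := three_le_logScale hn
  gcongr

end Level

lemma nullLaw_level_le (q : PlaneNorm) {n ℓ : ℕ} (hn : 3 ≤ n) (hℓ : ℓ ≤ levelMax n) {x : ℝ}
    (hx : 0 ≤ x) :
    (nullLaw n).real {X | ¬PoissonBounded (approxSet n ℓ) (ballPValue q X ℓ)
      (classCount n ℓ * x)} ≤
      192 * logScale n ^ 3 * Real.exp (-(x / 2)) + logScale n / (2 * n ^ 2) := by
  -- This many dyadic blocks give 2^(-M) ≤ (2n²)^(-2), so the event of a value below all blocks is
  -- negligible against the number of balls.
  set M := ⌈2 * logScale n⌉₊ with hM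
  have hΛ := three_le_logScale hn
  have hn' : (0 : ℝ) < n := by exact_mod_cast (by omega : 0 < n)
  have hsub : {X : Site n → ℝ | ¬PoissonBounded (approxSet n ℓ) (ballPValue q X ℓ)
      (classCount n ℓ * x)} ⊆ ⋃ k ∈ ballClasses n ℓ, {X | ¬PoissonBounded
        ((approxSet n ℓ).filter fun b => ballClass n ℓ b = k) (ballPValue q X ℓ) x} := by
    intro X hX
    by_contra hcon
    simp only [Set.mem_iUnion, not_exists, Set.mem_ofPred_eq, not_not] at hcon
    refine hX ?_
    rw [← card_ballClasses]
    exact PoissonBounded.of_fiberwise (fun b hb => ballClass_mem hn hℓ hb) hcon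
  refine (measureReal_mono hsub (measure_ne_top _ _)).trans
    ((measureReal_biUnion_finset_le _ _).trans ?_)
  refine (Finset.sum_le_sum fun k _ => nullLaw_not_poissonBounded_le q _ ?_ hx M).trans ?_
  · intro b hb b' hb' hne
    rw [Finset.mem_filter] at hb hb'
    exact disjoint_of_ballClass_eq q hn hℓ hb.1 hb'.1 (hb.2.trans hb'.2.symm) hne
  rw [Finset.sum_add_distrib, Finset.sum_const, card_ballClasses, nsmul_eq_mul, ← Finset.sum_mul]
  have h1 : ∑ k ∈ ballClasses n ℓ,
      (((approxSet n ℓ).filter fun b => ballClass n ℓ b = k).card : ℝ) = (approxSet n ℓ).card := by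
    exact_mod_cast (Finset.card_eq_sum_card_fiberwise
      (fun b hb => ballClass_mem hn hℓ hb)).symm
  rw [h1]
  have hM3 : (M : ℝ) ≤ 3 * logScale n := by
    have := Nat.ceil_lt_add_one (show 0 ≤ 2 * logScale n by linarith)
    linarith
  have hpow : (1 / 2 : ℝ) ^ (M + 1) ≤ 1 / (4 * n ^ 4) := by
    have h2 : (4 : ℝ) * n ^ 4 ≤ 2 ^ M := by
      have h3 := Real.rpow_le_rpow_of_exponent_le (x := 2) one_le_two (Nat.le_ceil (2 * logScale n))
      have h4 : (2 : ℝ) ^ (2 * logScale n) = 4 * n ^ 4 := by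
        rw [mul_comm, Real.rpow_mul zero_le_two, logScale,
          Real.rpow_logb two_pos (by norm_num) (by positivity), Real.rpow_two]
        ring
      rwa [h4, Real.rpow_natCast] at h3
    calc (1 / 2 : ℝ) ^ (M + 1) ≤ (1 / 2) ^ M :=
          pow_le_pow_of_le_one (by norm_num) (by norm_num) (by omega)
      _ = 1 / 2 ^ M := by rw [div_pow, one_pow]
      _ ≤ _ := one_div_le_one_div_of_le (by positivity) h2
  have hN := card_approxSet_le_logScale hn hℓ
  have hT := classCount_le_logScale hn hℓ
  refine add_le_add ?_ ?_
  · calc (classCount n ℓ : ℝ) * (M * Real.exp (-(x / 2)))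
        ≤ 64 * logScale n ^ 2 * (3 * logScale n * Real.exp (-(x / 2))) := by gcongr
      _ = _ := by ring
  · calc ((approxSet n ℓ).card : ℝ) * (1 / 2) ^ (M + 1)
        ≤ 2 * logScale n * n ^ 2 * (1 / (4 * n ^ 4)) := by gcongr
      _ = _ := by field_simp; ring

/-- All levels are simultaneously controlled by the height `x`. -/
def LevelsBounded (q : PlaneNorm) (n : ℕ) (x : ℝ) (X : Site n → ℝ) : Prop :=
  ∀ ℓ ≤ levelMax n, PoissonBounded (approxSet n ℓ) (ballPValue q X ℓ) (classCount n ℓ * x)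

lemma nullLaw_levels_le (q : PlaneNorm) {n : ℕ} (hn : 3 ≤ n) {x : ℝ} (hx : 0 ≤ x) :
    (nullLaw n).real {X | ¬LevelsBounded q n x X} ≤
      192 * logScale n ^ 4 * Real.exp (-(x / 2)) + logScale n ^ 2 / (2 * n ^ 2) := by
  have hsub : {X : Site n → ℝ | ¬LevelsBounded q n x X} ⊆ ⋃ ℓ ∈ Finset.range (levelMax n + 1),
      {X | ¬PoissonBounded (approxSet n ℓ) (ballPValue q X ℓ) (classCount n ℓ * x)} := by
    intro X hX
    simp only [LevelsBounded, Set.mem_ofPred_eq, not_forall] at hX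
    obtain ⟨ℓ, h1, h2⟩ := hX
    simp only [Set.mem_iUnion, Finset.mem_range, exists_prop]
    exact ⟨ℓ, by omega, h2⟩
  refine (measureReal_mono hsub (measure_ne_top _ _)).trans
    ((measureReal_biUnion_finset_le _ _).trans ?_)
  refine (Finset.sum_le_card_nsmul _ _ _ fun ℓ hℓ => nullLaw_level_le q hn
    (by rw [Finset.mem_range] at hℓ; omega) hx).trans ?_
  rw [Finset.card_range, nsmul_eq_mul]
  have hΛ := three_le_logScale hn
  refine (mul_le_mul_of_nonneg_right (levelMax_add_one_le hn) (by positivity)).trans_eq ?_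
  ring

lemma ballPValue_pos (q : PlaneNorm) {n : ℕ} (X : Site n → ℝ) (ℓ : ℕ) (b : ℕ × Site n) :
    0 < ballPValue q X ℓ b := pValue_pos _

/-- An empty level has weight 0 by division by zero, so it needs no separate assumption. -/
lemma weight_mul_classCount_le {n ℓ : ℕ} (hn : 3 ≤ n) (hℓ : ℓ ≤ levelMax n) :
    (n : ℝ) ^ 2 / (2 ^ ℓ * (approxSet n ℓ).card) * classCount n ℓ ≤ 110592 := by
  rcases Nat.eq_zero_or_pos (approxSet n ℓ).card with h0 | hpos
  · rw [h0]; norm_num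
  · have h := classCount_mul_le hn hℓ hpos
    have h1 : (0 : ℝ) < (approxSet n ℓ).card := by exact_mod_cast hpos
    rw [div_mul_eq_mul_div, div_le_iff₀ (by positivity)]
    linarith

lemma LevelsBounded.sBJ_le {q : PlaneNorm} {n : ℕ} (hn : 3 ≤ n) {x : ℝ} (hx : 0 ≤ x)
    {X : Site n → ℝ} (h : LevelsBounded q n x X) : sBJ q n X ≤ 331776 * x := by
  refine Finset.sup'_le _ _ fun ℓ hℓ => ?_
  have hℓ' : ℓ ≤ levelMax n := by rw [Finset.mem_range] at hℓ; omega
  have h1 := (h ℓ hℓ').berkJones_le (by positivity) fun b _ => ballPValue_pos q X ℓ b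
  have h2 := weight_mul_classCount_le hn hℓ'
  calc (n : ℝ) ^ 2 / (2 ^ ℓ * (approxSet n ℓ).card) *
        berkJones (approxSet n ℓ) (ballPValue q X ℓ)
      ≤ (n : ℝ) ^ 2 / (2 ^ ℓ * (approxSet n ℓ).card) * (3 * (classCount n ℓ * x)) := by gcongr
    _ = (n : ℝ) ^ 2 / (2 ^ ℓ * (approxSet n ℓ).card) * classCount n ℓ * (3 * x) := by ring
    _ ≤ 110592 * (3 * x) := by gcongr
    _ = _ := by ring

/-- No p-value of a level is smaller than the reciprocal of `log₂ (2 n²)² n_ℓ`. -/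
def NoSmallPValue (q : PlaneNorm) (n : ℕ) (X : Site n → ℝ) : Prop :=
  ∀ ℓ ≤ levelMax n, ∀ b ∈ approxSet n ℓ,
    1 / (logScale n ^ 2 * (approxSet n ℓ).card) ≤ ballPValue q X ℓ b

/-- By uniformity and a union bound each level contributes at most `logScale n`⁻², and there are at
most `logScale n` levels. -/
lemma nullLaw_not_noSmallPValue_le (q : PlaneNorm) {n : ℕ} (hn : 3 ≤ n) :
    (nullLaw n).real {X | ¬NoSmallPValue q n X} ≤ 1 / logScale n := by
  have hΛ := three_le_logScale hn
  have hsub : {X : Site n → ℝ | ¬NoSmallPValue q n X} ⊆ ⋃ ℓ ∈ Finset.range (levelMax n + 1),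
      ⋃ b ∈ approxSet n ℓ, {X | ballPValue q X ℓ b ≤
        1 / (logScale n ^ 2 * (approxSet n ℓ).card)} := by
    intro X hX
    simp only [NoSmallPValue, Set.mem_ofPred_eq, not_forall, not_le] at hX
    obtain ⟨ℓ, h1, b, hb, h2⟩ := hX
    simp only [Set.mem_iUnion, Finset.mem_range, exists_prop]
    exact ⟨ℓ, by omega, b, hb, h2.le⟩
  refine (measureReal_mono hsub (measure_ne_top _ _)).trans
    ((measureReal_biUnion_finset_le _ _).trans ?_)
  have hlev : ∀ ℓ ∈ Finset.range (levelMax n + 1), (nullLaw n).real (⋃ b ∈ approxSet n ℓ,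
      {X | ballPValue q X ℓ b ≤ 1 / (logScale n ^ 2 * (approxSet n ℓ).card)}) ≤
      1 / logScale n ^ 2 := by
    intro ℓ _
    rcases Nat.eq_zero_or_pos (approxSet n ℓ).card with h0 | hpos
    · rw [Finset.card_eq_zero.1 h0]; simp [sq_nonneg]
    have h1 : (1 : ℝ) ≤ (approxSet n ℓ).card := by exact_mod_cast hpos
    refine (measureReal_biUnion_finset_le _ _).trans ?_
    have hlt : 1 / (logScale n ^ 2 * (approxSet n ℓ).card) < 1 := by
      rw [div_lt_one (by positivity)]; nlinarith
    refine (Finset.sum_le_card_nsmul _ _ _ fun b _ => (nullLaw_pValue_scan_le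
      (ball_nonempty q b.2 (radius_pos b.1)) (by positivity) hlt).le).trans_eq ?_
    rw [nsmul_eq_mul]
    field_simp
  refine (Finset.sum_le_card_nsmul _ _ _ hlev).trans ?_
  rw [Finset.card_range, nsmul_eq_mul]
  refine (mul_le_mul_of_nonneg_right (levelMax_add_one_le hn) (by positivity)).trans_eq ?_
  field_simp

/-- The floor 1 / (Λ² n_ℓ), with Λ = `logScale n`, contributes Λ² and the number of classes another
64 Λ². The square of the bound is therefore of order Λ⁴ x², which for x of order log log n is below
log⁵ n. -/
lemma LevelsBounded.sHC_le {q : PlaneNorm} {n : ℕ} (hn : 3 ≤ n) {x : ℝ} (hx : 0 ≤ x)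
    {X : Site n → ℝ} (h : LevelsBounded q n x X) (hs : NoSmallPValue q n X) :
    sHC q n X ≤ √(221184 * x * (3 + 384 * logScale n ^ 4 * x)) := by
  have hΛ := three_le_logScale hn
  refine Finset.sup'_le _ _ fun ℓ hℓ => ?_
  have hℓ' : ℓ ≤ levelMax n := by rw [Finset.mem_range] at hℓ; omega
  rcases Nat.eq_zero_or_pos (approxSet n ℓ).card with h0 | hpos
  · rw [h0]
    simp
  have h1 : (1 : ℝ) ≤ (approxSet n ℓ).card := by exact_mod_cast hpos
  have h2 := (h ℓ hℓ').higherCriticism_le (by positivity) (by positivity) (hs ℓ hℓ')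
  have h3 := weight_mul_classCount_le hn hℓ'
  refine (mul_le_mul_of_nonneg_left h2 (Real.sqrt_nonneg _)).trans ?_
  rw [← Real.sqrt_mul (by positivity)]
  refine Real.sqrt_le_sqrt ?_
  have h4 : 6 * (classCount n ℓ * x) / ((approxSet n ℓ).card *
      (1 / (logScale n ^ 2 * (approxSet n ℓ).card))) ≤ 384 * logScale n ^ 4 * x := by
    have : ((approxSet n ℓ).card : ℝ) * (1 / (logScale n ^ 2 * (approxSet n ℓ).card)) =
        1 / logScale n ^ 2 := by field_simp
    rw [this, div_div_eq_mul_div, div_one]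
    have := classCount_le_logScale hn hℓ'
    calc 6 * (classCount n ℓ * x) * logScale n ^ 2
        ≤ 6 * (64 * logScale n ^ 2 * x) * logScale n ^ 2 := by gcongr
      _ = _ := by ring
  calc _ = 2 * (3 + 6 * (classCount n ℓ * x) / ((approxSet n ℓ).card *
      (1 / (logScale n ^ 2 * (approxSet n ℓ).card)))) * x *
        ((n : ℝ) ^ 2 / (2 ^ ℓ * (approxSet n ℓ).card) * classCount n ℓ) := by ring
    _ ≤ 2 * (3 + 384 * logScale n ^ 4 * x) * x * 110592 := by gcongr
    _ = _ := by ring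

/-- The top level alone prevents very negative values: one of its p-values is at most 1 - η with
probability 1 - η, and there n² / 2^ℓ ≤ 8. The constant 256 is the bound on its number of balls. -/
lemma nullLaw_sHC_lt_le (q : PlaneNorm) {n : ℕ} (hn : 3 ≤ n) {η : ℝ} (hη : 0 < η) (hη1 : η < 1) :
    (nullLaw n).real {X | sHC q n X < -√(8 * (256 / η))} ≤ η := by
  have hn' : (3 : ℝ) ≤ n := by exact_mod_cast hn
  set ℓ := levelMax n with hℓdef
  have hmem : ℓ ∈ Finset.range (levelMax n + 1) := by simp [hℓdef]
  have h2ℓ : (n : ℝ) ^ 2 ≤ 8 * 2 ^ ℓ := by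
    have h1 := Real.rpow_le_rpow_of_exponent_le (x := 2) one_le_two
      (Nat.le_ceil (Real.logb 2 ((n : ℝ) ^ 2 / 8)))
    rw [Real.rpow_logb two_pos (by norm_num) (by positivity), Real.rpow_natCast] at h1
    change _ ≤ (2 : ℝ) ^ ℓ at h1
    linarith
  rcases (approxSet n ℓ).eq_empty_or_nonempty with he | ⟨b, hb⟩
  · have : {X : Site n → ℝ | sHC q n X < -√(8 * (256 / η))} = ∅ := by
      ext X
      simp only [Set.mem_ofPred_eq, Set.mem_empty_iff_false, iff_false, not_lt]
      refine le_trans ?_ (Finset.le_sup' _ hmem)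
      rw [he]
      simp only [Finset.card_empty, Nat.cast_zero, mul_zero, div_zero, Real.sqrt_zero, zero_mul]
      exact neg_nonpos.2 (Real.sqrt_nonneg _)
    rw [this]; simpa using hη.le
  · have hc : 0 < (approxSet n ℓ).card := Finset.card_pos.2 ⟨b, hb⟩
    have hc0 : (0 : ℝ) < (approxSet n ℓ).card := by exact_mod_cast hc
    -- At the top level the level rate is at most 2: at most 4 radii, and n divided by the spacing
    -- is at most 8.
    have hN : ((approxSet n ℓ).card : ℝ) ≤ 256 := by
      have hE0 := levelRate_sq hn (le_refl ℓ)
      have hE : levelRate n ℓ ^ 2 ≤ 4 := by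
        rw [hE0, Real.logb_le_iff_le_rpow one_lt_two (by positivity), div_le_iff₀ (by positivity)]
        norm_num
        linarith
      have hE2 : levelRate n ℓ ≤ 2 := by nlinarith [levelRate_nonneg (n := n) (ℓ := ℓ)]
      have hE1 := one_le_levelRate hn (le_refl ℓ)
      have hd := le_spacing (n := n) (ℓ := ℓ)
      have hρ := one_le_maxRadius ℓ
      have hd0 : (0 : ℝ) < spacing n ℓ := by exact_mod_cast spacing_pos hn (le_refl ℓ)
      have hns : (n / spacing n ℓ : ℝ) ^ 2 ≤ 64 := by
        rw [div_pow, div_le_iff₀ (by positivity)]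
        rw [div_le_iff₀ (by positivity)] at hd
        have h1 : (2 : ℝ) ^ ℓ ≤ (spacing n ℓ : ℝ) ^ 2 * (2 * levelRate n ℓ ^ 2) := by
          rw [← maxRadius_sq]
          calc maxRadius ℓ ^ 2 ≤ (spacing n ℓ * (√2 * levelRate n ℓ)) ^ 2 := by gcongr
            _ = _ := by rw [mul_pow, mul_pow, Real.sq_sqrt zero_le_two]
        nlinarith [sq_nonneg (spacing n ℓ : ℝ)]
      refine (card_approxSet_le hn (le_refl ℓ)).trans ?_
      have := radiiCount_le hn (le_refl ℓ)
      calc (radiiCount n ℓ : ℝ) * (n / spacing n ℓ : ℝ) ^ 2 ≤ 4 * 64 := by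
            gcongr; linarith
        _ = 256 := by norm_num
    have hsub : {X : Site n → ℝ | sHC q n X < -√(8 * (256 / η))} ⊆
        {X | pValue (scan (ball q b.2 (radius n ℓ b.1)) X) ≤ 1 - η}ᶜ := by
      intro X hX hp
      have hX' : sHC q n X < _ := hX
      refine absurd hX' (not_lt.2 ?_)
      refine le_trans ?_ (Finset.le_sup' _ hmem)
      have h1 := neg_le_higherCriticism (fun b _ => ballPValue_pos q X ℓ b) hb hη hp
      have h2 : √((n : ℝ) ^ 2 / (2 ^ ℓ * (approxSet n ℓ).card)) *
          √((approxSet n ℓ).card / η) ≤ √(8 * (256 / η)) := by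
        rw [← Real.sqrt_mul (by positivity)]
        refine Real.sqrt_le_sqrt ?_
        have h3 : (n : ℝ) ^ 2 / (2 ^ ℓ * (approxSet n ℓ).card) * ((approxSet n ℓ).card / η) =
            n ^ 2 / 2 ^ ℓ * (1 / η) := by field_simp
        rw [h3]
        have h4 : (n : ℝ) ^ 2 / 2 ^ ℓ ≤ 8 := (div_le_iff₀ (by positivity)).2 h2ℓ
        have h5 : 1 / η ≤ 256 / η := by gcongr; norm_num
        gcongr
      calc -√(8 * (256 / η)) ≤ √((n : ℝ) ^ 2 / (2 ^ ℓ * (approxSet n ℓ).card)) *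
            -√((approxSet n ℓ).card / η) := by linarith
        _ ≤ _ := mul_le_mul_of_nonneg_left h1 (Real.sqrt_nonneg _)
    refine (measureReal_mono hsub (measure_ne_top _ _)).trans ?_
    rw [probReal_compl_eq_one_sub, nullLaw_pValue_scan_le (ball_nonempty q _ (radius_pos _))
      (by linarith) (by linarith)]
    · linarith
    · exact measurableSet_le (measurable_pValue.comp (measurable_scan _)) measurable_const

/-! ### Limits under the null hypothesis -/

lemma tendsto_log_natCast : Tendsto (fun n : ℕ => Real.log n) atTop atTop :=
  Real.tendsto_log_atTop.comp tendsto_natCast_atTop_atTop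

lemma logScale_le {n : ℕ} (hn : 3 ≤ n) : logScale n ≤ 5 * Real.log n := by
  have hn' : (3 : ℝ) ≤ n := by exact_mod_cast hn
  have hl : 0 < Real.log n := Real.log_pos (by linarith)
  have h2 := Real.log_two_gt_d9
  have h3 : Real.log (2 * (n : ℝ) ^ 2) ≤ 3 * Real.log n := by
    rw [Real.log_mul two_ne_zero (by positivity), Real.log_pow]
    have := Real.log_le_log two_pos (by linarith : (2 : ℝ) ≤ n)
    push_cast
    linarith
  rw [logScale, Real.logb, div_le_iff₀ (by linarith)]
  nlinarith

/-- The height 10 log log n gives exp(-x/2) = log⁻⁵ n, one power more than the factor of order log⁴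
n from classes, blocks and levels. -/
lemma tendsto_nullLaw_not_levelsBounded (q : PlaneNorm) :
    Tendsto (fun n => (nullLaw n).real
      {X | ¬LevelsBounded q n (10 * Real.log (Real.log n)) X}) atTop (𝓝 0) := by
  have h1 : Tendsto (fun n : ℕ => 120000 * (Real.log n)⁻¹ + 25 / 2 * (Real.log n / n) ^ 2)
      atTop (𝓝 (120000 * 0 + 25 / 2 * 0 ^ 2)) := by
    refine (tendsto_log_natCast.inv_tendsto_atTop.const_mul _).add (Tendsto.const_mul _ ?_)
    exact ((Real.isLittleO_log_id_atTop.tendsto_div_nhds_zero).comp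
      tendsto_natCast_atTop_atTop).pow 2
  norm_num at h1
  refine squeeze_zero' (Eventually.of_forall fun n => measureReal_nonneg) ?_ h1
  filter_upwards [eventually_ge_atTop 3, tendsto_log_natCast.eventually_ge_atTop 1] with n hn hL
  have hn' : (3 : ℝ) ≤ n := by exact_mod_cast hn
  refine (nullLaw_levels_le q hn (by have := Real.log_nonneg hL; linarith)).trans ?_
  have hΛ := logScale_le hn
  have hΛ0 := three_le_logScale hn
  have he : Real.exp (-(10 * Real.log (Real.log n) / 2)) = ((Real.log n) ^ 5)⁻¹ := by
    have h0 : -(10 * Real.log (Real.log n) / 2) = -((5 : ℕ) * Real.log (Real.log n)) := by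
      push_cast; ring
    rw [h0, Real.exp_neg, ← Real.log_pow, Real.exp_log (by positivity)]
  rw [he]
  refine add_le_add ?_ ?_
  · calc 192 * logScale n ^ 4 * ((Real.log n) ^ 5)⁻¹
        ≤ 192 * (5 * Real.log n) ^ 4 * ((Real.log n) ^ 5)⁻¹ := by gcongr
      _ = _ := by
        have : Real.log n ≠ 0 := by linarith
        field_simp
        norm_num
  · calc logScale n ^ 2 / (2 * n ^ 2) ≤ (5 * Real.log n) ^ 2 / (2 * n ^ 2) := by gcongr
      _ = _ := by
        field_simp
        norm_num

lemma asympLeInProb_sBJ (q : PlaneNorm) :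
    AsympLeInProb nullLaw (fun n X => sBJ q n X / Real.log (Real.log n)) 3317760 := by
  intro δ hδ
  refine squeeze_zero' (Eventually.of_forall fun n => measureReal_nonneg) ?_
    (tendsto_nullLaw_not_levelsBounded q)
  filter_upwards [eventually_ge_atTop 3, tendsto_log_natCast.eventually_gt_atTop 1] with n hn hL
  have hll : 0 < Real.log (Real.log n) := Real.log_pos hL
  refine measureReal_mono (fun X hX hgood => ?_) (measure_ne_top _ _)
  have h1 := hgood.sBJ_le hn (by linarith)
  have h2 : 3317760 + δ < sBJ q n X / Real.log (Real.log n) := hX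
  rw [lt_div_iff₀ hll] at h2
  nlinarith

lemma rpow_five_halves_sq {L : ℝ} (hL : 0 ≤ L) : (L ^ (5 / 2 : ℝ)) ^ 2 = L ^ 5 := by
  rw [← Real.rpow_natCast, ← Real.rpow_mul hL, ← Real.rpow_natCast]
  norm_num

lemma eventually_sHC_bound_le :
    ∀ᶠ n : ℕ in atTop, √(221184 * (10 * Real.log (Real.log n)) *
      (3 + 384 * logScale n ^ 4 * (10 * Real.log (Real.log n)))) ≤
      Real.log n ^ (5 / 2 : ℝ) := by
  have h1 : ∀ᶠ n : ℕ in atTop,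
      Real.log (Real.log n) ≤ 10 ^ (-8 : ℤ) * Real.log n ^ (1 / 2 : ℝ) := by
    have := ((isLittleO_log_rpow_atTop (r := 1 / 2) (by norm_num)).comp_tendsto
      tendsto_log_natCast).bound (c := 10 ^ (-8 : ℤ)) (by positivity)
    filter_upwards [this, tendsto_log_natCast.eventually_gt_atTop 1] with n h hL
    simp only [Function.comp_apply, Real.norm_eq_abs] at h
    rwa [abs_of_pos (Real.log_pos hL), abs_of_nonneg (by positivity)] at h
  filter_upwards [h1, eventually_ge_atTop 3, tendsto_log_natCast.eventually_gt_atTop 1]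
    with n hll hn hL
  set L := Real.log n with hLdef
  have hΛ := logScale_le hn
  have hΛ0 := three_le_logScale hn
  have hll0 : 0 < Real.log L := Real.log_pos hL
  refine Real.sqrt_le_iff.2 ⟨by positivity, ?_⟩
  rw [rpow_five_halves_sq (by linarith)]
  set s := L ^ (1 / 2 : ℝ) with hs
  have hs2 : s ^ 2 = L := by
    rw [hs, ← Real.rpow_natCast, ← Real.rpow_mul (by linarith)]; norm_num
  have hs1 : 1 ≤ s := Real.one_le_rpow hL.le (by norm_num)
  have h6 : Real.log L ^ 2 ≤ 10 ^ (-16 : ℤ) * L := by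
    calc Real.log L ^ 2 ≤ (10 ^ (-8 : ℤ) * s) ^ 2 := by gcongr
      _ = _ := by rw [mul_pow, hs2]; norm_num
  have h7 : Real.log L ≤ 10 ^ (-8 : ℤ) * L := by
    refine hll.trans ?_
    have : s ≤ L := by rw [← hs2]; nlinarith
    gcongr
  have h8 : L ≤ L ^ 5 := le_self_pow₀ hL.le (by norm_num)
  calc 221184 * (10 * Real.log L) * (3 + 384 * logScale n ^ 4 * (10 * Real.log L))
      ≤ 221184 * (10 * Real.log L) * (3 + 384 * (5 * L) ^ 4 * (10 * Real.log L)) := by gcongr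
    _ = 6635520 * Real.log L + 5308416000000 * L ^ 4 * Real.log L ^ 2 := by ring
    _ ≤ 6635520 * (10 ^ (-8 : ℤ) * L) + 5308416000000 * L ^ 4 * (10 ^ (-16 : ℤ) * L) := by
        gcongr
    _ ≤ L ^ 5 := by
        norm_num
        nlinarith

/-- The lower tail is applied with η = 1 / log n: its bound √(2048 log n) is below log^(5/2) n as
soon as log n > 2048. -/
lemma tendsto_nullLaw_abs_sHC (q : PlaneNorm) :
    Tendsto (fun n : ℕ => (nullLaw n).real {X | Real.log n ^ (5 / 2 : ℝ) < |sHC q n X|})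
      atTop (𝓝 0) := by
  have h1 : Tendsto (fun n : ℕ => (nullLaw n).real
      {X | ¬LevelsBounded q n (10 * Real.log (Real.log n)) X} + 2 / Real.log n) atTop
      (𝓝 (0 + 0)) :=
    (tendsto_nullLaw_not_levelsBounded q).add (tendsto_log_natCast.const_div_atTop 2)
  rw [add_zero] at h1
  refine squeeze_zero' (Eventually.of_forall fun n => measureReal_nonneg) ?_ h1
  filter_upwards [eventually_ge_atTop 3, tendsto_log_natCast.eventually_gt_atTop 2048,
    eventually_sHC_bound_le] with n hn hL hbd
  have hΛ0 := three_le_logScale hn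
  have hlΛ : Real.log n ≤ logScale n := by
    have hn' : (3 : ℝ) ≤ n := by exact_mod_cast hn
    have h2 := Real.log_two_lt_d9
    rw [logScale, Real.logb, le_div_iff₀ (by linarith [Real.log_two_gt_d9]),
      Real.log_mul two_ne_zero (by positivity), Real.log_pow]
    push_cast
    nlinarith [Real.log_two_gt_d9]
  set L := Real.log n with hLdef
  have hll : 0 < Real.log L := Real.log_pos (by linarith)
  have hsub : {X : Site n → ℝ | L ^ (5 / 2 : ℝ) < |sHC q n X|} ⊆
      ({X | ¬LevelsBounded q n (10 * Real.log L) X} ∪ {X | ¬NoSmallPValue q n X}) ∪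
        {X | sHC q n X < -√(8 * (256 / (1 / L)))} := by
    intro X hX
    by_contra hcon
    simp only [Set.mem_union, Set.mem_ofPred_eq, not_or, not_not, not_lt] at hcon
    obtain ⟨⟨h1, h2⟩, h3⟩ := hcon
    have h4 := h1.sHC_le hn (by linarith) h2
    have h5 : √(8 * (256 / (1 / L))) ≤ L ^ (5 / 2 : ℝ) := by
      refine Real.sqrt_le_iff.2 ⟨by positivity, ?_⟩
      rw [rpow_five_halves_sq (by linarith), div_div_eq_mul_div, div_one]
      have : 1 ≤ L ^ 3 := one_le_pow₀ (by linarith)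
      calc 8 * (256 * L) = 2048 * L * 1 := by ring
        _ ≤ L * L * L ^ 3 := by gcongr
        _ = L ^ 5 := by ring
    have h6 : |sHC q n X| ≤ L ^ (5 / 2 : ℝ) := abs_le.2 ⟨by linarith, h4.trans hbd⟩
    exact absurd hX (not_lt.2 h6)
  refine (measureReal_mono hsub (measure_ne_top _ _)).trans ((measureReal_union_le _ _).trans
    ((add_le_add (measureReal_union_le _ _) le_rfl).trans ?_))
  have h2 := nullLaw_not_noSmallPValue_le q hn
  have h3 := nullLaw_sHC_lt_le q hn (η := 1 / L) (by positivity)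
    (by rw [div_lt_one (by linarith)]; linarith)
  have h4 : 1 / logScale n ≤ 1 / L := one_div_le_one_div_of_le (by linarith) hlΛ
  have h5 : 2 / L = 1 / L + 1 / L := by ring
  linarith

lemma isBigOInProb_sHC (q : PlaneNorm) :
    IsBigOInProb nullLaw (fun n X => sHC q n X) (fun n => Real.log n ^ (5 / 2 : ℝ)) := by
  intro δ hδ
  refine ⟨1, ?_⟩
  simp only [one_mul]
  exact (tendsto_nullLaw_abs_sHC q).eventually_le_const hδ

lemma tendsto_nullLaw_sHC (q : PlaneNorm) :
    Tendsto (fun n : ℕ => (nullLaw n).real {X | Real.log n ^ 3 < sHC q n X}) atTop (𝓝 0) := by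
  refine squeeze_zero' (Eventually.of_forall fun n => measureReal_nonneg) ?_
    (tendsto_nullLaw_abs_sHC q)
  filter_upwards [tendsto_log_natCast.eventually_gt_atTop 1] with n hL
  refine measureReal_mono (fun X hX => ?_) (measure_ne_top _ _)
  have h1 : Real.log n ^ (5 / 2 : ℝ) ≤ Real.log n ^ 3 := by
    rw [← Real.rpow_natCast]
    exact Real.rpow_le_rpow_of_exponent_le hL.le (by norm_num)
  exact (h1.trans_lt hX).trans_le (le_abs_self _)

lemma tendsto_nullLaw_sBJ (q : PlaneNorm) :
    Tendsto (fun n : ℕ => (nullLaw n).real {X | √(Real.log n) < sBJ q n X}) atTop (𝓝 0) := by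
  refine squeeze_zero' (Eventually.of_forall fun n => measureReal_nonneg) ?_
    (tendsto_nullLaw_not_levelsBounded q)
  have := ((isLittleO_log_rpow_atTop (r := 1 / 2) (by norm_num)).comp_tendsto
      tendsto_log_natCast).bound (c := 10 ^ (-8 : ℤ)) (by positivity)
  filter_upwards [this, eventually_ge_atTop 3, tendsto_log_natCast.eventually_gt_atTop 1]
    with n h hn hL
  have hll : 0 < Real.log (Real.log n) := Real.log_pos hL
  simp only [Function.comp_apply, Real.norm_eq_abs] at h
  rw [abs_of_pos hll, abs_of_nonneg (by positivity), ← Real.sqrt_eq_rpow] at h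
  refine measureReal_mono (fun X hX hgood => ?_) (measure_ne_top _ _)
  have h1 := hgood.sBJ_le hn (by linarith)
  have h2 : √(Real.log n) < sBJ q n X := hX
  have h3 : 0 ≤ √(Real.log n) := Real.sqrt_nonneg _
  norm_num at h
  linarith

/-! ### Counting centres and lattice points -/

open Classical in
/-- The admissible centres of a ball of radius `R`. -/
def centers (n : ℕ) (R : ℝ) : Finset (Site n) := Finset.univ.filter fun c => InGrid R c

lemma mem_centers {n : ℕ} {R : ℝ} {c : Site n} : c ∈ centers n R ↔ InGrid R c := by
  simp [centers]

lemma finite_lattice_ball (q : PlaneNorm) (R : ℝ) : {x : ℤ × ℤ | q.eval x.1 x.2 < R}.Finite := by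
  refine ((Set.finite_Icc (-⌈R⌉) ⌈R⌉).prod (Set.finite_Icc (-⌈R⌉) ⌈R⌉)).subset ?_
  intro x hx
  have h1 := (q.abs_fst_le x.1 x.2).trans_lt hx
  have h2 := (q.abs_snd_le x.1 x.2).trans_lt hx
  have key : ∀ k : ℤ, |(k : ℝ)| < R → k ∈ Set.Icc (-⌈R⌉) ⌈R⌉ := by
    intro k hk
    have := hk.trans_le (Int.le_ceil R)
    have h3 : |k| < ⌈R⌉ := by exact_mod_cast this
    rw [abs_lt] at h3
    exact ⟨h3.1.le, h3.2.le⟩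
  exact ⟨key _ h1, key _ h2⟩

lemma card_ball (q : PlaneNorm) {n : ℕ} {R : ℝ} {c : Site n} (hc : InGrid R c) :
    (ball q c R).card = latticeBallCard q R := by
  rw [latticeBallCard, ← Set.ncard_coe_finset]
  refine Set.ncard_congr (fun x _ => ((x.1 : ℤ) - (c.1 : ℤ), (x.2 : ℤ) - (c.2 : ℤ))) ?_ ?_ ?_
  · intro x hx
    rw [Finset.mem_coe, mem_ball] at hx
    simp only [coord] at hx
    simpa using hx
  · intro x y _ _ h
    simp only [Prod.mk.injEq] at h
    exact Prod.ext (Fin.ext (by omega)) (Fin.ext (by omega))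
  · intro z hz
    have key : ∀ (j : Fin n) (k : ℤ), coord j ∈ Set.Icc R (n - R + 1) → |(k : ℝ)| < R →
        ∃ i : Fin n, (i : ℤ) - (j : ℤ) = k := by
      intro j k hj hk
      rw [abs_lt] at hk
      simp only [coord, Set.mem_Icc] at hj
      have h1 : (0 : ℝ) < ((j : ℤ) + 1 + k : ℤ) := by push_cast; linarith
      have h2 : (((j : ℤ) + 1 + k : ℤ) : ℝ) < (n + 1 : ℤ) := by push_cast; linarith
      have h1' : 0 < (j : ℤ) + 1 + k := by exact_mod_cast h1
      have h2' : (j : ℤ) + 1 + k < n + 1 := by exact_mod_cast h2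
      exact ⟨⟨((j : ℤ) + k).toNat, by omega⟩, by simp; omega⟩
    obtain ⟨i, hi⟩ := key c.1 z.1 hc.1 ((q.abs_fst_le z.1 z.2).trans_lt hz)
    obtain ⟨j, hj⟩ := key c.2 z.2 hc.2 ((q.abs_snd_le z.1 z.2).trans_lt hz)
    refine ⟨(i, j), ?_, Prod.ext hi hj⟩
    rw [Finset.mem_coe, mem_ball]
    have hz' : q.eval z.1 z.2 < R := hz
    rw [← hi, ← hj] at hz'
    push_cast at hz'
    simpa [coord] using hz'

/-- Since the norm is at most the ℓ¹-norm, the ball contains all integer points whose coordinates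
are below R / 2 in absolute value. -/
lemma sq_le_latticeBallCard (q : PlaneNorm) {R : ℝ} (hR : 0 < R) :
    (2 * ⌈R / 2⌉₊ - 1) ^ 2 ≤ latticeBallCard q R := by
  set k := ⌈R / 2⌉₊ with hk
  have hk1 : 1 ≤ k := Nat.ceil_pos.2 (by linarith)
  have hkR : (k : ℝ) < R / 2 + 1 := Nat.ceil_lt_add_one (by linarith)
  set I : Finset ℤ := Finset.Icc (-((k : ℤ) - 1)) ((k : ℤ) - 1)
  have hI : I.card = 2 * k - 1 := by rw [Int.card_Icc]; omega
  have hsub : ((I ×ˢ I : Finset (ℤ × ℤ)) : Set (ℤ × ℤ)) ⊆ {x | q.eval x.1 x.2 < R} := by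
    intro x hx
    have key : ∀ j : ℤ, j ∈ I → |(j : ℝ)| < R / 2 := by
      intro j hj
      rw [Finset.mem_Icc] at hj
      have h1 : |j| ≤ (k : ℤ) - 1 := abs_le.2 hj
      have h2 : |(j : ℝ)| ≤ (k : ℝ) - 1 := by exact_mod_cast h1
      linarith
    simp only [Finset.coe_product, Set.mem_prod, Finset.mem_coe] at hx
    have h1 := key _ hx.1
    have h2 := key _ hx.2
    have := q.eval_le x.1 x.2
    simp only [Set.mem_ofPred_eq]
    linarith
  have h := Set.ncard_le_ncard hsub (finite_lattice_ball q R)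
  rw [Set.ncard_coe_finset, Finset.card_product, hI] at h
  rw [sq]
  exact h

lemma radius_sq_le_latticeBallCard (q : PlaneNorm) {R : ℝ} (hR : 0 < R) :
    R ^ 2 ≤ 4 * latticeBallCard q R := by
  have h := sq_le_latticeBallCard q hR
  set k := ⌈R / 2⌉₊ with hk
  have hk1 : 1 ≤ k := Nat.ceil_pos.2 (by linarith)
  have hkR : R / 2 ≤ k := Nat.le_ceil _
  have h1 : ((2 * k - 1 : ℕ) : ℝ) = 2 * k - 1 := by
    rw [Nat.cast_sub (by omega)]; push_cast; ring
  have h2 : ((2 * k - 1 : ℕ) : ℝ) ^ 2 ≤ latticeBallCard q R := by exact_mod_cast h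
  rw [h1] at h2
  have hk1' : (1 : ℝ) ≤ k := by exact_mod_cast hk1
  nlinarith

lemma latticeBallCard_eq_zero (q : PlaneNorm) {R : ℝ} (hR : R ≤ 0) : latticeBallCard q R = 0 := by
  have : {x : ℤ × ℤ | q.eval x.1 x.2 < R} = ∅ := by
    ext x
    simp only [Set.mem_ofPred_eq, Set.mem_empty_iff_false, iff_false, not_lt]
    exact hR.trans ((abs_nonneg _).trans (q.abs_fst_le x.1 x.2))
  rw [latticeBallCard, this, Set.ncard_empty]

open Classical in
-- Overlapping balls have centres less than 2R ≤ 4k apart in each coordinate, k = ⌈R/2⌉. The window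
-- has (8k - 1)² points and 8k - 1 ≤ 7(2k - 1), which gives 49 = 7² uniformly down to single points.
lemma card_overlapping_le (q : PlaneNorm) {n : ℕ} {R : ℝ} (hR : 0 < R) (c : Site n) :
    ((centers n R).filter fun c' => ¬Disjoint (ball q c R) (ball q c' R)).card ≤
      49 * latticeBallCard q R := by
  have h := sq_le_latticeBallCard q hR
  set k := ⌈R / 2⌉₊ with hk
  have hk1 : 1 ≤ k := Nat.ceil_pos.2 (by linarith)
  have hkR : R / 2 ≤ k := Nat.le_ceil _
  let I : ℕ → Finset ℤ := fun j => Finset.Icc ((j : ℤ) - (4 * k - 1)) ((j : ℤ) + (4 * k - 1))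
  have hI : ∀ j, (I j).card = 8 * k - 1 := fun j => by
    simp only [I]; rw [Int.card_Icc]; omega
  have h1 : ((centers n R).filter fun c' => ¬Disjoint (ball q c R) (ball q c' R)).card ≤
      (I c.1 ×ˢ I c.2).card := by
    refine Finset.card_le_card_of_injOn (fun x => ((x.1 : ℤ), (x.2 : ℤ))) ?_ ?_
    · intro c' hc'
      simp only [Finset.coe_filter, Set.mem_ofPred_eq] at hc'
      obtain ⟨h1, h2⟩ := abs_coord_sub_lt_of_not_disjoint hc'.2
      have key : ∀ j j' : Fin n, |coord j - coord j'| < R + R → (j' : ℤ) ∈ I j := by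
        intro j j' hj
        simp only [coord] at hj
        have h3 : |((j : ℤ) : ℝ) - ((j' : ℤ) : ℝ)| < (4 * k : ℤ) := by
          push_cast
          refine lt_of_eq_of_lt ?_ (hj.trans_le (by linarith))
          congr 1; ring
        have h4 : |(j : ℤ) - (j' : ℤ)| < 4 * k := by exact_mod_cast h3
        rw [abs_lt] at h4
        rw [Finset.mem_Icc]
        omega
      simp only [Finset.coe_product, Set.mem_prod, Finset.mem_coe]
      exact ⟨key _ _ h1, key _ _ h2⟩
    · intro x _ y _ he
      simp only [Prod.mk.injEq] at he
      exact Prod.ext (Fin.ext (by omega)) (Fin.ext (by omega))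
  rw [Finset.card_product, hI, hI] at h1
  obtain ⟨j, hj⟩ : ∃ j, k = j + 1 := ⟨k - 1, by omega⟩
  rw [hj] at h h1
  have e1 : 2 * (j + 1) - 1 = 2 * j + 1 := by omega
  have e2 : 8 * (j + 1) - 1 = 8 * j + 7 := by omega
  rw [e1] at h
  rw [e2] at h1
  nlinarith

lemma le_card_centers {n : ℕ} {R : ℝ} (hR : 0 < R) (hRn : 8 * R ≤ n) (hn : 4 ≤ n) :
    (n : ℝ) ^ 2 / 4 ≤ (centers n R).card := by
  have hn' : (4 : ℝ) ≤ n := by exact_mod_cast hn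
  set J := multiplesIn n 1 R (n - R)
  have h1 := le_card_multiplesIn (n := n) (d := 1) one_pos hR (b := n - R) (by linarith)
  have hJ : (n : ℝ) / 2 ≤ J.card := by
    refine le_trans ?_ h1
    push_cast
    linarith
  have hsub : J ×ˢ J ⊆ centers n R := by
    intro c hc
    simp only [Finset.mem_product, J, mem_multiplesIn] at hc
    rw [mem_centers]
    exact ⟨⟨hc.1.2.1, by linarith [hc.1.2.2]⟩, ⟨hc.2.2.1, by linarith [hc.2.2.2]⟩⟩
  have h2 := Finset.card_le_card hsub
  rw [Finset.card_product] at h2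
  have h3 : (J.card : ℝ) * J.card ≤ (centers n R).card := by exact_mod_cast h2
  nlinarith

/-! ### Sums over configurations -/

/-- A product sum over tuples without related entries is almost the full power. -/
lemma pow_sub_le_sum_prod {σ : Type*} (Γ : Finset σ) (w : σ → ℝ)
    (hw : ∀ c ∈ Γ, 0 ≤ w c) (rel : σ → σ → Prop) (m : ℕ) (T : Finset (Fin m → σ))
    (hT : ∀ c, c ∈ T ↔ (∀ g, c g ∈ Γ) ∧ ∀ g h, g ≠ h → ¬rel (c g) (c h))
    [DecidableRel rel] :
    (∑ c ∈ Γ, w c) ^ m - m ^ 2 * ((∑ x ∈ Γ, w x * ∑ y ∈ Γ with rel y x, w y) *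
      (∑ c ∈ Γ, w c) ^ (m - 2)) ≤ ∑ c ∈ T, ∏ g, w (c g) := by
  classical
  set S := ∑ c ∈ Γ, w c with hS
  set O := ∑ x ∈ Γ, w x * ∑ y ∈ Γ with rel y x, w y with hO
  have hS0 : 0 ≤ S := Finset.sum_nonneg hw
  have hO0 : 0 ≤ O := Finset.sum_nonneg fun x hx => mul_nonneg (hw x hx)
    (Finset.sum_nonneg fun y hy => hw y (Finset.mem_filter.1 hy).1)
  set Pf := Fintype.piFinset fun _ : Fin m => Γ with hPf
  have hpow : S ^ m = ∑ c ∈ Pf, ∏ g, w (c g) := by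
    rw [hPf, ← Finset.prod_univ_sum, Finset.prod_const, Finset.card_univ, Fintype.card_fin]
  have hprod0 : ∀ c ∈ Pf, 0 ≤ ∏ g, w (c g) := fun c hc =>
    Finset.prod_nonneg fun g _ => hw _ (Fintype.mem_piFinset.1 hc g)
  have hTPf : T ⊆ Pf := fun c hc => Fintype.mem_piFinset.2 ((hT c).1 hc).1
  -- Fixing c h = x, the entry c g runs over the points related to x and the remaining m - 2 entries
  -- are free.
  have hpair : ∀ g h : Fin m, g ≠ h →
      ∑ c ∈ Pf with rel (c g) (c h), ∏ i, w (c i) = O * S ^ (m - 2) := by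
    intro g h hgh
    let t : σ → Fin m → Finset σ := fun x =>
      Function.update (Function.update (fun _ => Γ) g (Γ.filter fun y => rel y x)) h {x}
    have h1 : ∑ c ∈ Pf with rel (c g) (c h), ∏ i, w (c i) =
        ∑ x ∈ Γ, ∑ c ∈ Fintype.piFinset (t x), ∏ i, w (c i) := by
      rw [← Finset.sum_fiberwise_of_maps_to (s := Pf.filter fun c => rel (c g) (c h)) (t := Γ)
        (g := fun c => c h)
        (fun c hc => Fintype.mem_piFinset.1 (Finset.mem_filter.1 hc).1 h)]
      refine Finset.sum_congr rfl fun x hx => ?_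
      congr 1
      ext c
      simp only [Finset.mem_filter, hPf, Fintype.mem_piFinset]
      constructor
      · rintro ⟨⟨h1, h2⟩, rfl⟩ i
        by_cases hi : i = h
        · subst hi; simp [t]
        · by_cases hi' : i = g
          · subst hi'; simp [t, hi, h1 i, h2]
          · simp [t, hi, hi', h1 i]
      · intro hc
        have hch : c h = x := by simpa [t] using hc h
        have hcg := hc g
        simp only [t, Function.update_of_ne hgh, Function.update_self, Finset.mem_filter] at hcg
        refine ⟨⟨fun i => ?_, by rw [hch]; exact hcg.2⟩, hch⟩
        by_cases hi : i = h
        · rw [hi, hch]; exact hx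
        · by_cases hi' : i = g
          · rw [hi']; exact hcg.1
          · simpa [t, hi, hi'] using hc i
    rw [h1, hO, Finset.sum_mul]
    refine Finset.sum_congr rfl fun x _ => ?_
    rw [← Finset.prod_univ_sum, ← Finset.mul_prod_erase _ _ (Finset.mem_univ h),
      ← Finset.mul_prod_erase _ _ (Finset.mem_erase.2 ⟨hgh, Finset.mem_univ g⟩)]
    have h2 : ∏ i ∈ (Finset.univ.erase h).erase g, ∑ j ∈ t x i, w j = S ^ (m - 2) := by
      rw [Finset.prod_congr rfl (g := fun _ => S), Finset.prod_const, Finset.card_erase_of_mem,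
        Finset.card_erase_of_mem (Finset.mem_univ h), Finset.card_univ, Fintype.card_fin]
      · congr 1
      · exact Finset.mem_erase.2 ⟨hgh, Finset.mem_univ g⟩
      · intro i hi
        simp only [Finset.mem_erase] at hi
        simp [t, hi.1, hi.2.1, hS]
    rw [h2]
    simp only [t, Function.update_self, Function.update_of_ne hgh, Finset.sum_singleton]
    ring
  -- Union bound over ordered pairs of related entries. For m < 2 there are no pairs, so the
  -- truncated subtraction m - 2 does no harm.
  have hdiff : ∑ c ∈ Pf \ T, ∏ g, w (c g) ≤
      ∑ p ∈ (Finset.univ : Finset (Fin m × Fin m)) with p.1 ≠ p.2,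
        ∑ c ∈ Pf with rel (c p.1) (c p.2), ∏ i, w (c i) := by
    have h1 : ∑ p ∈ (Finset.univ : Finset (Fin m × Fin m)) with p.1 ≠ p.2,
        ∑ c ∈ Pf with rel (c p.1) (c p.2), ∏ i, w (c i) =
        ∑ c ∈ Pf, ∑ p ∈ (Finset.univ : Finset (Fin m × Fin m)) with p.1 ≠ p.2,
          if rel (c p.1) (c p.2) then ∏ i, w (c i) else 0 := by
      rw [Finset.sum_comm]
      exact Finset.sum_congr rfl fun p _ => Finset.sum_filter _ _
    rw [h1]
    have hnn : ∀ c ∈ Pf, ∀ p : Fin m × Fin m,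
        0 ≤ if rel (c p.1) (c p.2) then ∏ i, w (c i) else 0 := fun c hc p => by
      split_ifs
      · exact hprod0 c hc
      · exact le_rfl
    refine (Finset.sum_le_sum fun c hc => ?_).trans (Finset.sum_le_sum_of_subset_of_nonneg
      Finset.sdiff_subset fun c hc _ => Finset.sum_nonneg fun p _ => hnn c hc p)
    rw [Finset.mem_sdiff, hT] at hc
    obtain ⟨h1, h2⟩ := hc
    have h3 := Fintype.mem_piFinset.1 h1
    simp only [h3, implies_true, true_and, not_forall, not_not] at h2
    obtain ⟨g, h, hgh, hr⟩ := h2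
    refine le_trans (le_of_eq ?_) (Finset.single_le_sum (fun p _ => hnn c h1 p)
      (show (g, h) ∈ _ from Finset.mem_filter.2 ⟨Finset.mem_univ _, hgh⟩))
    rw [if_pos hr]
  have hcard : ((Finset.univ.filter fun p : Fin m × Fin m => p.1 ≠ p.2).card : ℝ) ≤ m ^ 2 := by
    have : (Finset.univ.filter fun p : Fin m × Fin m => p.1 ≠ p.2).card ≤ m ^ 2 :=
      (Finset.card_le_univ _).trans_eq (by simp [sq])
    exact_mod_cast this
  rw [Finset.sum_congr rfl fun p hp => hpair p.1 p.2 (Finset.mem_filter.1 hp).2, Finset.sum_const,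
    nsmul_eq_mul] at hdiff
  have hsplit := Finset.sum_sdiff (f := fun c => ∏ g, w (c g)) hTPf
  have hle := mul_le_mul_of_nonneg_right hcard (mul_nonneg hO0 (pow_nonneg hS0 (m - 2)))
  rw [hpow]
  linarith

/-! ### Locally dependent sums -/

/-- The variance of a sum of nonnegative bounded random variables is at most the sum of the second
moments of its dependent pairs. -/
lemma variance_sum_le_of_indepFun {Ω ι : Type*} [MeasurableSpace Ω] {P : Measure Ω}
    [IsProbabilityMeasure P] (s : Finset ι) (f : ι → Ω → ℝ) (K : ℝ)
    (hm : ∀ i ∈ s, Measurable (f i)) (h0 : ∀ i ∈ s, ∀ ω, 0 ≤ f i ω) (hK : ∀ i ∈ s, ∀ ω, f i ω ≤ K)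
    (rel : ι → ι → Prop) [DecidableRel rel]
    (hrel : ∀ i ∈ s, ∀ j ∈ s, ¬rel j i → IndepFun (f i) (f j) P) :
    Var[∑ i ∈ s, f i; P] ≤ ∑ i ∈ s, ∑ j ∈ s with rel j i, ∫ ω, f i ω * f j ω ∂P := by
  have hL : ∀ i ∈ s, MemLp (f i) 2 P := fun i hi =>
    MemLp.of_bound (hm i hi).aestronglyMeasurable K (ae_of_all _ fun ω => by
      rw [Real.norm_of_nonneg (h0 i hi ω)]; exact hK i hi ω)
  rw [variance_sum' hL]
  refine Finset.sum_le_sum fun i hi => ?_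
  rw [Finset.sum_filter]
  refine Finset.sum_le_sum fun j hj => ?_
  split_ifs with h
  -- For dependent pairs the product of the means is nonnegative and is dropped.
  · rw [covariance_eq_sub (hL i hi) (hL j hj)]
    have h1 := integral_nonneg (μ := P) (f := f i) (h0 i hi)
    have h2 := integral_nonneg (μ := P) (f := f j) (h0 j hj)
    have h3 := mul_nonneg h1 h2
    simp only [Pi.mul_apply]
    linarith
  · rw [(hrel i hi j hj h).covariance_eq_zero (hL i hi) (hL j hj)]

/-! ### The truncated likelihood ratio -/

/-- The likelihood ratio of `N(a, 1)` and `N(0, 1)`, truncated at `T`. -/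
def truncLR (T a s : ℝ) : ℝ := if s ≤ T then Real.exp (a * s - a ^ 2 / 2) else 0

lemma truncLR_nonneg (T a s : ℝ) : 0 ≤ truncLR T a s := by
  unfold truncLR; split_ifs <;> positivity

lemma truncLR_le (T a s : ℝ) : truncLR T a s ≤ Real.exp (a * s - a ^ 2 / 2) := by
  unfold truncLR; split_ifs
  · exact le_rfl
  · positivity

lemma truncLR_le_const {a : ℝ} (ha : 0 ≤ a) (T s : ℝ) :
    truncLR T a s ≤ Real.exp (a * T - a ^ 2 / 2) := by
  unfold truncLR; split_ifs
  · gcongr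
  · positivity

lemma measurable_truncLR (T a : ℝ) : Measurable (truncLR T a) :=
  Measurable.ite measurableSet_Iic (by fun_prop) measurable_const

lemma integral_truncLR (T a : ℝ) :
    ∫ s, truncLR T a s ∂(gaussianReal 0 1) = (gaussianReal a 1).real (Set.Iic T) := by
  rw [← integral_indicator_one measurableSet_Iic, gaussianReal_eq_withDensity a,
    integral_withDensity_eq_integral_toReal_smul (by fun_prop) (ae_of_all _ fun s => by simp)]
  refine integral_congr_ae (ae_of_all _ fun s => ?_)
  simp only [truncLR, Set.indicator_apply, Set.mem_Iic, ENNReal.toReal_ofReal (Real.exp_pos _).le,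
    Pi.one_apply, smul_eq_mul, mul_ite, mul_one, mul_zero]

lemma integral_truncLR_le_one (T a : ℝ) : ∫ s, truncLR T a s ∂(gaussianReal 0 1) ≤ 1 := by
  rw [integral_truncLR]; exact measureReal_le_one

lemma le_integral_truncLR (T a : ℝ) :
    1 - pValue (T - a) ≤ ∫ s, truncLR T a s ∂(gaussianReal 0 1) := by
  have h1 : pValue (T - a) = (gaussianReal a 1).real (Set.Ici T) := by
    have h2 : gaussianReal a 1 = (gaussianReal 0 1).map (fun x => x + a) := by
      rw [gaussianReal_map_add_const, zero_add]
    rw [h2, map_measureReal_apply (by fun_prop) measurableSet_Ici, pValue]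
    congr 1
    ext x
    simp
  have h3 : (gaussianReal a 1).real (Set.Ioi T) ≤ (gaussianReal a 1).real (Set.Ici T) :=
    measureReal_mono Set.Ioi_subset_Ici_self (measure_ne_top _ _)
  rw [integral_truncLR, h1, ← compl_compl (Set.Iic T),
    probReal_compl_eq_one_sub measurableSet_Iic.compl, Set.compl_Iic]
  linarith

/-- On s ≤ T one has 2as ≤ ks + (2a - k)T, which leaves a Gaussian exponential moment. The free tilt
k is taken as 2a when truncation is irrelevant and as T otherwise. -/
lemma integral_sq_truncLR_le {T a k : ℝ} (hk : k ≤ 2 * a) :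
    ∫ s, truncLR T a s ^ 2 ∂(gaussianReal 0 1) ≤
      Real.exp (k ^ 2 / 2 + (2 * a - k) * T - a ^ 2) := by
  have hmgf : ∫ s, Real.exp (k * s) ∂(gaussianReal 0 1) = Real.exp (k ^ 2 / 2) := by
    have := congrFun (mgf_id_gaussianReal (μ := 0) (v := 1)) k
    simpa [mgf] using this
  have hint : Integrable (fun s => Real.exp (k * s)) (gaussianReal 0 1) := by
    by_contra h
    rw [integral_undef h] at hmgf
    exact (Real.exp_pos _).ne hmgf
  have h1 : Real.exp (k ^ 2 / 2 + (2 * a - k) * T - a ^ 2) =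
      ∫ s, Real.exp ((2 * a - k) * T - a ^ 2) * Real.exp (k * s) ∂(gaussianReal 0 1) := by
    rw [integral_const_mul, hmgf, ← Real.exp_add]
    congr 1; ring
  rw [h1]
  refine integral_mono_of_nonneg (ae_of_all _ fun s => sq_nonneg _) (hint.const_mul _)
    (ae_of_all _ fun s => ?_)
  simp only [truncLR]
  split_ifs with hs
  · rw [← Real.exp_nat_mul, ← Real.exp_add]
    refine Real.exp_le_exp.2 ?_
    push_cast
    nlinarith [mul_nonneg (sub_nonneg.2 hk) (sub_nonneg.2 hs)]
  · rw [zero_pow two_ne_zero]; positivity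

/-! ### The likelihood of a configuration -/

lemma sum_mul_sub_eq_scan {n : ℕ} {I : Finset (Site n)} (hI : I.Nonempty) (μ : ℝ) (X : Site n → ℝ) :
    ∑ x ∈ I, (μ * X x - μ ^ 2 / 2) =
      μ * √(I.card : ℝ) * scan I X - (μ * √(I.card : ℝ)) ^ 2 / 2 := by
  have hc : (0 : ℝ) < I.card := by exact_mod_cast hI.card_pos
  have hs : √(I.card : ℝ) ≠ 0 := (Real.sqrt_pos.2 hc).ne'
  rw [Finset.sum_sub_distrib, ← Finset.mul_sum, Finset.sum_const, nsmul_eq_mul, mul_pow,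
    Real.sq_sqrt hc.le, scan]
  rw [mul_assoc μ (√_), mul_div_cancel₀ _ hs]
  ring

open Classical in
lemma mem_configs {q : PlaneNorm} {n m : ℕ} {R : ℝ} {c : Fin m → Site n} :
    c ∈ configs q n m R ↔ (∀ g, c g ∈ centers n R) ∧
      ∀ g h, g ≠ h → ¬¬Disjoint (ball q (c g) R) (ball q (c h) R) := by
  simp [configs, mem_centers]

/-- Since the clusters are disjoint, the likelihood ratio factors over them, and each factor depends
on the data only through the scan of its cluster. -/
lemma obsLaw_signal_eq {q : PlaneNorm} {n m : ℕ} {R μ : ℝ} {c : Fin m → Site n} (hR : 0 < R)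
    (hc : c ∈ configs q n m R) :
    obsLaw (signal q R μ c) = (nullLaw n).withDensity fun X => ENNReal.ofReal
      (∏ g, Real.exp (μ * √(latticeBallCard q R : ℝ) * scan (ball q (c g) R) X -
        (μ * √(latticeBallCard q R : ℝ)) ^ 2 / 2)) := by
  classical
  rw [mem_configs] at hc
  rw [obsLaw_eq_withDensity]
  congr 1
  ext X
  rw [← Real.exp_sum]
  congr 2
  have h1 : ∀ x, signal q R μ c x * X x - signal q R μ c x ^ 2 / 2 =
      if x ∈ Finset.univ.biUnion fun g => ball q (c g) R then μ * X x - μ ^ 2 / 2 else 0 := by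
    intro x
    simp only [signal, Finset.mem_biUnion, Finset.mem_univ, true_and]
    split_ifs <;> simp
  rw [Finset.sum_congr rfl fun x _ => h1 x, Finset.sum_ite_mem, Finset.univ_inter,
    Finset.sum_biUnion fun g _ h _ hgh => not_not.1 (hc.2 g h hgh)]
  refine Finset.sum_congr rfl fun g _ => ?_
  rw [sum_mul_sub_eq_scan (ball_nonempty q (c g) hR), card_ball q (mem_centers.1 (hc.1 g))]

/-- Under the alternative with fixed locations, the power of a test is at least its integral against
the truncated likelihood ratio. -/
lemma integral_mul_prod_truncLR_le {q : PlaneNorm} {n m : ℕ} {R μ T : ℝ} {c : Fin m → Site n}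
    (hR : 0 < R) (hc : c ∈ configs q n m R) {φ : (Site n → ℝ) → ℝ} (hφ : Measurable φ)
    (h01 : ∀ X, φ X ∈ Set.Icc (0 : ℝ) 1) :
    ∫ X, φ X * ∏ g, truncLR T (μ * √(latticeBallCard q R : ℝ)) (scan (ball q (c g) R) X)
      ∂(nullLaw n) ≤ ∫ X, φ X ∂(obsLaw (signal q R μ c)) := by
  have hd := obsLaw_signal_eq (μ := μ) hR hc
  set D : (Site n → ℝ) → ℝ := fun X =>
    ∏ g, Real.exp (μ * √(latticeBallCard q R : ℝ) * scan (ball q (c g) R) X -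
        (μ * √(latticeBallCard q R : ℝ)) ^ 2 / 2) with hD
  have hDm : Measurable D := by
    have := fun g => measurable_scan (ball q (c g) R)
    fun_prop
  have hD0 : ∀ X, 0 ≤ D X := fun X => Finset.prod_nonneg fun g _ => (Real.exp_pos _).le
  have hint : Integrable φ (obsLaw (signal q R μ c)) :=
    Integrable.of_bound hφ.aestronglyMeasurable 1 (ae_of_all _ fun X => by
      rw [Real.norm_of_nonneg (h01 X).1]; exact (h01 X).2)
  rw [hd, integrable_withDensity_iff_integrable_smul' hDm.ennreal_ofReal
    (ae_of_all _ fun s => by simp)] at hint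
  rw [hd, integral_withDensity_eq_integral_toReal_smul hDm.ennreal_ofReal
    (ae_of_all _ fun s => by simp)]
  refine integral_mono_of_nonneg (ae_of_all _ fun X => mul_nonneg (h01 X).1
    (Finset.prod_nonneg fun g _ => truncLR_nonneg _ _ _)) hint (ae_of_all _ fun X => ?_)
  have h1 : (ENNReal.ofReal (D X)).toReal = D X := ENNReal.toReal_ofReal (hD0 X)
  simp only [hD] at h1
  simp only [smul_eq_mul]
  rw [h1, mul_comm]
  refine mul_le_mul_of_nonneg_right ?_ (h01 X).1
  exact Finset.prod_le_prod (fun g _ => truncLR_nonneg _ _ _) fun g _ => truncLR_le _ _ _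

/-! ### The lower bound for fixed `n` -/

/-- Bernoulli's inequality gives S^m ≥ 1 - η, and S ≤ exp(1/m) bounds S^(m-2) by e < 3. Hence S must
be known to within o(1/m), not merely o(1). -/
lemma one_sub_le_pow_sub {m : ℕ} (hm : 1 ≤ m) {S O η : ℝ} (hη : η ≤ 1)
    (hS : m * |S - 1| ≤ η) (hO : m ^ 2 * O ≤ η) :
    1 - 4 * η ≤ S ^ m - m ^ 2 * (O * S ^ (m - 2)) := by
  have hm0 : (1 : ℝ) ≤ m := by exact_mod_cast hm
  have hη0 : 0 ≤ η := le_trans (by positivity) hS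
  have h1 : |S - 1| ≤ η / m := by
    rw [le_div_iff₀ (by linarith)]; linarith
  have h2 : η / m ≤ 1 := (div_le_self hη0 hm0).trans hη
  rw [abs_le] at h1
  have hS0 : 0 ≤ S := by linarith
  have h3 : 1 - η ≤ S ^ m := by
    have h4 := one_add_mul_le_pow (a := S - 1) (by linarith) m
    have h5 : m * (η / m) = η := mul_div_cancel₀ _ (by linarith)
    have h6 : -(m * (η / m)) ≤ m * (S - 1) := by nlinarith
    rw [add_sub_cancel] at h4
    linarith
  have h7 : S ^ (m - 2) ≤ 3 := by
    have h8 : S ≤ Real.exp (1 / m) := by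
      have := Real.add_one_le_exp (1 / (m : ℝ))
      have h9 : η / m ≤ 1 / m := by gcongr
      linarith
    calc S ^ (m - 2) ≤ Real.exp (1 / m) ^ (m - 2) := pow_le_pow_left₀ hS0 h8 _
      _ ≤ Real.exp (1 / m) ^ m := by
        refine pow_le_pow_right₀ (Real.one_le_exp (by positivity)) (Nat.sub_le _ _)
      _ = Real.exp 1 := by
        rw [← Real.exp_nat_mul]; congr 1; exact mul_one_div_cancel (by linarith)
      _ ≤ 3 := Real.exp_one_lt_three.le
  have h8 : 0 ≤ S ^ (m - 2) := pow_nonneg hS0 _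
  have h9 : m ^ 2 * (O * S ^ (m - 2)) ≤ η * 3 := by
    rw [← mul_assoc]; exact mul_le_mul hO h7 h8 hη0
  linarith

open Classical in
/-- If the overlaps are sparse, then there are admissible configurations. -/
lemma configs_nonempty (q : PlaneNorm) {n m : ℕ} {R : ℝ} (hR : 0 < R)
    (hM : 0 < (centers n R).card)
    (hO : (m : ℝ) ^ 2 * (49 * latticeBallCard q R) / (centers n R).card < 1) :
    0 < (configs q n m R).card := by
  by_contra h
  have h0 : configs q n m R = ∅ := by
    rw [← Finset.card_eq_zero]; omega
  set M := (centers n R).card with hMdef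
  have hM' : (0 : ℝ) < M := by exact_mod_cast hM
  -- With constant weights 1/M this is the probabilistic method: independent uniform centres are
  -- pairwise disjoint with positive probability.
  have h1 := pow_sub_le_sum_prod (centers n R) (fun _ => (M : ℝ)⁻¹) (fun _ _ => by positivity)
    (fun c c' => ¬Disjoint (ball q c R) (ball q c' R)) m (configs q n m R) fun c => mem_configs
  rw [h0, Finset.sum_empty, Finset.sum_const, nsmul_eq_mul, ← hMdef, mul_inv_cancel₀ hM'.ne',
    one_pow, one_pow, mul_one] at h1
  have h2 : ∑ x ∈ centers n R, (M : ℝ)⁻¹ *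
      ∑ y ∈ centers n R with ¬Disjoint (ball q y R) (ball q x R), (M : ℝ)⁻¹ ≤
      (49 * latticeBallCard q R) / M := by
    calc _ ≤ ∑ x ∈ centers n R, (M : ℝ)⁻¹ * ((49 * latticeBallCard q R) * (M : ℝ)⁻¹) := by
          refine Finset.sum_le_sum fun x _ => ?_
          rw [Finset.sum_const, nsmul_eq_mul]
          gcongr
          have := card_overlapping_le (n := n) q hR x
          simp_rw [disjoint_comm (a := ball q x R)] at this
          exact_mod_cast this
      _ = _ := by
          rw [Finset.sum_const, nsmul_eq_mul, ← hMdef, ← mul_assoc, mul_inv_cancel₀ hM'.ne',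
            one_mul, div_eq_mul_inv]
  have h3 : (m : ℝ) ^ 2 * ∑ x ∈ centers n R, (M : ℝ)⁻¹ *
      ∑ y ∈ centers n R with ¬Disjoint (ball q y R) (ball q x R), (M : ℝ)⁻¹ ≤
      m ^ 2 * (49 * latticeBallCard q R) / M := by
    rw [mul_div_assoc]
    exact mul_le_mul_of_nonneg_left h2 (by positivity)
  linarith

/-- Without admissible configurations the definition yields the zero measure, so their existence has
to be proved first. -/
lemma isProbabilityMeasure_altLaw {q : PlaneNorm} {n m : ℕ} {R μ : ℝ}
    (h : 0 < (configs q n m R).card) : IsProbabilityMeasure (altLaw q n m R μ) := by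
  constructor
  rw [altLaw, Measure.smul_apply, Measure.finsetSum_apply, Finset.sum_congr rfl
    fun c _ => measure_univ, Finset.sum_const, nsmul_eq_mul, mul_one, smul_eq_mul]
  exact ENNReal.inv_mul_cancel (by exact_mod_cast h.ne') (ENNReal.natCast_ne_top _)

lemma integral_altLaw {q : PlaneNorm} {n m : ℕ} {R μ : ℝ} {φ : (Site n → ℝ) → ℝ}
    (hφ : Measurable φ) (h01 : ∀ X, φ X ∈ Set.Icc (0 : ℝ) 1) :
    ∫ X, φ X ∂(altLaw q n m R μ) = ((configs q n m R).card : ℝ)⁻¹ *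
      ∑ c ∈ configs q n m R, ∫ X, φ X ∂(obsLaw (signal q R μ c)) := by
  rw [altLaw, integral_smul_measure, integral_finsetSum_measure]
  · simp
  · exact fun c _ => Integrable.of_bound hφ.aestronglyMeasurable 1 (ae_of_all _ fun X => by
      rw [Real.norm_of_nonneg (h01 X).1]; exact (h01 X).2)

lemma card_configs_le (q : PlaneNorm) (n m : ℕ) (R : ℝ) :
    (configs q n m R).card ≤ (centers n R).card ^ m := by
  classical
  have h : configs q n m R ⊆ Fintype.piFinset fun _ => centers n R := fun c hc =>
    Fintype.mem_piFinset.2 (mem_configs.1 hc).1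
  refine (Finset.card_le_card h).trans_eq ?_
  simp

lemma integral_comp_scan_nullLaw {n : ℕ} {I : Finset (Site n)} (hI : I.Nonempty) {f : ℝ → ℝ}
    (hf : Measurable f) :
    ∫ X, f (scan I X) ∂(nullLaw n) = ∫ s, f s ∂(gaussianReal 0 1) := by
  have h := obsLaw_map_scan (fun _ : Site n => (0 : ℝ)) hI
  have h0 : scan I (fun _ : Site n => (0 : ℝ)) = 0 := by simp [scan]
  rw [h0] at h
  rw [← h, integral_map (measurable_scan I).aemeasurable hf.aestronglyMeasurable, nullLaw]

lemma indepFun_scan {n : ℕ} (θ : Site n → ℝ) {I J : Finset (Site n)} (h : Disjoint I J) :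
    IndepFun (scan I) (scan J) (obsLaw θ) := by
  have := (iIndepFun_scan θ (fun b : Bool => if b then I else J) (by
    intro b b' hb
    cases b <;> cases b' <;> simp_all [disjoint_comm])).indepFun (i := true) (j := false) (by simp)
  simpa using this

open Classical in
/-- Away from an event of small probability, the truncated likelihood ratio of the alternative is
close to one. -/
lemma nullLaw_bad_le (q : PlaneNorm) {n m : ℕ} {R a T k η : ℝ} (hR : 0 < R) (hm : 1 ≤ m)
    (ha : 0 ≤ a) (hk : k ≤ 2 * a) (hη0 : 0 < η) (hη1 : η ≤ 1)
    (hM : 0 < (centers n R).card) (h1 : m * pValue (T - a) ≤ η / 2)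
    (h2 : (m : ℝ) ^ 2 * (49 * latticeBallCard q R) / (centers n R).card *
      Real.exp (k ^ 2 / 2 + (2 * a - k) * T - a ^ 2) ≤ η ^ 3 / 8)
    (w : (Site n → ℝ) → Site n → ℝ)
    (hw : ∀ X c, w X c = truncLR T a (scan (ball q c R) X) / (centers n R).card) :
    (nullLaw n).real {X | ¬(m * |∑ c ∈ centers n R, w X c - 1| ≤ η ∧
      m ^ 2 * ∑ x ∈ centers n R, w X x *
        ∑ y ∈ centers n R with ¬Disjoint (ball q y R) (ball q x R), w X y ≤ η)} ≤ η := by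
  set Γ := centers n R with hΓ
  set M : ℝ := (Γ.card : ℝ) with hMdef
  set V := Real.exp (k ^ 2 / 2 + (2 * a - k) * T - a ^ 2) with hV
  set P := nullLaw n
  have hM0 : 0 < M := Nat.cast_pos.2 hM
  have hm0 : (1 : ℝ) ≤ m := by exact_mod_cast hm
  set Kc := Real.exp (a * T - a ^ 2 / 2) / M with hKc
  let f : Site n → (Site n → ℝ) → ℝ := fun c X => w X c
  have hfe : ∀ c, f c = fun X => truncLR T a (scan (ball q c R) X) / M := fun c => by
    ext X; exact hw X c
  have hfm : ∀ c, Measurable (f c) := fun c => by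
    rw [hfe]
    exact ((measurable_truncLR T a).comp (measurable_scan _)).div_const _
  have hf0 : ∀ c X, 0 ≤ f c X := fun c X => by
    rw [hfe]; exact div_nonneg (truncLR_nonneg _ _ _) hM0.le
  have hfK : ∀ c X, f c X ≤ Kc := fun c X => by
    rw [hfe]; exact div_le_div_of_nonneg_right (truncLR_le_const ha _ _) hM0.le
  have hint : ∀ c, Integrable (f c) P := fun c =>
    Integrable.of_bound (hfm c).aestronglyMeasurable Kc (ae_of_all _ fun X => by
      rw [Real.norm_of_nonneg (hf0 c X)]; exact hfK c X)
  have hintsq : ∀ c, Integrable (fun X => f c X ^ 2) P := fun c =>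
    Integrable.of_bound ((hfm c).pow_const 2).aestronglyMeasurable (Kc ^ 2)
      (ae_of_all _ fun X => by
        rw [Real.norm_of_nonneg (sq_nonneg _)]; exact pow_le_pow_left₀ (hf0 c X) (hfK c X) 2)
  have hsq : ∀ c, ∫ X, f c X ^ 2 ∂P ≤ V / M ^ 2 := fun c => by
    simp_rw [hfe, div_pow]
    rw [integral_div, integral_comp_scan_nullLaw (f := fun s => truncLR T a s ^ 2)
      (ball_nonempty q c hR) ((measurable_truncLR T a).pow_const 2)]
    gcongr
    exact integral_sq_truncLR_le hk
  -- Pairs of overlapping balls are handled only through xy ≤ (x² + y²)/2; their correlation is not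
  -- used.
  have hprod : ∀ c c', ∫ X, f c X * f c' X ∂P ≤ V / M ^ 2 := fun c c' => by
    have h3 : ∫ X, f c X * f c' X ∂P ≤ ∫ X, (f c X ^ 2 + f c' X ^ 2) / 2 ∂P := by
      refine integral_mono_of_nonneg (ae_of_all _ fun X => mul_nonneg (hf0 c X) (hf0 c' X))
        (((hintsq c).add (hintsq c')).div_const 2) (ae_of_all _ fun X => ?_)
      have := two_mul_le_add_sq (f c X) (f c' X)
      simp only
      linarith
    rw [integral_div, integral_add (hintsq c) (hintsq c')] at h3
    linarith [hsq c, hsq c']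
  have hpairs : ∑ x ∈ Γ, ∑ y ∈ Γ with ¬Disjoint (ball q y R) (ball q x R),
      ∫ X, f x X * f y X ∂P ≤ (49 * latticeBallCard q R) / M * V := by
    calc _ ≤ ∑ x ∈ Γ, (49 * latticeBallCard q R) * (V / M ^ 2) := by
          refine Finset.sum_le_sum fun x _ => ?_
          refine (Finset.sum_le_card_nsmul _ _ _ fun y _ => hprod x y).trans ?_
          rw [nsmul_eq_mul]
          have := card_overlapping_le (n := n) q hR x
          simp_rw [disjoint_comm (a := ball q x R)] at this
          refine mul_le_mul_of_nonneg_right ?_ (by positivity)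
          exact_mod_cast this
      _ = _ := by
          rw [Finset.sum_const, nsmul_eq_mul, ← hMdef]
          field_simp
  have hvar : Var[∑ c ∈ Γ, f c; P] ≤ (49 * latticeBallCard q R) / M * V := by
    refine (variance_sum_le_of_indepFun Γ f Kc (fun c _ => hfm c) (fun c _ => hf0 c)
      (fun c _ => hfK c) (fun y x => ¬Disjoint (ball q y R) (ball q x R)) ?_).trans hpairs
    intro x _ y _ hxy
    rw [not_not] at hxy
    rw [hfe, hfe]
    exact (indepFun_scan (fun _ : Site n => (0 : ℝ)) hxy.symm).comp
      (φ := fun s => truncLR T a s / M) (ψ := fun s => truncLR T a s / M)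
      ((measurable_truncLR T a).div_const _) ((measurable_truncLR T a).div_const _)
  have hmean : ∫ X, (∑ c ∈ Γ, f c) X ∂P = ∫ s, truncLR T a s ∂(gaussianReal 0 1) := by
    simp_rw [Finset.sum_apply]
    rw [integral_finsetSum _ fun c _ => hint c]
    have h3 : ∀ c ∈ Γ, ∫ X, f c X ∂P = (∫ s, truncLR T a s ∂(gaussianReal 0 1)) / M :=
      fun c _ => by
        simp_rw [hfe]
        rw [integral_div,
          integral_comp_scan_nullLaw (ball_nonempty q c hR) (measurable_truncLR T a)]
    rw [Finset.sum_congr rfl h3, Finset.sum_const, nsmul_eq_mul, ← hMdef,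
      mul_div_cancel₀ _ hM0.ne']
  have hLp : MemLp (∑ c ∈ Γ, f c) 2 P := memLp_finsetSum' _ fun c _ =>
    MemLp.of_bound (hfm c).aestronglyMeasurable Kc (ae_of_all _ fun ω => by
      rw [Real.norm_of_nonneg (hf0 c ω)]; exact hfK c ω)
  have hq : (m : ℝ) ^ 2 * ((49 * latticeBallCard q R) / M * V) ≤ η ^ 3 / 8 := by
    rw [← mul_assoc, ← mul_div_assoc]; exact h2
  -- the centred sum
  have hA : P.real {X | η / (2 * m) ≤ |(∑ c ∈ Γ, f c) X - ∫ X, (∑ c ∈ Γ, f c) X ∂P|} ≤ η / 2 := by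
    have h3 := meas_ge_le_variance_div_sq hLp (c := η / (2 * m)) (by positivity)
    have h4 : P.real {X | η / (2 * m) ≤ |(∑ c ∈ Γ, f c) X - ∫ X, (∑ c ∈ Γ, f c) X ∂P|} ≤
        Var[∑ c ∈ Γ, f c; P] / (η / (2 * m)) ^ 2 :=
      ENNReal.toReal_le_of_le_ofReal (div_nonneg (variance_nonneg _ _) (by positivity)) h3
    refine h4.trans ?_
    rw [div_le_iff₀ (by positivity)]
    have h5 : η / 2 * (η / (2 * m)) ^ 2 = η ^ 3 / 8 / m ^ 2 := by field_simp; norm_num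
    rw [h5, le_div_iff₀ (by positivity)]
    calc _ ≤ (49 * latticeBallCard q R) / M * V * (m : ℝ) ^ 2 := by gcongr
      _ ≤ _ := by linarith
  -- the overlaps
  let G : (Site n → ℝ) → ℝ := fun X => ∑ x ∈ Γ, f x X *
        ∑ y ∈ Γ with ¬Disjoint (ball q y R) (ball q x R), f y X
  have hG0 : ∀ X, 0 ≤ G X := fun X => Finset.sum_nonneg fun x _ => mul_nonneg (hf0 x X)
    (Finset.sum_nonneg fun y _ => hf0 y X)
  have hintp : ∀ x y, Integrable (fun X => f x X * f y X) P := fun x y =>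
    Integrable.of_bound ((hfm x).mul (hfm y)).aestronglyMeasurable (Kc * Kc)
      (ae_of_all _ fun X => by
        rw [Real.norm_of_nonneg (mul_nonneg (hf0 x X) (hf0 y X))]
        exact mul_le_mul (hfK x X) (hfK y X) (hf0 y X) ((hf0 x X).trans (hfK x X)))
  have hGe : G = fun X => ∑ x ∈ Γ, ∑ y ∈ Γ with ¬Disjoint (ball q y R) (ball q x R),
      f x X * f y X := by
    ext X
    simp only [G, Finset.mul_sum]
  have hGi : Integrable G P := by
    rw [hGe]
    exact integrable_finsetSum _ fun x _ => integrable_finsetSum _ fun y _ => hintp x y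
  have hGint : ∫ X, G X ∂P ≤ (49 * latticeBallCard q R) / M * V := by
    refine le_trans (le_of_eq ?_) hpairs
    rw [hGe, integral_finsetSum _ fun x _ => integrable_finsetSum _ fun y _ => hintp x y]
    exact Finset.sum_congr rfl fun x _ => integral_finsetSum _ fun y _ => hintp x y
  have hB : P.real {X | η / m ^ 2 ≤ G X} ≤ η / 2 := by
    have h3 := mul_meas_ge_le_integral_of_nonneg (ae_of_all _ hG0) hGi (η / m ^ 2)
    have h4 : η / m ^ 2 * P.real {X | η / m ^ 2 ≤ G X} ≤ η ^ 3 / 8 / m ^ 2 := by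
      refine h3.trans (hGint.trans ?_)
      rw [le_div_iff₀ (by positivity)]; linarith
    have h5 : η ^ 3 / 8 / m ^ 2 ≤ η / m ^ 2 * (η / 2) := by
      have h6 : η / m ^ 2 * (η / 2) = η ^ 2 / 2 / m ^ 2 := by ring
      rw [h6]
      gcongr ?_ / _
      nlinarith [sq_nonneg η]
    have h7 : (0 : ℝ) < η / m ^ 2 := by positivity
    exact le_of_mul_le_mul_left (h4.trans h5) h7
  refine (measureReal_mono ?_ (measure_ne_top _ _)).trans ((measureReal_union_le
    {X | η / (2 * m) ≤ |(∑ c ∈ Γ, f c) X - ∫ X, (∑ c ∈ Γ, f c) X ∂P|}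
    {X | η / m ^ 2 ≤ G X}).trans (by linarith))
  intro X hX
  by_contra hcon
  simp only [Set.mem_union, Set.mem_ofPred_eq, not_or, not_le] at hcon
  refine hX ⟨?_, ?_⟩
  · have h3 := hcon.1
    rw [hmean, Finset.sum_apply] at h3
    have h4 := integral_truncLR_le_one T a
    have h5 := le_integral_truncLR T a
    -- The mean of the sum is 1 minus the mass cut off by the truncation, which is at most `pValue
    -- (T - a)`; the rest is the Chebyshev deviation.
    have h6 : |∑ c ∈ Γ, w X c - 1| ≤ η / (2 * m) + pValue (T - a) := by
      have h7 := abs_lt.1 h3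
      exact abs_le.2 ⟨by linarith [h7.1], by linarith [h7.2, pValue_nonneg (T - a)]⟩
    have h8 : m * (η / (2 * m)) = η / 2 := by field_simp
    calc _ ≤ m * (η / (2 * m) + pValue (T - a)) := by gcongr
      _ ≤ η := by rw [mul_add, h8]; linarith
  · have h3 : G X < η / m ^ 2 := hcon.2
    rw [lt_div_iff₀ (by positivity)] at h3
    have h4 : (m : ℝ) ^ 2 * G X ≤ η := by linarith
    exact h4

open Classical in
/-- Every test has almost the same power under the null hypothesis and under the alternative. -/
lemma integral_nullLaw_le (q : PlaneNorm) {n m : ℕ} {R μ T k η : ℝ} (hR : 0 < R) (hm : 1 ≤ m)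
    (hμ : 0 ≤ μ) (hk : k ≤ 2 * (μ * √(latticeBallCard q R : ℝ))) (hη0 : 0 < η) (hη1 : η ≤ 1 / 4)
    (hM : 0 < (centers n R).card) (hC : 0 < (configs q n m R).card)
    (h1 : m * pValue (T - μ * √(latticeBallCard q R : ℝ)) ≤ η / 2)
    (h2 : (m : ℝ) ^ 2 * (49 * latticeBallCard q R) / (centers n R).card *
      Real.exp (k ^ 2 / 2 + (2 * (μ * √(latticeBallCard q R : ℝ)) - k) * T -
        (μ * √(latticeBallCard q R : ℝ)) ^ 2) ≤ η ^ 3 / 8)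
    {φ : (Site n → ℝ) → ℝ} (hφ : Measurable φ) (h01 : ∀ X, φ X ∈ Set.Icc (0 : ℝ) 1) :
    ∫ X, φ X ∂(nullLaw n) - 5 * η ≤ ∫ X, φ X ∂(altLaw q n m R μ) := by
  set a := μ * √(latticeBallCard q R : ℝ) with ha
  set Γ := centers n R with hΓ
  set P := nullLaw n
  have hM0 : (0 : ℝ) < Γ.card := by exact_mod_cast hM
  have hC0 : (0 : ℝ) < (configs q n m R).card := by exact_mod_cast hC
  let w : (Site n → ℝ) → Site n → ℝ := fun X c => truncLR T a (scan (ball q c R) X) / Γ.card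
  have hw0 : ∀ X c, 0 ≤ w X c := fun X c => div_nonneg (truncLR_nonneg _ _ _) hM0.le
  have hwm : ∀ c, Measurable fun X => w X c := fun c =>
    ((measurable_truncLR T a).comp (measurable_scan _)).div_const _
  have ha0 : 0 ≤ a := by positivity
  have hbad := nullLaw_bad_le q hR hm ha0 hk hη0 (by linarith) hM h1 h2 w fun _ _ => rfl
  set E : Set (Site n → ℝ) := {X | m * |∑ c ∈ Γ, w X c - 1| ≤ η ∧
      m ^ 2 * ∑ x ∈ Γ, w X x *
        ∑ y ∈ Γ with ¬Disjoint (ball q y R) (ball q x R), w X y ≤ η} with hE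
  have hEm : MeasurableSet E := by
    refine MeasurableSet.inter ?_ ?_
    · have h3 : Measurable fun X => m * |∑ c ∈ Γ, w X c - 1| := by fun_prop
      exact measurableSet_le h3 measurable_const
    · have h3 : Measurable fun X => m ^ 2 * ∑ x ∈ Γ, w X x *
          ∑ y ∈ Γ with ¬Disjoint (ball q y R) (ball q x R), w X y := by fun_prop
      exact measurableSet_le h3 measurable_const
  have hEc : P.real Eᶜ ≤ η := hbad
  have hint : Integrable φ P := Integrable.of_bound hφ.aestronglyMeasurable 1
    (ae_of_all _ fun X => by rw [Real.norm_of_nonneg (h01 X).1]; exact (h01 X).2)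
  -- the power under the alternative
  let W : (Site n → ℝ) → ℝ := fun X => ∑ c ∈ configs q n m R, ∏ g, w X (c g)
  have hW0 : ∀ X, 0 ≤ W X := fun X =>
    Finset.sum_nonneg fun c _ => Finset.prod_nonneg fun g _ => hw0 _ _
  have hpint : ∀ c : Fin m → Site n, Integrable (fun X => φ X * ∏ g, w X (c g)) P := fun c => by
    refine Integrable.of_bound (hφ.mul (Finset.measurable_prod _ fun g _ =>
      hwm (c g))).aestronglyMeasurable ((Real.exp (a * T - a ^ 2 / 2) / Γ.card) ^ m)
      (ae_of_all _ fun X => ?_)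
    have h3 : 0 ≤ ∏ g, w X (c g) := Finset.prod_nonneg fun g _ => hw0 _ _
    rw [Real.norm_of_nonneg (mul_nonneg (h01 X).1 h3)]
    refine (mul_le_of_le_one_left h3 (h01 X).2).trans ?_
    refine (Finset.prod_le_prod (g := fun _ => Real.exp (a * T - a ^ 2 / 2) / Γ.card)
      (fun g _ => hw0 _ _) fun g _ => ?_).trans
      (by rw [Finset.prod_const, Finset.card_univ, Fintype.card_fin])
    exact div_le_div_of_nonneg_right (truncLR_le_const ha0 _ _) hM0.le
  have halt : ∫ X, φ X * W X ∂P ≤ ∫ X, φ X ∂(altLaw q n m R μ) := by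
    rw [integral_altLaw hφ h01]
    have h3 : ∫ X, φ X * W X ∂P = ((Γ.card : ℝ) ^ m)⁻¹ * ∑ c ∈ configs q n m R,
        ∫ X, φ X * ∏ g, truncLR T a (scan (ball q (c g) R) X) ∂P := by
      simp only [W, Finset.mul_sum]
      rw [integral_finsetSum _ fun c _ => hpint c]
      refine Finset.sum_congr rfl fun c _ => ?_
      rw [← integral_const_mul]
      refine integral_congr_ae (ae_of_all _ fun X => ?_)
      simp only [w, Finset.prod_div_distrib, Finset.prod_const, Finset.card_univ, Fintype.card_fin]
      ring
    rw [h3]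
    -- The number of configurations is replaced by the larger M^m. This goes in the right direction,
    -- since only a lower bound for the power is needed.
    refine mul_le_mul ?_ (Finset.sum_le_sum fun c hc =>
      integral_mul_prod_truncLR_le hR hc hφ h01) ?_ (by positivity)
    · exact inv_anti₀ hC0 (by exact_mod_cast card_configs_le q n m R)
    · exact Finset.sum_nonneg fun c _ => integral_nonneg fun X => mul_nonneg (h01 X).1
        (Finset.prod_nonneg fun g _ => truncLR_nonneg _ _ _)
  have hlow : ∀ X, (1 - 4 * η) * E.indicator φ X ≤ φ X * W X := by
    intro X
    by_cases hX : X ∈ E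
    · rw [Set.indicator_of_mem hX, mul_comm]
      refine mul_le_mul_of_nonneg_left ?_ (h01 X).1
      have h3 := pow_sub_le_sum_prod Γ (w X) (fun c _ => hw0 X c)
        (fun c c' => ¬Disjoint (ball q c R) (ball q c' R)) m (configs q n m R) fun c => mem_configs
      refine le_trans ?_ h3
      exact one_sub_le_pow_sub hm (by linarith) hX.1 hX.2
    · rw [Set.indicator_of_notMem hX, mul_zero]
      exact mul_nonneg (h01 X).1 (hW0 X)
  have hWint : Integrable (fun X => φ X * W X) P := by
    simp only [W, Finset.mul_sum]
    exact integrable_finsetSum _ fun c _ => hpint c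
  have h3 := integral_mono ((hint.indicator hEm).const_mul (1 - 4 * η)) hWint hlow
  rw [integral_const_mul, integral_indicator hEm] at h3
  have h4 := integral_add_compl hEm hint
  have h5 : ∫ X in Eᶜ, φ X ∂P ≤ P.real Eᶜ := by
    have h6 := integral_mono (hint.integrableOn (s := Eᶜ)) (integrable_const (1 : ℝ))
      fun X => (h01 X).2
    simpa using h6
  have h7 : ∫ X in E, φ X ∂P ≤ 1 := by
    have h6 := integral_mono (hint.integrableOn (s := E)) (integrable_const (1 : ℝ))
      fun X => (h01 X).2
    have h8 : P.real E ≤ 1 := measureReal_le_one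
    have h9 : ∫ X in E, φ X ∂P ≤ P.real E := by simpa using h6
    linarith
  have h8 : η * ∫ X in E, φ X ∂P ≤ η * 1 := mul_le_mul_of_nonneg_left h7 hη0.le
  linarith [halt]

/-! ### Asymptotics of the model -/

lemma rpow_two_mul_eq_exp {n : ℕ} (hn : 0 < n) (x : ℝ) :
    (n : ℝ) ^ (2 * x) = Real.exp (x * Real.log ((n : ℝ) ^ 2)) := by
  rw [Real.rpow_def_of_pos (by exact_mod_cast hn), Real.log_pow]
  congr 1
  push_cast; ring

lemma tendsto_log_sq : Tendsto (fun n : ℕ => Real.log ((n : ℝ) ^ 2)) atTop atTop := by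
  refine Real.tendsto_log_atTop.comp ((tendsto_pow_atTop two_ne_zero).comp ?_)
  exact tendsto_natCast_atTop_atTop

lemma tendsto_exp_mul_log_sq {e : ℕ → ℝ} {e₀ : ℝ} (he : Tendsto e atTop (𝓝 e₀)) (h0 : e₀ < 0) :
    Tendsto (fun n : ℕ => Real.exp (e n * Real.log ((n : ℝ) ^ 2))) atTop (𝓝 0) :=
  Real.tendsto_exp_atBot.comp (he.neg_mul_atTop h0 tendsto_log_sq)

/-- The size of the balls relative to its approximation `n^{2α}`. -/
def sizeRatio (q : PlaneNorm) (α : ℝ) (R : ℕ → ℝ) (n : ℕ) : ℝ :=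
  (latticeBallCard q (R n) : ℝ) / (n : ℝ) ^ (2 * α)

lemma signalMean_nonneg (α r : ℝ) (n : ℕ) : 0 ≤ signalMean α r n := by
  unfold signalMean; positivity

lemma signalMean_mul_sqrt {α r : ℝ} (hr : 0 ≤ r) (n : ℕ) (b : ℝ) :
    signalMean α r n * √b =
      √(2 * Real.log ((n : ℝ) ^ 2)) * (√r * √(b / (n : ℝ) ^ (2 * α))) := by
  have h : (0 : ℝ) ≤ (n : ℝ) ^ (2 * α) := by positivity
  have h1 : 2 * r * Real.log ((n : ℝ) ^ 2) = r * (2 * Real.log ((n : ℝ) ^ 2)) := by ring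
  rw [signalMean, Real.sqrt_div' _ h, h1, Real.sqrt_mul hr]
  ring

namespace SparseClusterModel

variable {q : PlaneNorm} {α β : ℝ} {m : ℕ → ℕ} {R : ℕ → ℝ}

lemma card_bounds (h : SparseClusterModel q α β m R) : ∀ᶠ n : ℕ in atTop,
    4 ≤ n ∧ 1 ≤ m n ∧ (m n : ℝ) ≤ 2 * (n : ℝ) ^ (2 * (1 - α - β)) ∧
      (n : ℝ) ^ (2 * (1 - α - β)) ≤ 2 * m n ∧
      (latticeBallCard q (R n) : ℝ) ≤ 2 * (n : ℝ) ^ (2 * α) ∧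
      (n : ℝ) ^ (2 * α) ≤ 2 * latticeBallCard q (R n) ∧ 0 < R n ∧ 8 * R n ≤ n := by
  have h1 := h.number.eventually (Ioo_mem_nhds (by norm_num : (1 / 2 : ℝ) < 1) one_lt_two)
  have h2 := h.size.eventually (Ioo_mem_nhds (by norm_num : (1 / 2 : ℝ) < 1) one_lt_two)
  have h3 := tendsto_exp_mul_log_sq (e := fun _ => α - 1) tendsto_const_nhds
    (by linarith [h.alpha_lt_one])
  have h4 := h3.eventually (gt_mem_nhds (by norm_num : (0 : ℝ) < 1 / 512))
  filter_upwards [h1, h2, h4, eventually_ge_atTop 4] with n h1 h2 h4 hn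
  have hn0 : (0 : ℝ) < n := by exact_mod_cast (by omega : 0 < n)
  have hp : ∀ x : ℝ, 0 < (n : ℝ) ^ x := fun x => Real.rpow_pos_of_pos hn0 x
  have h1a := (lt_div_iff₀ (hp _)).1 h1.1
  have h1b := (div_lt_iff₀ (hp _)).1 h1.2
  have h2a := (lt_div_iff₀ (hp _)).1 h2.1
  have h2b := (div_lt_iff₀ (hp _)).1 h2.2
  have hm : 0 < (m n : ℝ) := lt_trans (by have := hp (2 * (1 - α - β)); positivity) h1a
  have hb : 0 < (latticeBallCard q (R n) : ℝ) :=
    lt_trans (by have := hp (2 * α); positivity) h2a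
  have hR : 0 < R n := by
    by_contra hR
    rw [latticeBallCard_eq_zero q (not_lt.1 hR)] at hb
    simp at hb
  refine ⟨hn, by exact_mod_cast hm, h1b.le, by linarith, h2b.le, by linarith, hR, ?_⟩
  have h5 := radius_sq_le_latticeBallCard q hR
  -- Then 64 R² ≤ 256 · (points of a ball) ≤ 512 n^(2α) ≤ n², that is 8R ≤ n.
  have h6 : 512 * (n : ℝ) ^ (2 * α) ≤ (n : ℝ) ^ 2 := by
    have h7 : Real.exp ((α - 1) * Real.log ((n : ℝ) ^ 2)) = (n : ℝ) ^ (2 * α) / (n : ℝ) ^ 2 := by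
      rw [rpow_two_mul_eq_exp (by omega), sub_mul, one_mul, Real.exp_sub,
        Real.exp_log (by positivity)]
    rw [h7, div_lt_iff₀ (by positivity)] at h4
    linarith
  exact le_of_sq_le_sq (by nlinarith) hn0.le

/-- The last inequality is the sparseness assumption; it makes the expected number of overlaps, of
order n^(2(2B - A)), tend to zero. -/
lemma exponents (h : SparseClusterModel q α β m R) : 0 < 1 - α ∧ 0 ≤ 1 - α - β ∧
    2 * (1 - α - β) < 1 - α := by
  have hA : 0 < 1 - α := by linarith [h.alpha_lt_one]
  refine ⟨hA, by linarith [h.sum_le_one], ?_⟩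
  have := (lt_div_iff₀ hA).1 h.sparse
  linarith

/-- The expected number of overlaps is negligible. -/
lemma overlaps_le (h : SparseClusterModel q α β m R) : ∀ᶠ n : ℕ in atTop,
    0 < (centers n (R n)).card ∧
    (m n : ℝ) ^ 2 * (49 * latticeBallCard q (R n)) / (centers n (R n)).card ≤
      1568 * Real.exp ((2 * (1 - α - β) - (1 - α)) * Real.log ((n : ℝ) ^ 2)) := by
  filter_upwards [h.card_bounds] with n ⟨hn, hm, hm2, _, hb2, _, hR, hRn⟩
  have hn0 : (0 : ℝ) < n := by exact_mod_cast (by omega : 0 < n)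
  have hM := le_card_centers hR hRn hn
  have hM0 : (0 : ℝ) < (centers n (R n)).card := lt_of_lt_of_le (by positivity) hM
  refine ⟨by exact_mod_cast hM0, ?_⟩
  rw [rpow_two_mul_eq_exp (by omega)] at hm2 hb2
  calc (m n : ℝ) ^ 2 * (49 * latticeBallCard q (R n)) / (centers n (R n)).card
      ≤ (2 * Real.exp ((1 - α - β) * Real.log ((n : ℝ) ^ 2))) ^ 2 *
        (49 * (2 * Real.exp (α * Real.log ((n : ℝ) ^ 2)))) / ((n : ℝ) ^ 2 / 4) := by gcongr
    _ = 1568 * (Real.exp ((1 - α - β) * Real.log ((n : ℝ) ^ 2)) ^ 2 *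
        Real.exp (α * Real.log ((n : ℝ) ^ 2)) / (n : ℝ) ^ 2) := by
      field_simp; norm_num
    _ = _ := by
      have h1 : (n : ℝ) ^ 2 = Real.exp (Real.log ((n : ℝ) ^ 2)) :=
        (Real.exp_log (by positivity)).symm
      rw [← Real.exp_nat_mul, ← Real.exp_add]
      nth_rewrite 3 [h1]
      rw [← Real.exp_sub]
      congr 2
      push_cast
      ring

lemma configs_nonempty (h : SparseClusterModel q α β m R) : ∀ᶠ n : ℕ in atTop,
    0 < (configs q n (m n) (R n)).card := by
  obtain ⟨_, _, hAB⟩ := h.exponents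
  have h3 := (tendsto_exp_mul_log_sq (e := fun _ => 2 * (1 - α - β) - (1 - α)) tendsto_const_nhds
    (by linarith)).const_mul 1568
  rw [mul_zero] at h3
  filter_upwards [h.overlaps_le, h.card_bounds, h3.eventually (gt_mem_nhds one_pos)]
    with n ⟨h1, h2⟩ ⟨_, _, _, _, _, _, hR, _⟩ h4
  exact NetworkClusters.configs_nonempty q hR h1 (h2.trans_lt h4)

end SparseClusterModel

/-! ### The lower bound -/

/-- The exponent of the truncated second moment. -/
def truncExponent (A ρ : ℝ) : ℝ :=
  min (2 * ρ) √A ^ 2 + 2 * (2 * ρ - min (2 * ρ) √A) * √A - 2 * ρ ^ 2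

lemma continuous_truncExponent (A : ℝ) : Continuous (truncExponent A) := by
  unfold truncExponent; fun_prop

/-- The second condition makes m times the truncated mass negligible, the third the second moment.
For 2√r ≤ √A the truncated exponent is 2r and the third condition reads r < A/2 - B = β - A/2;
otherwise it reads √r < √A - √B. Both branches of the boundary imply √r + √B < √A, which is the
second condition. -/
lemma below_boundary {α β r : ℝ} (hA : 0 < 1 - α) (hB : 0 ≤ 1 - α - β) (hr : 0 < r)
    (h : r < detectionBoundary α β) :
    √r < √(1 - α) ∧ 1 - α - β - (√(1 - α) - √r) ^ 2 < 0 ∧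
      2 * (1 - α - β) - (1 - α) + truncExponent (1 - α) √r < 0 := by
  set A := 1 - α with hAdef
  set B := A - β with hBdef
  have hβ : β = A - B := by ring
  obtain ⟨x, hx, rfl⟩ : ∃ x : ℝ, 0 < x ∧ r = x ^ 2 :=
    ⟨√r, Real.sqrt_pos.2 hr, (Real.sq_sqrt hr.le).symm⟩
  obtain ⟨a, ha, hae⟩ : ∃ a : ℝ, 0 < a ∧ A = a ^ 2 :=
    ⟨√A, Real.sqrt_pos.2 hA, (Real.sq_sqrt hA.le).symm⟩
  obtain ⟨b, hb, hbe⟩ : ∃ b : ℝ, 0 ≤ b ∧ B = b ^ 2 :=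
    ⟨√B, Real.sqrt_nonneg _, (Real.sq_sqrt hB).symm⟩
  rw [detectionBoundary] at h
  rw [Real.sqrt_sq hx.le]
  unfold truncExponent
  change (if β / A < 3 / 4 then β - A / 2 else (√A - √B) ^ 2) > x ^ 2 at h
  rw [hβ, hae, hbe, Real.sqrt_sq ha.le, Real.sqrt_sq hb] at h
  rw [hae, hbe, Real.sqrt_sq ha.le]
  have ha2 : 0 < a ^ 2 := by positivity
  simp only [div_lt_iff₀ ha2] at h
  split_ifs at h with hc
  · have h1 : (x + b) ^ 2 < a ^ 2 := by nlinarith [sq_nonneg (x - b)]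
    have h2 : x + b < a := lt_of_pow_lt_pow_left₀ 2 ha.le h1
    have h3 : 2 * x < a := by nlinarith
    refine ⟨by linarith, by nlinarith, ?_⟩
    rw [min_eq_left h3.le]
    nlinarith
  · have hba : 2 * b ≤ a := by nlinarith
    have h2 : x + b < a := by
      have : x < a - b := lt_of_pow_lt_pow_left₀ 2 (by linarith) h
      linarith
    refine ⟨by linarith, by nlinarith, ?_⟩
    rcases le_total (2 * x) a with h3 | h3
    · rw [min_eq_left h3]
      rcases eq_or_lt_of_le hba with h4 | h4
      · have : 2 * x < a := by linarith
        nlinarith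
      · nlinarith
    · rw [min_eq_right h3]
      nlinarith

theorem mergeAsymptotically_of_lt (q : PlaneNorm) {α β r : ℝ} {m : ℕ → ℕ} {R : ℕ → ℝ}
    (h : SparseClusterModel q α β m R) (hr : 0 < r) (hrb : r < detectionBoundary α β) :
    MergeAsymptotically nullLaw fun n => altLaw q n (m n) (R n) (signalMean α r n) := by
  obtain ⟨hA, hB, hAB⟩ := h.exponents
  obtain ⟨hrA, he1, he2⟩ := below_boundary hA hB hr hrb
  set A := 1 - α with hAdef
  set B := A - β with hBdef
  -- The balls have size n^(2α) only asymptotically, so the standardized mean is √(2L) ρ n with ρ n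
  -- → √r. The exponents are continuous in ρ and strictly negative in the limit.
  let ρ : ℕ → ℝ := fun n => √r * √(sizeRatio q α R n)
  have hρ : Tendsto ρ atTop (𝓝 √r) := by
    have h1 : Tendsto (sizeRatio q α R) atTop (𝓝 1) := h.size
    have h2 := (h1.sqrt).const_mul √r
    rwa [Real.sqrt_one, mul_one] at h2
  have hlim1 : Tendsto (fun n : ℕ => 2 * Real.exp ((B - (√A - ρ n) ^ 2) * Real.log ((n : ℝ) ^ 2)))
      atTop (𝓝 0) := by
    have h1 := (tendsto_exp_mul_log_sq (((hρ.const_sub √A).pow 2).const_sub B) he1).const_mul 2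
    rwa [mul_zero] at h1
  have hlim2 : Tendsto (fun n : ℕ => 1568 *
      Real.exp ((2 * B - A + truncExponent A (ρ n)) * Real.log ((n : ℝ) ^ 2))) atTop (𝓝 0) := by
    have h1 := (tendsto_exp_mul_log_sq ((((continuous_truncExponent A).tendsto √r).comp
      hρ).const_add (2 * B - A)) he2).const_mul 1568
    rwa [mul_zero] at h1
  intro φ hφ h01
  have key : ∀ η : ℝ, 0 < η → η ≤ 1 / 4 → ∀ᶠ n in atTop,
      |((∫ ω, φ n ω ∂(nullLaw n)) + (∫ ω, (1 - φ n ω)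
        ∂(altLaw q n (m n) (R n) (signalMean α r n)))) - 1| ≤ 5 * η := by
    intro η hη hη4
    filter_upwards [h.card_bounds, h.overlaps_le, h.configs_nonempty,
      hρ.eventually (gt_mem_nhds hrA),
      hlim1.eventually (ge_mem_nhds (by positivity : 0 < η / 2)),
      hlim2.eventually (ge_mem_nhds (by positivity : 0 < η ^ 3 / 8))]
      with n ⟨hn, hm, hm2, _, hb2, _, hR, hRn⟩ ⟨hM, hO⟩ hC hρA hl1 hl2
    have hn0 : (0 : ℝ) < n := by exact_mod_cast (by omega : 0 < n)
    have hL0 : 0 ≤ Real.log ((n : ℝ) ^ 2) := by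
      refine Real.log_nonneg (one_le_pow₀ ?_)
      exact_mod_cast (by omega : 1 ≤ n)
    set Lg := Real.log ((n : ℝ) ^ 2) with hLg
    have hμ := signalMean_nonneg α r n
    have hae : signalMean α r n * √(latticeBallCard q (R n) : ℝ) = √(2 * Lg) * ρ n :=
      signalMean_mul_sqrt hr.le n _
    have hsq : √(2 * Lg) ^ 2 = 2 * Lg := Real.sq_sqrt (by positivity)
    have hs0 : 0 ≤ √(2 * Lg) := Real.sqrt_nonneg _
    have hprob := isProbabilityMeasure_altLaw (μ := signalMean α r n) hC
    -- The tilt k = √(2L) min(2ρ, √A) accompanies the truncation level T = √(2L) √A.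
    have hk : √(2 * Lg) * min (2 * ρ n) √A ≤ 2 * (√(2 * Lg) * ρ n) := by
      have := mul_le_mul_of_nonneg_left (min_le_left (2 * ρ n) √A) hs0
      linarith
    have h1 : m n * pValue (√(2 * Lg) * √A - √(2 * Lg) * ρ n) ≤ η / 2 := by
      refine le_trans ?_ hl1
      have h2 : 0 ≤ √(2 * Lg) * √A - √(2 * Lg) * ρ n := by
        rw [← mul_sub]; exact mul_nonneg hs0 (by linarith)
      rw [rpow_two_mul_eq_exp (by omega)] at hm2
      calc _ ≤ (2 * Real.exp (B * Lg)) *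
            Real.exp (-(√(2 * Lg) * √A - √(2 * Lg) * ρ n) ^ 2 / 2) :=
            mul_le_mul hm2 (pValue_le_exp h2) (pValue_nonneg _) (by positivity)
        _ = _ := by
          rw [mul_assoc, ← Real.exp_add, ← mul_sub, mul_pow, hsq]
          congr 2
          ring
    have h2 : (m n : ℝ) ^ 2 * (49 * latticeBallCard q (R n)) / (centers n (R n)).card *
        Real.exp ((√(2 * Lg) * min (2 * ρ n) √A) ^ 2 / 2 +
          (2 * (√(2 * Lg) * ρ n) - √(2 * Lg) * min (2 * ρ n) √A) * (√(2 * Lg) * √A) -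
          (√(2 * Lg) * ρ n) ^ 2) ≤ η ^ 3 / 8 := by
      refine le_trans ?_ hl2
      refine (mul_le_mul_of_nonneg_right hO (Real.exp_pos _).le).trans_eq ?_
      rw [mul_assoc, ← Real.exp_add, truncExponent]
      congr 2
      have h3 : (2 * (√(2 * Lg) * ρ n) - √(2 * Lg) * min (2 * ρ n) √A) * (√(2 * Lg) * √A) =
          √(2 * Lg) ^ 2 * ((2 * ρ n - min (2 * ρ n) √A) * √A) := by ring
      rw [h3, mul_pow, mul_pow, hsq]
      ring
    rw [← hae] at hk h1 h2
    have hp1 := integral_nullLaw_le q hR hm hμ hk hη hη4 hM hC h1 h2 (hφ n) (h01 n)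
    -- The bound is one-sided; the complementary test gives the other side.
    have hp2 := integral_nullLaw_le q hR hm hμ hk hη hη4 hM hC h1 h2
      (φ := fun ω => 1 - φ n ω) (by have := hφ n; fun_prop)
      fun X => ⟨by linarith [(h01 n X).2], by linarith [(h01 n X).1]⟩
    have hint : ∀ P : Measure (Site n → ℝ), IsProbabilityMeasure P → Integrable (φ n) P :=
      fun P _ => Integrable.of_bound (hφ n).aestronglyMeasurable 1 (ae_of_all _ fun X => by
        rw [Real.norm_of_nonneg (h01 n X).1]; exact (h01 n X).2)
    have hone : ∀ P : Measure (Site n → ℝ), IsProbabilityMeasure P →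
        ∫ ω, (1 - φ n ω) ∂P = 1 - ∫ ω, φ n ω ∂P := fun P hP => by
      rw [integral_sub (integrable_const _) (hint P hP)]; simp
    rw [hone _ inferInstance, hone _ hprob] at hp2
    rw [hone _ hprob, abs_le]
    constructor <;> linarith
  rw [Metric.tendsto_nhds]
  intro ε hε
  have hη : 0 < min (1 / 4) (ε / 10) := by positivity
  filter_upwards [key _ hη (min_le_left _ _)] with n hn
  rw [Real.dist_eq]
  refine hn.trans_lt ?_
  have := min_le_right (1 / 4) (ε / 10)
  linarith

/-! ### Lower bounds for the structured statistics -/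

lemma one_sub_pValue_le (x : ℝ) : 1 - pValue x ≤ pValue (-x) := by
  have h1 : gaussianReal 0 1 = (gaussianReal 0 1).map (fun y => -y) := by
    rw [gaussianReal_map_neg, neg_zero]
  have h2 : pValue (-x) = (gaussianReal 0 1).real (Set.Iic x) := by
    rw [pValue, h1, map_measureReal_apply measurable_neg measurableSet_Ici, ← h1]
    congr 1
    ext y
    simp
  rw [h2, pValue, ← probReal_compl_eq_one_sub measurableSet_Ici, Set.compl_Ici]
  exact measureReal_mono Set.Iio_subset_Iic_self (measure_ne_top _ _)

variable {n ℓ : ℕ}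

lemma level_le_sHC (q : PlaneNorm) (hℓ : ℓ ≤ levelMax n) (X : Site n → ℝ) :
    √((n : ℝ) ^ 2 / (2 ^ ℓ * (approxSet n ℓ).card)) *
      higherCriticism (approxSet n ℓ) (ballPValue q X ℓ) ≤ sHC q n X :=
  Finset.le_sup' (fun ℓ => √((n : ℝ) ^ 2 / (2 ^ ℓ * (approxSet n ℓ).card)) *
      higherCriticism (approxSet n ℓ) (ballPValue q X ℓ)) (Finset.mem_range.2 (by omega))

lemma level_le_sBJ (q : PlaneNorm) (hℓ : ℓ ≤ levelMax n) (X : Site n → ℝ) :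
    (n : ℝ) ^ 2 / (2 ^ ℓ * (approxSet n ℓ).card) *
      berkJones (approxSet n ℓ) (ballPValue q X ℓ) ≤ sBJ q n X :=
  Finset.le_sup' (fun ℓ => (n : ℝ) ^ 2 / (2 ^ ℓ * (approxSet n ℓ).card) *
      berkJones (approxSet n ℓ) (ballPValue q X ℓ)) (Finset.mem_range.2 (by omega))

/-- If at least `y` p-values of a level are at most `t`, then both statistics are large. -/
lemma exists_le_statistics (q : PlaneNorm) (hℓ : ℓ ≤ levelMax n) {X : Site n → ℝ} {t y : ℝ}
    (ht : 0 < t) (hNt : (approxSet n ℓ).card * t < y)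
    (hy : y ≤ numLe (approxSet n ℓ) (ballPValue q X ℓ) t)
    (hyN : y + 1 ≤ ((approxSet n ℓ).card : ℝ) / 2) :
    ∃ u : ℝ, y / (approxSet n ℓ).card ≤ u ∧
      √((n : ℝ) ^ 2 / (2 ^ ℓ * (approxSet n ℓ).card)) *
        (√((approxSet n ℓ).card : ℝ) * (u - t) / √t) ≤ sHC q n X ∧
      (n : ℝ) ^ 2 / (2 ^ ℓ * (approxSet n ℓ).card) *
        ((approxSet n ℓ).card * (u * Real.log (u / t) - u + t)) ≤ sBJ q n X := by
  set N := (approxSet n ℓ).card with hN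
  have hy0 : 0 < y := lt_of_le_of_lt (by positivity) hNt
  have hN0 : (0 : ℝ) < N := by linarith
  have h1 : 1 ≤ ⌈y⌉₊ := Nat.ceil_pos.2 hy0
  have h2 : ⌈y⌉₊ ≤ N / 2 := by
    have h3 : (⌈y⌉₊ : ℝ) < N / 2 := (Nat.ceil_lt_add_one hy0.le).trans_le hyN
    rw [Nat.le_div_iff_mul_le two_pos]
    have h4 : (⌈y⌉₊ : ℝ) * 2 ≤ N := by linarith
    exact_mod_cast h4
  have h3 : ⌈y⌉₊ ≤ numLe (approxSet n ℓ) (ballPValue q X ℓ) t := Nat.ceil_le.2 hy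
  have h4 : y / N ≤ (⌈y⌉₊ : ℝ) / N := by gcongr; exact Nat.le_ceil y
  have h5 : t < (⌈y⌉₊ : ℝ) / N := by
    refine lt_of_lt_of_le ?_ h4
    rw [lt_div_iff₀ hN0]; linarith
  have hp : ∀ a ∈ approxSet n ℓ, 0 < ballPValue q X ℓ a := fun a _ => pValue_pos _
  refine ⟨(⌈y⌉₊ : ℝ) / N, h4, ?_, ?_⟩
  · refine le_trans ?_ (level_le_sHC q hℓ X)
    gcongr
    exact le_higherCriticism hp h1 h2 h3 h5
  · refine le_trans ?_ (level_le_sBJ q hℓ X)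
    gcongr
    exact le_berkJones hp h1 h2 h3 h5

/-- A Bernstein form of the entropy bound: (u - t)² / (u + t) is increasing in u ≥ t and is
evaluated at t + v. -/
lemma sq_div_le_of_le {t v u : ℝ} (ht : 0 < t) (hv : 0 ≤ v) (hu : t + v ≤ u) :
    v ^ 2 / (2 * t + v) ≤ u * Real.log (u / t) - u + t := by
  have h1 := sq_sub_le_mul ht (by linarith : t ≤ u)
  have h2 : v ^ 2 * (u + t) ≤ (u - t) ^ 2 * (2 * t + v) := by
    obtain ⟨w, rfl⟩ : ∃ w, u = t + v + w := ⟨u - t - v, by ring⟩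
    have hw : 0 ≤ w := by linarith
    have : (t + v + w - t) ^ 2 * (2 * t + v) - v ^ 2 * (t + v + w + t) =
      w * (4 * t * v + v ^ 2) + w ^ 2 * (2 * t + v) := by ring
    have h3 : 0 ≤ w * (4 * t * v + v ^ 2) + w ^ 2 * (2 * t + v) := by positivity
    linarith
  rw [div_le_iff₀ (by linarith)]
  have hut : 0 < u + t := by linarith
  have h3 : v ^ 2 * (u + t) ≤ (u * Real.log (u / t) - u + t) * (2 * t + v) * (u + t) := by
    refine h2.trans ?_
    have := mul_le_mul_of_nonneg_right h1 (by linarith : 0 ≤ 2 * t + v)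
    linarith
  exact le_of_mul_le_mul_right h3 hut

/-- Lower bounds when the number of small p-values exceeds its mean under the null hypothesis by
`e / 2`. -/
lemma le_statistics_of_excess (q : PlaneNorm) (hn : 0 < n) (hℓ : ℓ ≤ levelMax n) {X : Site n → ℝ}
    {t e Q : ℝ} (ht : 0 < t) (he : 0 < e)
    (hy : (approxSet n ℓ).card * t + e / 2 ≤ numLe (approxSet n ℓ) (ballPValue q X ℓ) t)
    (hyN : (approxSet n ℓ).card * t + e / 2 + 1 ≤ ((approxSet n ℓ).card : ℝ) / 2)
    (hQ : 2 ^ ℓ * (approxSet n ℓ).card / (n : ℝ) ^ 2 * ((approxSet n ℓ).card * t + e) ≤ Q * e ^ 2) :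
    1 / (2 * √Q) ≤ sHC q n X ∧ 1 / (8 * Q) ≤ sBJ q n X := by
  obtain ⟨u, hu, h1, h2⟩ := exists_le_statistics q hℓ ht (by linarith) hy hyN
  set N : ℝ := ((approxSet n ℓ).card : ℝ) with hNdef
  have hN0 : 0 < N := by
    have h3 : 0 ≤ N := Nat.cast_nonneg _
    have h4 : 0 ≤ N * t := by positivity
    linarith
  have hn0 : (0 : ℝ) < n := by exact_mod_cast hn
  set K : ℝ := 2 ^ ℓ * N / (n : ℝ) ^ 2 with hK
  have hK0 : 0 < K := by positivity
  have hKi : (n : ℝ) ^ 2 / (2 ^ ℓ * N) = 1 / K := by rw [hK, one_div_div]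
  have hue : t + e / (2 * N) ≤ u := by
    refine le_trans (le_of_eq ?_) hu
    field_simp
  have hQ0 : 0 < Q := by
    have h3 : 0 < K * (N * t + e) := by positivity
    exact pos_of_mul_pos_left (h3.trans_le hQ) (sq_nonneg e)
  rw [hKi] at h1 h2
  constructor
  · refine le_trans ?_ h1
    have h3 : √N * (e / (2 * N)) / √t ≤ √N * (u - t) / √t := by gcongr; linarith
    refine le_trans ?_ (mul_le_mul_of_nonneg_left h3 (Real.sqrt_nonneg _))
    have h4 : √(1 / K) * (√N * (e / (2 * N)) / √t) = √(e ^ 2 / (4 * (K * (N * t)))) := by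
      rw [Real.sqrt_div' 1 hK0.le, Real.sqrt_div' (e ^ 2) (by positivity), Real.sqrt_sq he.le,
        Real.sqrt_mul (by norm_num) (K * (N * t)), Real.sqrt_mul hK0.le, Real.sqrt_mul hN0.le,
        show (4 : ℝ) = 2 ^ 2 by norm_num, Real.sqrt_sq zero_le_two, Real.sqrt_one]
      have hsN : √N ≠ 0 := (Real.sqrt_pos.2 hN0).ne'
      have hsK : √K ≠ 0 := (Real.sqrt_pos.2 hK0).ne'
      have hst : √t ≠ 0 := (Real.sqrt_pos.2 ht).ne'
      have h5 : N = √N ^ 2 := (Real.sq_sqrt hN0.le).symm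
      nth_rewrite 2 [h5]
      field_simp
    have h6 : 1 / (2 * √Q) = √(1 / (4 * Q)) := by
      rw [Real.sqrt_div' 1 (by positivity), Real.sqrt_mul (by norm_num),
        show (4 : ℝ) = 2 ^ 2 by norm_num, Real.sqrt_sq zero_le_two, Real.sqrt_one]
    rw [h4, h6]
    refine Real.sqrt_le_sqrt ?_
    rw [div_le_div_iff₀ (by positivity) (by positivity)]
    have h7 : K * (N * t) ≤ K * (N * t + e) := by gcongr; linarith
    linarith
  · refine le_trans ?_ h2
    have h3 := sq_div_le_of_le ht (by positivity : 0 ≤ e / (2 * N)) hue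
    refine le_trans ?_ (mul_le_mul_of_nonneg_left (mul_le_mul_of_nonneg_left h3 hN0.le)
      (by positivity))
    have h4 : 1 / K * (N * ((e / (2 * N)) ^ 2 / (2 * t + e / (2 * N)))) =
        e ^ 2 / (K * (8 * (N * t) + 2 * e)) := by
      have h5 : 2 * t + e / (2 * N) = (4 * (N * t) + e) / (2 * N) := by field_simp; ring
      have h6 : (4 * (N * t) + e) ≠ 0 := by positivity
      have h7 : (8 * (N * t) + 2 * e) = 2 * (4 * (N * t) + e) := by ring
      rw [h5, h7]
      generalize 4 * (N * t) + e = D at h6 ⊢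
      field_simp
    rw [h4, div_le_div_iff₀ (by positivity) (by positivity)]
    have h7 : K * (8 * (N * t) + 2 * e) ≤ 8 * (K * (N * t + e)) := by
      have : 0 ≤ K * e := by positivity
      linarith
    linarith

/-- Lower bounds when a fixed proportion of the classes has a small p-value. -/
lemma le_statistics_of_proportion (q : PlaneNorm) (hn : 0 < n) (hℓ : ℓ ≤ levelMax n)
    {X : Site n → ℝ} {t κ : ℝ} (ht : 0 < t) (hκ : 0 < κ) (hN : 0 < (approxSet n ℓ).card)
    (hy : κ / 2 * (2 ^ ℓ * (approxSet n ℓ).card / (n : ℝ) ^ 2) ≤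
      numLe (approxSet n ℓ) (ballPValue q X ℓ) t)
    (hyN : κ / 2 * (2 ^ ℓ * (approxSet n ℓ).card / (n : ℝ) ^ 2) + 1 ≤
      ((approxSet n ℓ).card : ℝ) / 2)
    (hW : 6 ≤ κ * (2 ^ ℓ / ((n : ℝ) ^ 2 * t))) :
    κ / 4 * √(2 ^ ℓ / ((n : ℝ) ^ 2 * t)) ≤ sHC q n X ∧
      κ / 2 * (Real.log (κ / 2 * (2 ^ ℓ / ((n : ℝ) ^ 2 * t))) - 1) ≤ sBJ q n X := by
  set N : ℝ := ((approxSet n ℓ).card : ℝ) with hNdef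
  have hN0 : 0 < N := Nat.cast_pos.2 hN
  have hn0 : (0 : ℝ) < n := by exact_mod_cast hn
  set W : ℝ := 2 ^ ℓ / ((n : ℝ) ^ 2 * t) with hWdef
  have hW0 : 0 < W := by positivity
  set K : ℝ := 2 ^ ℓ * N / (n : ℝ) ^ 2 with hK
  have hK0 : 0 < K := by positivity
  have hKW : K = W * (N * t) := by rw [hK, hWdef]; field_simp
  have hKi : (n : ℝ) ^ 2 / (2 ^ ℓ * N) = 1 / K := by rw [hK, one_div_div]
  have hNt : N * t < κ / 2 * K := by
    rw [hKW]
    have h3 : 0 < N * t := by positivity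
    nlinarith
  obtain ⟨u, hu, h1, h2⟩ := exists_le_statistics q hℓ ht hNt hy hyN
  rw [← hNdef] at hu h1 h2
  rw [hKi] at h1 h2
  have hut : κ / 2 * W * t ≤ u := by
    refine le_trans (le_of_eq ?_) hu
    rw [hKW]; field_simp
  have hu0 : 0 < u := lt_of_lt_of_le (by positivity) hut
  have hNu : κ / 2 * K ≤ N * u := by
    rw [div_le_iff₀ hN0] at hu; linarith
  constructor
  · refine le_trans ?_ h1
    have h3 : κ / 4 * W * t ≤ u - t := by nlinarith
    refine le_trans ?_ (mul_le_mul_of_nonneg_left (by gcongr : √N * (κ / 4 * W * t) / √t ≤ _)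
      (Real.sqrt_nonneg _))
    refine le_of_eq ?_
    rw [hKW, Real.sqrt_div' 1 (by positivity), Real.sqrt_mul hW0.le, Real.sqrt_mul hN0.le,
      Real.sqrt_one]
    have hsN : √N ≠ 0 := (Real.sqrt_pos.2 hN0).ne'
    have hsW : √W ≠ 0 := (Real.sqrt_pos.2 hW0).ne'
    have hst : √t ≠ 0 := (Real.sqrt_pos.2 ht).ne'
    have h5 : W = √W ^ 2 := (Real.sq_sqrt hW0.le).symm
    have h6 : t = √t ^ 2 := (Real.sq_sqrt ht.le).symm
    nth_rewrite 3 [h5]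
    nth_rewrite 2 [h6]
    field_simp
  · refine le_trans ?_ h2
    have hlog : Real.log (κ / 2 * W) ≤ Real.log (u / t) := by
      refine Real.log_le_log (by positivity) ?_
      rw [le_div_iff₀ ht]; exact hut
    have hlog1 : 1 ≤ Real.log (κ / 2 * W) := by
      rw [Real.le_log_iff_exp_le (by positivity)]
      linarith [Real.exp_one_lt_three]
    have h3 : κ / 2 * K * (Real.log (κ / 2 * W) - 1) ≤ N * (u * Real.log (u / t) - u + t) := by
      calc _ ≤ N * u * (Real.log (u / t) - 1) := by gcongr
        _ ≤ _ := by
          have : 0 ≤ N * t := by positivity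
          nlinarith
    calc _ = 1 / K * (κ / 2 * K * (Real.log (κ / 2 * W) - 1)) := by field_simp
      _ ≤ _ := by gcongr

/-! ### The number of small p-values -/

lemma ballPValue_le_iff (q : PlaneNorm) (X : Site n → ℝ) (b : ℕ × Site n) (z : ℝ) :
    ballPValue q X ℓ b ≤ pValue z ↔ z ≤ scan (ball q b.2 (radius n ℓ b.1)) X := by
  rw [ballPValue_eq, pValue_strictAnti.le_iff_ge]

/-- Chebyshev's inequality for the number of small p-values. -/
lemma obsLaw_numLe_lt_le (q : PlaneNorm) (hn : 3 ≤ n) (hℓ : ℓ ≤ levelMax n) (θ : Site n → ℝ)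
    {z e : ℝ} (he : 0 < e) (hE : (approxSet n ℓ).card * pValue z + e ≤
      ∑ b ∈ approxSet n ℓ, pValue (z - scan (ball q b.2 (radius n ℓ b.1)) θ)) :
    (obsLaw θ).real {X | (numLe (approxSet n ℓ) (ballPValue q X ℓ) (pValue z) : ℝ) <
      (approxSet n ℓ).card * pValue z + e / 2} ≤
      16 * classCount n ℓ * ((approxSet n ℓ).card * pValue z + e) / e ^ 2 := by
  classical
  set A := approxSet n ℓ with hA
  set P := obsLaw θ
  let I : ℕ × Site n → Finset (Site n) := fun b => ball q b.2 (radius n ℓ b.1)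
  let f : ℕ × Site n → (Site n → ℝ) → ℝ := fun b X => (Set.Ici z).indicator 1 (scan (I b) X)
  have hg : Measurable ((Set.Ici z).indicator (1 : ℝ → ℝ)) :=
    measurable_one.indicator measurableSet_Ici
  have hfm : ∀ b, Measurable (f b) := fun b => hg.comp (measurable_scan _)
  have hf0 : ∀ b X, 0 ≤ f b X := fun b X => Set.indicator_nonneg (fun _ _ => zero_le_one) _
  have hf1 : ∀ b X, f b X ≤ 1 := fun b X =>
    Set.indicator_le_self' (fun _ _ => zero_le_one) _
  have hfi : ∀ b, Integrable (f b) P := fun b =>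
    Integrable.of_bound (hfm b).aestronglyMeasurable 1 (ae_of_all _ fun X => by
      rw [Real.norm_of_nonneg (hf0 b X)]; exact hf1 b X)
  have hmean : ∀ b, ∫ X, f b X ∂P = pValue (z - scan (I b) θ) := fun b => by
    rw [← obsLaw_scan_ge θ (ball_nonempty q b.2 (radius_pos b.1))]
    change _ = P.real (scan (I b) ⁻¹' Set.Ici z)
    rw [← integral_indicator_one ((measurable_scan _) measurableSet_Ici)]
    rfl
  have hT : ∀ X, (numLe A (ballPValue q X ℓ) (pValue z) : ℝ) = (∑ b ∈ A, f b) X := fun X => by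
    rw [numLe, Finset.card_filter, Finset.sum_apply]
    push_cast
    refine Finset.sum_congr rfl fun b _ => ?_
    simp only [ballPValue_le_iff, f, Set.indicator_apply, Set.mem_Ici, Pi.one_apply, I]
  set E := ∫ X, (∑ b ∈ A, f b) X ∂P with hEdef
  have hEe : E = ∑ b ∈ A, pValue (z - scan (I b) θ) := by
    rw [hEdef]
    simp_rw [Finset.sum_apply]
    rw [integral_finsetSum _ fun b _ => hfi b]
    exact Finset.sum_congr rfl fun b _ => hmean b
  -- The indicators satisfy f b · f b' ≤ f b, and each ball meets at most 4 · `classCount` balls of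
  -- its level.
  have hvar : Var[∑ b ∈ A, f b; P] ≤ 4 * classCount n ℓ * E := by
    refine (variance_sum_le_of_indepFun A f 1 (fun b _ => hfm b) (fun b _ => hf0 b)
      (fun b _ => hf1 b) (fun b' b => ¬Disjoint (I b) (I b')) ?_).trans ?_
    · intro b _ b' _ h
      rw [not_not] at h
      exact (indepFun_scan θ h).comp hg hg
    · rw [hEe, Finset.mul_sum]
      refine Finset.sum_le_sum fun b hb => ?_
      refine (Finset.sum_le_card_nsmul _ _ (pValue (z - scan (I b) θ)) fun b' _ => ?_).trans ?_
      · rw [← hmean b]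
        refine integral_mono_of_nonneg (ae_of_all _ fun X => mul_nonneg (hf0 b X) (hf0 b' X))
          (hfi b) (ae_of_all _ fun X => mul_le_of_le_one_right (hf0 b X) (hf1 b' X))
      · rw [nsmul_eq_mul]
        refine mul_le_mul_of_nonneg_right ?_ (pValue_nonneg _)
        exact_mod_cast card_not_disjoint_le q hn hℓ hb
  have hLp : MemLp (∑ b ∈ A, f b) 2 P := memLp_finsetSum' _ fun b _ =>
    MemLp.of_bound (hfm b).aestronglyMeasurable 1 (ae_of_all _ fun ω => by
      rw [Real.norm_of_nonneg (hf0 b ω)]; exact hf1 b ω)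
  set M : ℝ := A.card * pValue z + e with hM
  have hMe : e ≤ M := by
    have := mul_nonneg (Nat.cast_nonneg (α := ℝ) A.card) (pValue_nonneg z)
    linarith
  have hEM : M ≤ E := by rw [hEe]; exact hE
  have hd : 0 < E - M + e / 2 := by linarith
  have h3 := meas_ge_le_variance_div_sq hLp hd
  have h4 : P.real {X | E - M + e / 2 ≤ |(∑ b ∈ A, f b) X - E|} ≤
      Var[∑ b ∈ A, f b; P] / (E - M + e / 2) ^ 2 :=
    ENNReal.toReal_le_of_le_ofReal (div_nonneg (variance_nonneg _ _) (by positivity)) h3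
  refine (measureReal_mono ?_ (measure_ne_top _ _)).trans (h4.trans ?_)
  · intro X hX
    rw [Set.mem_ofPred_eq, hT] at hX
    rw [Set.mem_ofPred_eq]
    refine le_trans ?_ (neg_le_abs _)
    linarith
  · rw [div_le_div_iff₀ (by positivity) (by positivity)]
    -- A larger mean only helps: Chebyshev's ratio E / (E - M + e/2)² is at most its value at E = M,
    -- as e ≤ M.
    have h5 : E * e ^ 2 ≤ 4 * (M * (E - M + e / 2) ^ 2) := by
      obtain ⟨x, hx⟩ : ∃ x, E = M + x := ⟨E - M, by ring⟩
      have hx0 : 0 ≤ x := by linarith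
      have hM0 : 0 < M := by linarith
      have h6 : 4 * (M * (E - M + e / 2) ^ 2) - E * e ^ 2 =
          4 * M * x ^ 2 + e * x * (4 * M - e) := by rw [hx]; ring
      have h7 : 0 ≤ 4 * M * x ^ 2 + e * x * (4 * M - e) :=
        add_nonneg (by positivity) (mul_nonneg (by positivity) (by linarith))
      linarith
    calc Var[∑ b ∈ A, f b; P] * e ^ 2 ≤ 4 * classCount n ℓ * E * e ^ 2 := by gcongr
      _ = 4 * classCount n ℓ * (E * e ^ 2) := by ring
      _ ≤ 4 * classCount n ℓ * (4 * (M * (E - M + e / 2) ^ 2)) := by gcongr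
      _ = _ := by ring

/-- Markov's inequality for the number of large p-values among balls with a large mean. -/
lemma obsLaw_numLe_lt_half_le (q : PlaneNorm) (θ : Site n → ℝ) {z y : ℝ} {B : Finset (ℕ × Site n)}
    (hB : B ⊆ approxSet n ℓ) (hB0 : 0 < B.card)
    (hθ : ∀ b ∈ B, y ≤ scan (ball q b.2 (radius n ℓ b.1)) θ) :
    (obsLaw θ).real {X | (numLe (approxSet n ℓ) (ballPValue q X ℓ) (pValue z) : ℝ) <
      (B.card : ℝ) / 2} ≤ 2 * pValue (y - z) := by
  classical
  set P := obsLaw θ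
  let I : ℕ × Site n → Finset (Site n) := fun b => ball q b.2 (radius n ℓ b.1)
  let f : ℕ × Site n → (Site n → ℝ) → ℝ := fun b X => (Set.Iio z).indicator 1 (scan (I b) X)
  have hg : Measurable ((Set.Iio z).indicator (1 : ℝ → ℝ)) :=
    measurable_one.indicator measurableSet_Iio
  have hfm : ∀ b, Measurable (f b) := fun b => hg.comp (measurable_scan _)
  have hf0 : ∀ b X, 0 ≤ f b X := fun b X => Set.indicator_nonneg (fun _ _ => zero_le_one) _
  have hf1 : ∀ b X, f b X ≤ 1 := fun b X =>
    Set.indicator_le_self' (fun _ _ => zero_le_one) _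
  have hfi : ∀ b, Integrable (f b) P := fun b =>
    Integrable.of_bound (hfm b).aestronglyMeasurable 1 (ae_of_all _ fun X => by
      rw [Real.norm_of_nonneg (hf0 b X)]; exact hf1 b X)
  have hmean : ∀ b ∈ B, ∫ X, f b X ∂P ≤ pValue (y - z) := fun b hb => by
    have h1 : ∫ X, f b X ∂P = P.real (scan (I b) ⁻¹' Set.Ici z)ᶜ := by
      rw [← integral_indicator_one ((measurable_scan _) measurableSet_Ici).compl]
      refine integral_congr_ae (ae_of_all _ fun X => ?_)
      simp only [f, Set.indicator_apply, Set.mem_Iio, Set.mem_compl_iff, Set.mem_preimage,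
        Set.mem_Ici, not_le,        Pi.one_apply]
    have h2 : P.real (scan (I b) ⁻¹' Set.Ici z) = pValue (z - scan (I b) θ) :=
      obsLaw_scan_ge θ (ball_nonempty q b.2 (radius_pos b.1)) z
    rw [h1, probReal_compl_eq_one_sub ((measurable_scan _) measurableSet_Ici), h2]
    refine (one_sub_pValue_le _).trans (pValue_strictAnti.antitone ?_)
    have := hθ b hb
    simp only [I]
    linarith
  have hB0' : (0 : ℝ) < B.card := by exact_mod_cast hB0
  let F : (Site n → ℝ) → ℝ := fun X => ∑ b ∈ B, f b X
  have hF0 : ∀ X, 0 ≤ F X := fun X => Finset.sum_nonneg fun b _ => hf0 b X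
  have hFi : Integrable F P := integrable_finsetSum _ fun b _ => hfi b
  have hFm : ∫ X, F X ∂P ≤ B.card * pValue (y - z) := by
    rw [integral_finsetSum _ fun b _ => hfi b]
    refine (Finset.sum_le_card_nsmul _ _ _ hmean).trans_eq (nsmul_eq_mul _ _)
  have h3 := mul_meas_ge_le_integral_of_nonneg (ae_of_all _ hF0) hFi ((B.card : ℝ) / 2)
  have h4 : P.real {X | (B.card : ℝ) / 2 ≤ F X} ≤ 2 * pValue (y - z) := by
    have h5 : (B.card : ℝ) / 2 * P.real {X | (B.card : ℝ) / 2 ≤ F X} ≤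
        (B.card : ℝ) / 2 * (2 * pValue (y - z)) := by
      refine (h3.trans hFm).trans_eq ?_
      ring
    exact le_of_mul_le_mul_left h5 (by positivity)
  refine (measureReal_mono ?_ (measure_ne_top _ _)).trans h4
  intro X hX
  rw [Set.mem_ofPred_eq] at hX ⊢
  have h5 : (B.card : ℝ) ≤ F X + numLe (approxSet n ℓ) (ballPValue q X ℓ) (pValue z) := by
    have h6 : (B.card : ℝ) = F X +
        ∑ b ∈ B, if ballPValue q X ℓ b ≤ pValue z then (1 : ℝ) else 0 := by
      simp only [F]
      rw [← Finset.sum_add_distrib, Finset.card_eq_sum_ones]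
      push_cast
      refine Finset.sum_congr rfl fun b _ => ?_
      simp only [ballPValue_le_iff, f, Set.indicator_apply, Set.mem_Iio, Pi.one_apply, I]
      by_cases h : scan (ball q b.2 (radius n ℓ b.1)) X < z
      · simp [h, not_le.2 h]
      · simp [h, not_lt.1 h]
    rw [h6, numLe, Finset.card_filter]
    push_cast
    gcongr
  linarith

/-! ### The power for fixed locations -/

lemma signal_nonneg (q : PlaneNorm) {n m : ℕ} {R μ : ℝ} (hμ : 0 ≤ μ) (c : Fin m → Site n)
    (x : Site n) : 0 ≤ signal q R μ c x := by
  unfold signal; split_ifs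
  · exact hμ
  · exact le_rfl

lemma scan_signal_nonneg (q : PlaneNorm) {n m : ℕ} {R μ : ℝ} (hμ : 0 ≤ μ) (c : Fin m → Site n)
    (I : Finset (Site n)) : 0 ≤ scan I (signal q R μ c) :=
  div_nonneg (Finset.sum_nonneg fun x _ => signal_nonneg q hμ c x) (Real.sqrt_nonneg _)

lemma scan_signal_of_subset (q : PlaneNorm) {n m : ℕ} {R μ : ℝ} (c : Fin m → Site n) (g : Fin m)
    {I : Finset (Site n)} (hI : I ⊆ ball q (c g) R) :
    scan I (signal q R μ c) = μ * √(I.card : ℝ) := by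
  have h1 : ∀ x ∈ I, signal q R μ c x = μ := fun x hx => by
    rw [signal, if_pos ⟨g, hI hx⟩]
  rw [scan, Finset.sum_congr rfl h1, Finset.sum_const, nsmul_eq_mul, mul_comm, mul_div_assoc,
    Real.div_sqrt]

/-- `B` consists of balls of level `ℓ` that are contained in the ball of radius `R` around `c` and
in which the signal has standardized mean at least `y`. -/
structure IsApproximant (q : PlaneNorm) {n : ℕ} (ℓ : ℕ) (R μ y : ℝ) (c : Site n)
    (B : Finset (ℕ × Site n)) : Prop where
  subset : B ⊆ approxSet n ℓ
  ball_subset : ∀ b ∈ B, ball q b.2 (radius n ℓ b.1) ⊆ ball q c R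
  mean : ∀ b ∈ B, y ≤ μ * √((ball q b.2 (radius n ℓ b.1)).card : ℝ)

variable {n ℓ : ℕ}

/-- The mean number of p-values that are at most `pValue z`. -/
lemma le_sum_pValue {q : PlaneNorm} {m : ℕ} {R μ y z k : ℝ} (hμ : 0 ≤ μ) {c : Fin m → Site n}
    (hc : c ∈ configs q n m R) {B : Fin m → Finset (ℕ × Site n)}
    (hB : ∀ g, IsApproximant q ℓ R μ y (c g) (B g)) (hk : ∀ g, k ≤ (B g).card)
    (hzy : pValue z ≤ pValue (z - y) / 2) :
    (approxSet n ℓ).card * pValue z + m * k * (pValue (z - y) / 2) ≤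
      ∑ b ∈ approxSet n ℓ, pValue (z - scan (ball q b.2 (radius n ℓ b.1)) (signal q R μ c)) := by
  classical
  set S := Finset.univ.biUnion B with hS
  have hSA : S ⊆ approxSet n ℓ := Finset.biUnion_subset.2 fun g _ => (hB g).subset
  -- A nonempty ball cannot be contained in two disjoint clusters, so no approximant is counted
  -- twice.
  have hdisj : ∀ g ∈ (Finset.univ : Finset (Fin m)), ∀ h ∈ (Finset.univ : Finset (Fin m)), g ≠ h →
      Disjoint (B g) (B h) := by
    intro g _ h _ hgh
    rw [Finset.disjoint_left]
    intro b hb hb'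
    have h1 := not_not.1 ((mem_configs.1 hc).2 g h hgh)
    obtain ⟨x, hx⟩ := ball_nonempty q b.2 (radius_pos (n := n) (ℓ := ℓ) b.1)
    exact Finset.disjoint_left.1 h1 ((hB g).ball_subset b hb hx) ((hB h).ball_subset b hb' hx)
  have hScard : (m : ℝ) * k ≤ S.card := by
    rw [hS, Finset.card_biUnion hdisj]
    push_cast
    calc (m : ℝ) * k = ∑ _g : Fin m, k := by simp
      _ ≤ _ := Finset.sum_le_sum fun g _ => hk g
  have hterm : ∀ b ∈ approxSet n ℓ, pValue z + (if b ∈ S then pValue (z - y) / 2 else 0) ≤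
      pValue (z - scan (ball q b.2 (radius n ℓ b.1)) (signal q R μ c)) := by
    intro b _
    split_ifs with hbS
    · obtain ⟨g, _, hg⟩ := Finset.mem_biUnion.1 hbS
      have h1 := scan_signal_of_subset (μ := μ) q c g ((hB g).ball_subset b hg)
      have h2 := (hB g).mean b hg
      have h3 : pValue (z - y) ≤ pValue (z - scan (ball q b.2 (radius n ℓ b.1))
          (signal q R μ c)) := pValue_strictAnti.antitone (by rw [h1]; linarith)
      linarith
    · rw [add_zero]
      refine pValue_strictAnti.antitone ?_
      linarith [scan_signal_nonneg q hμ c (R := R) (ball q b.2 (radius n ℓ b.1))]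
  refine le_trans ?_ (Finset.sum_le_sum hterm)
  rw [Finset.sum_add_distrib, Finset.sum_const, nsmul_eq_mul, Finset.sum_ite_mem,
    Finset.inter_eq_right.2 hSA, Finset.sum_const, nsmul_eq_mul]
  have := mul_le_mul_of_nonneg_right hScard (by linarith [pValue_nonneg (z - y)] :
    0 ≤ pValue (z - y) / 2)
  linarith

/-- With K = 2^ℓ n_ℓ / n², the reciprocal weight, each cluster supplies at least κK balls, so the
excess of the mean is e = mκK · `pValue (z - y)` / 2. The expression bounded by Q is K (n_ℓ t + e) /
e². Since `classCount` is at most 110592 K, the same ratio bounds the Chebyshev error and determines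
the size of the statistics. -/
lemma obsLaw_signal_small_le {q : PlaneNorm} (hn : 3 ≤ n) (hℓ : ℓ ≤ levelMax n)
    (hN : 0 < (approxSet n ℓ).card) {m : ℕ} (hm : 0 < m) {R μ y z κ Q : ℝ} (hμ : 0 ≤ μ)
    (hκ : 0 < κ) {c : Fin m → Site n} (hc : c ∈ configs q n m R)
    {B : Fin m → Finset (ℕ × Site n)} (hB : ∀ g, IsApproximant q ℓ R μ y (c g) (B g))
    (hk : ∀ g, κ * (2 ^ ℓ * (approxSet n ℓ).card / (n : ℝ) ^ 2) ≤ (B g).card)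
    (hzy : pValue z ≤ pValue (z - y) / 2) (hz : pValue z ≤ 1 / 8) (hN8 : 8 ≤ (approxSet n ℓ).card)
    (hmκ : m * κ * (2 ^ ℓ / (n : ℝ) ^ 2) ≤ 1 / 2)
    (hQ : 4 * ((n : ℝ) ^ 2 / 2 ^ ℓ) * pValue z / (m * κ * pValue (z - y)) ^ 2 +
      2 / (m * κ * pValue (z - y)) ≤ Q) :
    (obsLaw (signal q R μ c)).real {X | ¬(1 / (2 * √Q) ≤ sHC q n X ∧ 1 / (8 * Q) ≤ sBJ q n X)} ≤
      1769472 * Q := by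
  have hE := le_sum_pValue hμ hc hB hk hzy
  set N : ℝ := ((approxSet n ℓ).card : ℝ) with hNdef
  have hN0 : 0 < N := Nat.cast_pos.2 hN
  have hN8' : 8 ≤ N := by rw [hNdef]; exact_mod_cast hN8
  have hn0 : (0 : ℝ) < n := by exact_mod_cast (by omega : 0 < n)
  have hm0 : (0 : ℝ) < m := by exact_mod_cast hm
  set K : ℝ := 2 ^ ℓ * N / (n : ℝ) ^ 2 with hK
  have hK0 : 0 < K := by positivity
  have hπ := pValue_pos (z - y)
  have ht := pValue_pos z
  set e : ℝ := m * (κ * K) * (pValue (z - y) / 2) with he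
  have he0 : 0 < e := by positivity
  have hQ' : K * (N * pValue z + e) ≤ Q * e ^ 2 := by
    have h1 : K * (N * pValue z + e) / e ^ 2 ≤ Q := by
      refine le_trans (le_of_eq ?_) hQ
      rw [he, hK]
      field_simp
      ring
    rwa [div_le_iff₀ (by positivity)] at h1
  have heN : e ≤ N / 4 := by
    have h1 : e = m * κ * (2 ^ ℓ / (n : ℝ) ^ 2) * N * (pValue (z - y) / 2) := by
      rw [he, hK]; ring
    rw [h1]
    have h2 := (pValue_lt_one (z - y)).le
    calc _ ≤ 1 / 2 * N * (1 / 2) := by gcongr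
      _ = _ := by ring
  have hyN : N * pValue z + e / 2 + 1 ≤ N / 2 := by nlinarith
  have hcheb := obsLaw_numLe_lt_le q hn hℓ (signal q R μ c) he0 hE
  refine (measureReal_mono ?_ (measure_ne_top _ _)).trans (hcheb.trans ?_)
  · intro X hX
    rw [Set.mem_ofPred_eq] at hX ⊢
    by_contra hcon
    exact hX (le_statistics_of_excess q (by omega) hℓ ht he0 (not_lt.1 hcon) hyN hQ')
  · have h1 := classCount_mul_le hn hℓ hN
    have h2 : (classCount n ℓ : ℝ) ≤ 110592 * K := by
      rw [hK, ← mul_div_assoc, le_div_iff₀ (by positivity)]; exact h1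
    rw [div_le_iff₀ (by positivity)]
    have h3 : 0 ≤ N * pValue z + e := by positivity
    calc 16 * (classCount n ℓ : ℝ) * (N * pValue z + e)
        ≤ 16 * (110592 * K) * (N * pValue z + e) := by gcongr
      _ = 1769472 * (K * (N * pValue z + e)) := by ring
      _ ≤ 1769472 * (Q * e ^ 2) := by gcongr
      _ = _ := by ring

/-- When the mean y of a single cluster exceeds the threshold z, Markov's inequality shows that half
of its approximants have small p-values. No independence is needed, so the number of clusters may
stay bounded. -/
lemma obsLaw_signal_small_le_of_large_mean {q : PlaneNorm} (hn : 3 ≤ n) (hℓ : ℓ ≤ levelMax n)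
    (hN : 0 < (approxSet n ℓ).card) {m : ℕ} {R μ y z κ : ℝ} (hκ : 0 < κ) {c : Fin m → Site n}
    (g : Fin m) {B : Finset (ℕ × Site n)} (hB : IsApproximant q ℓ R μ y (c g) B)
    (hk : κ * (2 ^ ℓ * (approxSet n ℓ).card / (n : ℝ) ^ 2) ≤ B.card)
    (hN8 : 8 ≤ (approxSet n ℓ).card) (hκn : κ * (2 ^ ℓ / (n : ℝ) ^ 2) ≤ 1 / 2)
    (hW : 6 ≤ κ * (2 ^ ℓ / ((n : ℝ) ^ 2 * pValue z))) :
    (obsLaw (signal q R μ c)).real {X | ¬(κ / 4 * √(2 ^ ℓ / ((n : ℝ) ^ 2 * pValue z)) ≤ sHC q n X ∧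
      κ / 2 * (Real.log (κ / 2 * (2 ^ ℓ / ((n : ℝ) ^ 2 * pValue z))) - 1) ≤ sBJ q n X)} ≤
      2 * pValue (y - z) := by
  set N : ℝ := ((approxSet n ℓ).card : ℝ) with hNdef
  have hN0 : 0 < N := Nat.cast_pos.2 hN
  have hN8' : 8 ≤ N := by rw [hNdef]; exact_mod_cast hN8
  have hn0 : (0 : ℝ) < n := by exact_mod_cast (by omega : 0 < n)
  set K : ℝ := 2 ^ ℓ * N / (n : ℝ) ^ 2 with hK
  have hK0 : 0 < K := by positivity
  have hB0 : 0 < B.card := by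
    have : (0 : ℝ) < B.card := lt_of_lt_of_le (by positivity) hk
    exact_mod_cast this
  have hyN : κ / 2 * K + 1 ≤ N / 2 := by
    have h1 : κ / 2 * K = κ * (2 ^ ℓ / (n : ℝ) ^ 2) * N / 2 := by rw [hK]; ring
    rw [h1]
    nlinarith
  have hmark := obsLaw_numLe_lt_half_le q (signal q R μ c) (z := z) (y := y) hB.subset hB0
    fun b hb => by
      rw [scan_signal_of_subset q c g (hB.ball_subset b hb)]; exact hB.mean b hb
  refine (measureReal_mono ?_ (measure_ne_top _ _)).trans hmark
  intro X hX
  rw [Set.mem_ofPred_eq] at hX ⊢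
  by_contra hcon
  refine hX (le_statistics_of_proportion q (by omega) hℓ (pValue_pos z) hκ hN ?_ hyN hW)
  linarith [not_lt.1 hcon]

/-- Bounds that hold for all locations also hold for random locations. -/
lemma altLaw_compl_le {q : PlaneNorm} {n m : ℕ} {R μ δ : ℝ} (hC : 0 < (configs q n m R).card)
    {S : Set (Site n → ℝ)}
    (h : ∀ c ∈ configs q n m R, (obsLaw (signal q R μ c)).real Sᶜ ≤ δ) :
    1 - δ ≤ (altLaw q n m R μ).real S ∧ (altLaw q n m R μ).real S ≤ 1 := by
  have hprob := isProbabilityMeasure_altLaw (μ := μ) hC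
  have hC0 : (0 : ℝ) < (configs q n m R).card := by exact_mod_cast hC
  refine ⟨?_, measureReal_le_one⟩
  have h1 : (altLaw q n m R μ).real Sᶜ ≤ δ := by
    rw [altLaw, measureReal_ennreal_smul_apply, measureReal_def, Measure.finsetSum_apply,
      ENNReal.toReal_sum fun _ _ => measure_ne_top _ _, ENNReal.toReal_inv, ENNReal.toReal_natCast]
    refine (mul_le_mul_of_nonneg_left (Finset.sum_le_card_nsmul _ _ δ h)
      (inv_nonneg.2 hC0.le)).trans_eq ?_
    rw [nsmul_eq_mul, inv_mul_cancel_left₀ hC0.ne']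
  have h2 := measureReal_union_le (μ := altLaw q n m R μ) S Sᶜ
  rw [Set.union_compl_self, probReal_univ] at h2
  linarith

/-! ### Asymptotics of the number of lattice points of a ball -/

lemma PlaneNorm.continuous_eval (q : PlaneNorm) :
    Continuous fun v : Fin 2 → ℝ => q.eval (v 0) (v 1) := by
  cases q
  · simp only [PlaneNorm.eval]; fun_prop
  · simp only [PlaneNorm.eval]; fun_prop

/-- The open unit disc of the norm. -/
def unitDisc (q : PlaneNorm) : Set (Fin 2 → ℝ) := {v | q.eval (v 0) (v 1) < 1}

lemma mem_smul_unitDisc (q : PlaneNorm) {x : ℝ} (hx : 0 < x) (v : Fin 2 → ℝ) :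
    x⁻¹ • v ∈ unitDisc q ↔ q.eval (v 0) (v 1) < x := by
  have h : q.eval (x⁻¹ * v 0) (x⁻¹ * v 1) = x⁻¹ * q.eval (v 0) (v 1) := by
    rw [q.eval_mul, abs_of_pos (inv_pos.2 hx)]
  simp only [unitDisc, Set.mem_ofPred_eq, Pi.smul_apply, smul_eq_mul, h]
  rw [inv_mul_lt_iff₀ hx, mul_one]

lemma isOpen_unitDisc (q : PlaneNorm) : IsOpen (unitDisc q) :=
  isOpen_lt q.continuous_eval continuous_const

lemma convex_unitDisc (q : PlaneNorm) : Convex ℝ (unitDisc q) := by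
  intro v hv w hw a b ha hb hab
  have hv' : q.eval (v 0) (v 1) < 1 := hv
  have hw' : q.eval (w 0) (w 1) < 1 := hw
  have h := q.eval_add_le (a * v 0) (a * v 1) (b * w 0) (b * w 1)
  rw [q.eval_mul, q.eval_mul, abs_of_nonneg ha, abs_of_nonneg hb] at h
  refine h.trans_lt ?_
  rcases ha.eq_or_lt with rfl | ha
  · rw [zero_add] at hab
    simpa [hab] using hw'
  · have h1 := mul_lt_mul_of_pos_left hv' ha
    have h2 := mul_le_mul_of_nonneg_left hw'.le hb
    linarith

lemma isBounded_unitDisc (q : PlaneNorm) : Bornology.IsBounded (unitDisc q) := by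
  rw [isBounded_iff_forall_norm_le]
  refine ⟨1, fun v hv => ?_⟩
  have hv' : q.eval (v 0) (v 1) < 1 := hv
  rw [pi_norm_le_iff_of_nonneg zero_le_one]
  intro i
  fin_cases i
  · exact (q.abs_fst_le _ _).trans hv'.le
  · exact (q.abs_snd_le _ _).trans hv'.le

open scoped Pointwise in
lemma latticeBallCard_eq_natCard (q : PlaneNorm) {x : ℝ} (hx : 0 < x) :
    latticeBallCard q x = Nat.card ↑(unitDisc q ∩
      x⁻¹ • (Submodule.span ℤ (Set.range (Pi.basisFun ℝ (Fin 2))) : Set (Fin 2 → ℝ))) := by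
  rw [Nat.card_coe_set_eq, latticeBallCard]
  refine Set.ncard_congr (fun z _ => x⁻¹ • ![(z.1 : ℝ), (z.2 : ℝ)]) ?_ ?_ ?_
  · intro z hz
    refine ⟨(mem_smul_unitDisc q hx _).2 (by simpa using hz), Set.smul_mem_smul_set ?_⟩
    rw [SetLike.mem_coe, Module.Basis.mem_span_iff_repr_mem]
    intro i
    fin_cases i
    · exact ⟨z.1, by simp⟩
    · exact ⟨z.2, by simp⟩
  · intro z w _ _ h
    have h1 := smul_right_injective (Fin 2 → ℝ) (inv_ne_zero hx.ne') h
    have h2 := congrFun h1 0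
    have h3 := congrFun h1 1
    simp only [Matrix.cons_val_zero, Matrix.cons_val_one, Int.cast_inj] at h2 h3
    exact Prod.ext h2 h3
  · rintro _ ⟨h1, v, hv, rfl⟩
    rw [SetLike.mem_coe, Module.Basis.mem_span_iff_repr_mem] at hv
    obtain ⟨a, ha⟩ := hv 0
    obtain ⟨b, hb⟩ := hv 1
    simp only [Pi.basisFun_repr, algebraMap_int_eq, Int.coe_castRingHom] at ha hb
    have h2 := (mem_smul_unitDisc q hx v).1 h1
    rw [← ha, ← hb] at h2
    refine ⟨(a, b), h2, ?_⟩
    simp only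
    congr 1
    ext i
    fin_cases i
    · exact ha
    · exact hb

/-- Lattice point counting for a bounded convex set, whose boundary is null; V is the area of the
unit disc. Only positivity of V is used, so both norms are treated alike. -/
lemma tendsto_latticeBallCard_div_sq (q : PlaneNorm) : ∃ V : ℝ, 0 < V ∧
    Tendsto (fun x : ℝ => (latticeBallCard q x : ℝ) / x ^ 2) atTop (𝓝 V) := by
  refine ⟨volume.real (unitDisc q), ?_, ?_⟩
  · refine ENNReal.toReal_pos ((isOpen_unitDisc q).measure_pos volume ⟨0, ?_⟩).ne'
      (isBounded_unitDisc q).measure_lt_top.ne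
    simp [unitDisc, q.eval_zero]
  · have h := tendsto_card_div_pow_atTop_volume' (unitDisc q) (isBounded_unitDisc q)
      (isOpen_unitDisc q).measurableSet ((convex_unitDisc q).addHaar_frontier volume) ?_
    · refine h.congr' ?_
      filter_upwards [eventually_gt_atTop 0] with x hx
      rw [latticeBallCard_eq_natCard q hx, Fintype.card_fin]
    · rintro x y hx hxy _ ⟨v, hv, rfl⟩
      have hy := hx.trans_le hxy
      refine ⟨(x / y) • v, ?_, ?_⟩
      · have h1 := convex_unitDisc q (show (0 : Fin 2 → ℝ) ∈ unitDisc q by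
          simp [unitDisc, q.eval_zero]) hv (a := 1 - x / y) (b := x / y)
          (by rw [sub_nonneg, div_le_one hy]; exact hxy) (by positivity) (by ring)
        rwa [smul_zero, zero_add] at h1
      · simp only [smul_smul, mul_div_cancel₀ _ hy.ne']

lemma latticeBallCard_mono (q : PlaneNorm) {x y : ℝ} (h : x ≤ y) :
    latticeBallCard q x ≤ latticeBallCard q y :=
  Set.ncard_le_ncard (fun _ hz => lt_of_lt_of_le hz h) (finite_lattice_ball q y)

/-- Slightly smaller balls have almost the same number of lattice points. -/
lemma eventually_mul_latticeBallCard_le (q : PlaneNorm) {a θ : ℝ} (hθ : 0 < θ) (h : a < θ ^ 2) :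
    ∀ᶠ x : ℝ in atTop, a * latticeBallCard q x ≤ latticeBallCard q (θ * x) := by
  obtain ⟨V, hV, hlim⟩ := tendsto_latticeBallCard_div_sq q
  have h1 := hlim.const_mul a
  have h2 := (hlim.comp (tendsto_id.const_mul_atTop hθ)).mul_const (θ ^ 2)
  have h3 : a * V < V * θ ^ 2 := by nlinarith
  filter_upwards [h1.eventually_lt h2 h3, eventually_gt_atTop 0] with x hx hx0
  simp only [Function.comp_apply, id_eq] at hx
  have hx2 : 0 < x ^ 2 := by positivity
  have h4 : (latticeBallCard q (θ * x) : ℝ) / (θ * x) ^ 2 * θ ^ 2 =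
      (latticeBallCard q (θ * x) : ℝ) / x ^ 2 := by
    field_simp
  rw [h4, ← mul_div_assoc, div_lt_div_iff_of_pos_right hx2] at hx
  exact hx.le

/-! ### Approximation of the balls by the approximating set -/

/-- The fraction f is kept at least w so that the window of radii just below the target stays within
one level. If the fractional part of Λ is too small, the end of the previous level is used. -/
lemma exists_level {Λ w : ℝ} (hΛ : 0 ≤ Λ) (hw0 : 0 < w) (hw1 : w ≤ 1) :
    ∃ (ℓ : ℕ) (f : ℝ), w ≤ f ∧ f ≤ 1 ∧ Λ - w ≤ ℓ - 1 + f ∧ (ℓ : ℝ) - 1 + f ≤ Λ := by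
  have h1 := Nat.floor_le hΛ
  have h2 := Nat.lt_floor_add_one Λ
  rcases le_or_gt w (Λ - ⌊Λ⌋₊) with h | h
  · refine ⟨⌊Λ⌋₊ + 1, Λ - ⌊Λ⌋₊, h, by linarith, ?_, ?_⟩ <;> push_cast <;> linarith
  · exact ⟨⌊Λ⌋₊, 1, hw1, le_rfl, by linarith, by linarith⟩

variable {n ℓ : ℕ}

lemma ball_subset_ball_of_close (q : PlaneNorm) {c b : Site n} {ρ R δ : ℝ}
    (h1 : |coord b.1 - coord c.1| ≤ δ) (h2 : |coord b.2 - coord c.2| ≤ δ) (h : ρ + 2 * δ ≤ R) :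
    ball q b ρ ⊆ ball q c R := by
  intro x hx
  rw [mem_ball] at hx ⊢
  have h3 := q.eval_add_le (coord x.1 - coord b.1) (coord x.2 - coord b.2)
    (coord b.1 - coord c.1) (coord b.2 - coord c.2)
  rw [sub_add_sub_cancel, sub_add_sub_cancel] at h3
  have h4 := q.eval_le (coord b.1 - coord c.1) (coord b.2 - coord c.2)
  linarith

set_option maxHeartbeats 1000000 in
/-- The balls of a level whose radii are slightly smaller than `R` and whose centres are close
to `c`. -/
lemma exists_close_balls (q : PlaneNorm) (hn : 3 ≤ n) (hℓ : ℓ ≤ levelMax n) {R η f : ℝ}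
    (hη0 : 0 < η) (hη1 : η ≤ 1 / 2) (hfη : η ≤ f) (hf1 : f ≤ 1)
    (hlow : Real.logb 2 (((1 - η) * R) ^ 2) - η ≤ ℓ - 1 + f)
    (hup : (ℓ : ℝ) - 1 + f ≤ Real.logb 2 (((1 - η) * R) ^ 2))
    (hL : 4 / η ≤ levelRate n ℓ) (hR : 4 / η ≤ R) {c : Site n} (hc : InGrid R c) :
    ∃ B ⊆ approxSet n ℓ, B.Nonempty ∧
      η ^ 3 / 32 * (2 ^ ℓ * (approxSet n ℓ).card / (n : ℝ) ^ 2) ≤ B.card ∧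
      ∀ b ∈ B, InGrid (radius n ℓ b.1) b.2 ∧ (1 - η) * 2 ^ (-η) * R ≤ radius n ℓ b.1 ∧
        ball q b.2 (radius n ℓ b.1) ⊆ ball q c R := by
  have hn0 : (0 : ℝ) < n := by exact_mod_cast (by omega : 0 < n)
  set L := levelRate n ℓ with hLdef
  set d := spacing n ℓ with hd
  have hd0 : (0 : ℝ) < d := by exact_mod_cast spacing_pos hn hℓ
  have h8 : 8 ≤ 4 / η := by rw [le_div_iff₀ hη0]; linarith
  have hR0 : 0 < R := by linarith
  have hL0 : 0 < L := by linarith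
  have hηL : 4 ≤ η * L := by rw [div_le_iff₀ hη0] at hL; linarith
  have hηR : 4 ≤ η * R := by rw [div_le_iff₀ hη0] at hR; linarith
  have hR1 : 0 < (1 - η) * R := mul_pos (by linarith) hR0
  set Λ := Real.logb 2 (((1 - η) * R) ^ 2) with hΛ
  have h2Λ : (2 : ℝ) ^ Λ = ((1 - η) * R) ^ 2 :=
    Real.rpow_logb two_pos (by norm_num) (by positivity)
  -- the size of the level
  have h2ℓ : (2 : ℝ) ^ ℓ ≤ 2 * R ^ 2 := by
    have h1 : (2 : ℝ) ^ ((ℓ : ℝ) - 1) ≤ 2 ^ Λ :=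
      Real.rpow_le_rpow_of_exponent_le one_le_two (by linarith)
    rw [two_rpow_sub_one, h2Λ] at h1
    have h2 : ((1 - η) * R) ^ 2 ≤ R ^ 2 := by
      refine pow_le_pow_left₀ hR1.le ?_ 2
      nlinarith
    linarith
  -- The level rate is at least 4/η, so the spacing is fine compared with the allowed displacement
  -- of the centre.
  have hdR : (d : ℝ) ≤ η * R / 2 := by
    have h1 : maxRadius ℓ ≤ √2 * R := by
      rw [maxRadius, ← Real.sqrt_sq hR0.le, ← Real.sqrt_mul zero_le_two]
      exact Real.sqrt_le_sqrt h2ℓ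
    have h2 : maxRadius ℓ / (√2 * L) ≤ R / L := by
      rw [div_le_div_iff₀ (by positivity) hL0]
      nlinarith
    have h3 : R / L ≤ η * R / 4 := by
      rw [div_le_div_iff₀ hL0 (by norm_num)]; nlinarith
    have h4 := spacing_lt (n := n) (ℓ := ℓ)
    linarith
  -- radii and centres
  set J := Finset.Icc ⌈(f - η) * L⌉₊ ⌊f * L⌋₊ with hJ
  have hJcard : η / 4 * radiiCount n ℓ ≤ J.card := by
    have h1 := Nat.lt_floor_add_one (f * L)
    have h2 := Nat.ceil_lt_add_one (mul_nonneg (sub_nonneg.2 hfη) hL0.le)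
    have h3 : (⌊f * L⌋₊ : ℝ) + 1 ≤ J.card + (⌈(f - η) * L⌉₊ : ℝ) := by
      rw [hJ, Nat.card_Icc]
      exact_mod_cast (by omega : ⌊f * L⌋₊ + 1 ≤ ⌊f * L⌋₊ + 1 - ⌈(f - η) * L⌉₊ + ⌈(f - η) * L⌉₊)
    have h4 := radiiCount_le hn hℓ
    nlinarith
  have hJr : ∀ i ∈ J, i < radiiCount n ℓ ∧ (1 - η) * 2 ^ (-η) * R ≤ radius n ℓ i ∧
      radius n ℓ i ≤ (1 - η) * R := by
    intro i hi
    rw [hJ, Finset.mem_Icc, Nat.ceil_le, Nat.le_floor_iff (by nlinarith)] at hi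
    have h0 : i * precision n ℓ = i / L := by rw [precision_eq]; ring
    have h1 : (i : ℝ) / L ≤ f := by rw [div_le_iff₀ hL0]; exact hi.2
    have h2 : f - η ≤ (i : ℝ) / L := by rw [le_div_iff₀ hL0]; exact hi.1
    refine ⟨?_, ?_, ?_⟩
    · rw [radiiCount, Nat.lt_add_one_iff, Nat.le_floor_iff hL0.le]
      exact hi.2.trans (by nlinarith)
    · refine Real.le_sqrt_of_sq_le ?_
      have h3 : ((1 - η) * 2 ^ (-η) * R) ^ 2 = 2 ^ (Λ + (-η) * 2) := by
        rw [Real.rpow_add two_pos, h2Λ, Real.rpow_mul zero_le_two (-η) 2, Real.rpow_two]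
        ring
      rw [h3, h0]
      exact Real.rpow_le_rpow_of_exponent_le one_le_two (by linarith)
    · rw [radius, h0]
      refine Real.sqrt_le_iff.2 ⟨hR1.le, ?_⟩
      rw [← h2Λ]
      exact Real.rpow_le_rpow_of_exponent_le one_le_two (by linarith)
  -- A displacement of ηR/2 in each coordinate moves the centre by at most ηR in either norm; the
  -- radii are at most (1 - η)R to leave this room.
  let M : ℝ → Finset (Fin n) := fun a => multiplesIn n d (a - η * R / 2) (a + η * R / 2)
  have hMcard : ∀ j : Fin n, coord j ∈ Set.Icc R (n - R + 1) →
      η * R / (2 * d) ≤ (M (coord j)).card := by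
    intro j hj
    refine le_trans ?_ (le_card_multiplesIn (spacing_pos hn hℓ) (by nlinarith [hj.1])
      (by nlinarith [hj.2]))
    rw [add_sub_sub_cancel, add_halves, le_sub_iff_add_le, ← hd, div_add_one (by positivity),
      div_le_div_iff₀ (by positivity) hd0]
    nlinarith
  set B : Finset (ℕ × Site n) := J ×ˢ M (coord c.1) ×ˢ M (coord c.2) with hB
  have hmem : ∀ b ∈ B, b.1 ∈ J ∧ b.2.1 ∈ M (coord c.1) ∧ b.2.2 ∈ M (coord c.2) := fun b hb => by
    simpa [hB, Finset.mem_product] using hb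
  have hclose : ∀ b ∈ B, |coord b.2.1 - coord c.1| ≤ η * R / 2 ∧
      |coord b.2.2 - coord c.2| ≤ η * R / 2 := by
    intro b hb
    obtain ⟨_, h2, h3⟩ := hmem b hb
    rw [mem_multiplesIn] at h2 h3
    exact ⟨abs_le.2 ⟨by linarith [h2.2.1], by linarith [h2.2.2]⟩,
      abs_le.2 ⟨by linarith [h3.2.1], by linarith [h3.2.2]⟩⟩
  have hgrid : ∀ b ∈ B, InGrid (radius n ℓ b.1) b.2 := by
    intro b hb
    obtain ⟨h1, _, _⟩ := hmem b hb
    obtain ⟨h2, h3⟩ := hclose b hb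
    have h4 := (hJr b.1 h1).2.2
    rw [abs_le] at h2 h3
    obtain ⟨hc1, hc2⟩ := hc
    rw [Set.mem_Icc] at hc1 hc2
    have h5 : 0 ≤ η * R := by positivity
    exact ⟨⟨by linarith [hc1.1], by linarith [hc1.2]⟩, ⟨by linarith [hc2.1], by linarith [hc2.2]⟩⟩
  have hcard : (η / 4 * radiiCount n ℓ) * ((η * R / (2 * d)) * (η * R / (2 * d))) ≤ B.card := by
    rw [hB, Finset.card_product, Finset.card_product]
    push_cast
    have h1 := hMcard c.1 hc.1
    have h2 := hMcard c.2 hc.2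
    gcongr
  have hr0 : (0 : ℝ) < radiiCount n ℓ := by exact_mod_cast one_le_radiiCount
  refine ⟨B, ?_, ?_, ?_, ?_⟩
  · intro b hb
    obtain ⟨h1, h2, h3⟩ := hmem b hb
    rw [mem_multiplesIn] at h2 h3
    exact mem_approxSet.2 ⟨(hJr b.1 h1).1, h2.1, h3.1, hgrid b hb⟩
  · rw [← Finset.card_pos]
    have : (0 : ℝ) < B.card := lt_of_lt_of_le (by positivity) hcard
    exact_mod_cast this
  · refine le_trans ?_ hcard
    have h1 : (2 : ℝ) ^ ℓ * (approxSet n ℓ).card / (n : ℝ) ^ 2 ≤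
        2 * R ^ 2 * (radiiCount n ℓ / (d : ℝ) ^ 2) := by
      rw [div_le_iff₀ (by positivity)]
      have h2 := mul_le_mul h2ℓ (card_approxSet_le hn hℓ) (Nat.cast_nonneg _) (by positivity)
      refine h2.trans_eq ?_
      rw [← hd, div_pow]
      ring
    refine (mul_le_mul_of_nonneg_left h1 (by positivity)).trans_eq ?_
    rw [div_mul_div_comm]
    field_simp
    norm_num
  · intro b hb
    obtain ⟨h1, _, _⟩ := hmem b hb
    obtain ⟨h2, h3⟩ := hclose b hb
    refine ⟨hgrid b hb, (hJr b.1 h1).2.1, ball_subset_ball_of_close q h2 h3 ?_⟩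
    linarith [(hJr b.1 h1).2.2]

/-! ### Approximants of the clusters -/

/-- The standardized mean `√(2 r log n²)`. -/
def calibratedMean (r : ℝ) (n : ℕ) : ℝ := √(2 * Real.log ((n : ℝ) ^ 2)) * √r

lemma calibratedMean_le {α r r' : ℝ} {n : ℕ} (hn : 0 < n) (hr' : 0 ≤ r') (hr : 0 < r) {b : ℝ}
    (h : r' / r * (n : ℝ) ^ (2 * α) ≤ b) : calibratedMean r' n ≤ signalMean α r n * √b := by
  have hp : 0 < (n : ℝ) ^ (2 * α) := Real.rpow_pos_of_pos (by exact_mod_cast hn) _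
  have hb : 0 ≤ b := le_trans (by positivity) h
  rw [signalMean_mul_sqrt hr.le, calibratedMean, ← Real.sqrt_mul hr.le]
  refine mul_le_mul_of_nonneg_left (Real.sqrt_le_sqrt ?_) (Real.sqrt_nonneg _)
  rw [← le_div_iff₀ hp] at h
  calc r' = r * (r' / r) := by field_simp
    _ ≤ _ := by gcongr

lemma maxRadius_eq_one : maxRadius 0 = 1 := by simp [maxRadius]

lemma le_levelMax {n ℓ : ℕ} (h : (8 : ℝ) * 2 ^ ℓ ≤ n ^ 2) : ℓ ≤ levelMax n := by
  have h0 : (0 : ℝ) < 2 ^ ℓ := by positivity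
  have h1 : (ℓ : ℝ) ≤ Real.logb 2 ((n : ℝ) ^ 2 / 8) := by
    rw [Real.le_logb_iff_rpow_le one_lt_two (by linarith), Real.rpow_natCast]
    linarith
  exact Nat.cast_le.1 (h1.trans (Nat.le_ceil _))

lemma levelRate_ge {n ℓ : ℕ} {c : ℝ} (hn : 3 ≤ n) (hℓ : ℓ ≤ levelMax n)
    (h : (2 : ℝ) ^ (c ^ 2) * 2 ^ ℓ ≤ 2 * n ^ 2) : c ≤ levelRate n ℓ := by
  refine le_of_sq_le_sq ?_ levelRate_nonneg
  have hn0 : (0 : ℝ) < n := by exact_mod_cast (by omega : 0 < n)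
  rw [levelRate_sq hn hℓ, Real.le_logb_iff_rpow_le one_lt_two (by positivity),
    le_div_iff₀ (by positivity)]
  exact h

namespace SparseClusterModel

variable {q : PlaneNorm} {α β : ℝ} {m : ℕ → ℕ} {R : ℕ → ℝ}

lemma eventually_mul_rpow_le (h : SparseClusterModel q α β m R) (c : ℝ) :
    ∀ᶠ n : ℕ in atTop, c * (n : ℝ) ^ (2 * α) ≤ (n : ℝ) ^ 2 := by
  have h1 := (tendsto_exp_mul_log_sq (e := fun _ => α - 1) tendsto_const_nhds
    (by linarith [h.alpha_lt_one])).const_mul c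
  rw [mul_zero] at h1
  filter_upwards [h1.eventually (gt_mem_nhds one_pos), eventually_gt_atTop 0] with n hn hn0
  have hn0' : (0 : ℝ) < n := by exact_mod_cast hn0
  rw [sub_mul, one_mul, Real.exp_sub, Real.exp_log (by positivity), ← rpow_two_mul_eq_exp hn0,
    ← mul_div_assoc, div_lt_one (by positivity)] at hn
  exact hn.le

lemma tendsto_latticeBallCard (h : SparseClusterModel q α β m R) (hα : 0 < α) :
    Tendsto (fun n => (latticeBallCard q (R n) : ℝ)) atTop atTop := by
  have h1 : Tendsto (fun n : ℕ => (n : ℝ) ^ (2 * α)) atTop atTop :=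
    (tendsto_rpow_atTop (by linarith)).comp tendsto_natCast_atTop_atTop
  refine (h.size.pos_mul_atTop one_pos h1).congr' ?_
  filter_upwards [eventually_gt_atTop 0] with n hn
  have : (0 : ℝ) < (n : ℝ) ^ (2 * α) := Real.rpow_pos_of_pos (by exact_mod_cast hn) _
  exact div_mul_cancel₀ _ this.ne'

lemma tendsto_radius (h : SparseClusterModel q α β m R) (hα : 0 < α) :
    Tendsto R atTop atTop := by
  rw [tendsto_atTop]
  intro x
  filter_upwards [(h.tendsto_latticeBallCard hα).eventually_gt_atTop (latticeBallCard q x : ℝ)]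
    with n hn
  by_contra hx
  have := latticeBallCard_mono q (not_le.1 hx).le
  exact absurd hn (not_lt.2 (by exact_mod_cast this))

/-- Clusters that are single points. -/
lemma exists_approximants_of_eq_zero (h : SparseClusterModel q 0 β m R) {r r' : ℝ} (hr' : 0 < r')
    (hr : r' < r) : ∃ κ C : ℝ, 0 < κ ∧ 0 < C ∧ ∀ᶠ n : ℕ in atTop, ∃ ℓ ≤ levelMax n,
      (2 : ℝ) ^ ℓ ≤ C * (n : ℝ) ^ (2 * (0 : ℝ)) ∧ (n : ℝ) ^ (2 * (0 : ℝ)) ≤ C * 2 ^ ℓ ∧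
      ∀ c ∈ centers n (R n), ∃ B : Finset (ℕ × Site n),
        IsApproximant q ℓ (R n) (signalMean 0 r n) (calibratedMean r' n) c B ∧ B.Nonempty ∧
        κ * (2 ^ ℓ * (approxSet n ℓ).card / (n : ℝ) ^ 2) ≤ B.card := by
  have hr0 : 0 < r := hr'.trans hr
  have hsize := h.size.eventually (Ioo_mem_nhds (by norm_num : (1 / 2 : ℝ) < 1)
    (by norm_num : (1 : ℝ) < 2))
  refine ⟨1, 1, one_pos, one_pos, ?_⟩
  filter_upwards [hsize, h.card_bounds] with n hs ⟨hn, _, _, _, _, _, hR, _⟩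
  have hn3 : 3 ≤ n := by omega
  have hn0 : (0 : ℝ) < n := by exact_mod_cast (by omega : 0 < n)
  have hn4 : (4 : ℝ) ≤ n := by exact_mod_cast hn
  have hℓ : 0 ≤ levelMax n := Nat.zero_le _
  -- At level 0 all radii are at most 1 and the spacing is 1, so every open ball of the level is a
  -- single point and every point occurs once for each radius.
  refine ⟨0, hℓ, by simp, by simp, fun c hc => ?_⟩
  have hd : spacing n 0 = 1 := by
    have h1 := one_le_levelRate hn3 hℓ
    have h2 := spacing_pos hn3 hℓ
    rw [spacing_eq, maxRadius_eq_one] at h2 ⊢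
    refine le_antisymm (Nat.ceil_le.2 ?_) h2
    have h3 : (1 : ℝ) ≤ √2 := Real.one_le_sqrt.2 one_le_two
    rw [Nat.cast_one, div_le_one (by positivity)]
    nlinarith
  have hrad : ∀ i < radiiCount n 0, radius n 0 i ≤ 1 := fun i hi => by
    have := radius_le_maxRadius hn3 hℓ hi
    rwa [maxRadius_eq_one] at this
  have hball : ∀ i < radiiCount n 0, ball q c (radius n 0 i) = {c} := by
    intro i hi
    ext x
    rw [mem_ball, Finset.mem_singleton]
    constructor
    · intro hx
      have key : ∀ j k : Fin n, |coord j - coord k| < 1 → j = k := by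
        intro j k hjk
        simp only [coord, add_sub_add_right_eq_sub] at hjk
        have h1 : |((j : ℕ) : ℤ) - ((k : ℕ) : ℤ)| < 1 := by exact_mod_cast hjk
        rw [Int.abs_lt_one_iff] at h1
        exact Fin.ext (by omega)
      have h1 := hx.trans_le (hrad i hi)
      exact Prod.ext (key _ _ ((q.abs_fst_le _ _).trans_lt h1))
        (key _ _ ((q.abs_snd_le _ _).trans_lt h1))
    · rintro rfl
      simpa [q.eval_zero] using radius_pos i
  have hgrid : ∀ i < radiiCount n 0, InGrid (radius n 0 i) c := by
    intro i hi
    have h1 := hrad i hi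
    have key : ∀ j : Fin n, coord j ∈ Set.Icc (radius n 0 i) (n - radius n 0 i + 1) := by
      intro j
      have h2 : ((j : ℕ) : ℝ) + 1 ≤ n := by exact_mod_cast j.2
      have h3 : (0 : ℝ) ≤ ((j : ℕ) : ℝ) := Nat.cast_nonneg _
      simp only [coord, Set.mem_Icc]
      constructor <;> linarith
    exact ⟨key _, key _⟩
  refine ⟨(Finset.range (radiiCount n 0)).image fun i => (i, c), ⟨?_, ?_, ?_⟩, ?_, ?_⟩
  · intro b hb
    obtain ⟨i, hi, rfl⟩ := Finset.mem_image.1 hb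
    rw [Finset.mem_range] at hi
    rw [mem_approxSet, hd]
    exact ⟨hi, one_dvd _, one_dvd _, hgrid i hi⟩
  · intro b hb
    obtain ⟨i, hi, rfl⟩ := Finset.mem_image.1 hb
    rw [Finset.mem_range] at hi
    rw [hball i hi, Finset.singleton_subset_iff, mem_ball]
    simpa [q.eval_zero] using hR
  · intro b hb
    obtain ⟨i, hi, rfl⟩ := Finset.mem_image.1 hb
    rw [Finset.mem_range] at hi
    rw [hball i hi, Finset.card_singleton]
    refine calibratedMean_le (by omega) hr'.le hr0 ?_
    rw [mul_zero, Real.rpow_zero, mul_one, Nat.cast_one]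
    exact ((div_lt_one hr0).2 hr).le
  · have h1 := one_le_radiiCount (n := n) (ℓ := 0)
    exact (Finset.nonempty_range_iff.2 (by omega)).image _
  · rw [Finset.card_image_of_injective _ fun i j hij => (Prod.ext_iff.1 hij).1, Finset.card_range,
      one_mul, pow_zero, one_mul, div_le_iff₀ (by positivity)]
    have h1 := card_approxSet_le hn3 hℓ
    rwa [hd, Nat.cast_one, div_one] at h1

/-- Clusters whose radii tend to infinity. -/
lemma exists_approximants_of_pos (h : SparseClusterModel q α β m R) (hα : 0 < α) {r r' : ℝ}
    (hr' : 0 < r') (hr : r' < r) : ∃ κ C : ℝ, 0 < κ ∧ 0 < C ∧ ∀ᶠ n : ℕ in atTop, ∃ ℓ ≤ levelMax n,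
      (2 : ℝ) ^ ℓ ≤ C * (n : ℝ) ^ (2 * α) ∧ (n : ℝ) ^ (2 * α) ≤ C * 2 ^ ℓ ∧
      ∀ c ∈ centers n (R n), ∃ B : Finset (ℕ × Site n),
        IsApproximant q ℓ (R n) (signalMean α r n) (calibratedMean r' n) c B ∧ B.Nonempty ∧
        κ * (2 ^ ℓ * (approxSet n ℓ).card / (n : ℝ) ^ 2) ≤ B.card := by
  have hr0 : 0 < r := hr'.trans hr
  obtain ⟨V, hV, hVlim⟩ := tendsto_latticeBallCard_div_sq q
  have hrr : r' / r < 1 := (div_lt_one hr0).2 hr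
  -- The loss r'/r is split in two: the factor a pays for the smaller balls, and r'/(ra) < 1 for the
  -- rounding of the cluster size.
  obtain ⟨a, ha1, ha2⟩ := exists_between hrr
  have ha0 : 0 < a := (div_pos hr' hr0).trans ha1
  obtain ⟨η, hη0, hη1, hηa⟩ : ∃ η : ℝ, 0 < η ∧ η ≤ 1 / 2 ∧ a < ((1 - η) * 2 ^ (-η)) ^ 2 := by
    have h1 : Tendsto (fun η : ℝ => ((1 - η) * (2 : ℝ) ^ (-η)) ^ 2) (𝓝[>] 0) (𝓝 1) := by
      have h2 : Continuous fun η : ℝ => ((1 - η) * (2 : ℝ) ^ (-η)) ^ 2 := by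
        have : Continuous fun η : ℝ => (2 : ℝ) ^ (-η) :=
          (Real.continuous_const_rpow two_ne_zero).comp continuous_neg
        fun_prop
      have h3 := (h2.tendsto 0).mono_left (nhdsWithin_le_nhds (s := Set.Ioi 0))
      simpa using h3
    have h2 : ∀ᶠ η : ℝ in 𝓝[>] 0, η ≤ 1 / 2 :=
      nhdsWithin_le_nhds (ge_mem_nhds (by norm_num))
    obtain ⟨η, h3, h4, h5⟩ := ((h1.eventually (lt_mem_nhds ha2)).and
      (h2.and self_mem_nhdsWithin)).exists
    exact ⟨η, h5, h4, h3⟩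
  have hθ : 0 < (1 - η) * (2 : ℝ) ^ (-η) := mul_pos (by linarith) (by positivity)
  have hRt := h.tendsto_radius hα
  have hcount := hRt.eventually (eventually_mul_latticeBallCard_le q hθ hηa)
  have hVb := (hVlim.comp hRt).eventually (ge_mem_nhds (lt_add_one V))
  have hsize := h.size.eventually (lt_mem_nhds ((div_lt_one ha0).2 ha1))
  -- With b points in a cluster: 2^ℓ ≤ 2R² ≤ 8b ≤ 16 n^(2α), and n^(2α) ≤ 2b ≤ 2(V + 1)R² ≤ 16(V +
  -- 1)2^ℓ.
  refine ⟨η ^ 3 / 32, 16 * (V + 1) + 16, by positivity, by positivity, ?_⟩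
  filter_upwards [hcount, hVb, hsize, hRt.eventually_ge_atTop (4 / η), h.card_bounds,
    h.eventually_mul_rpow_le 128, h.eventually_mul_rpow_le (8 * 2 ^ ((4 / η) ^ 2))]
    with n hcount hVb hsize hRη ⟨hn, _, _, _, hb2, hb3, hR, hRn⟩ hn128 hnc
  have hn3 : 3 ≤ n := by omega
  have hn0 : (0 : ℝ) < n := by exact_mod_cast (by omega : 0 < n)
  have hp : 0 < (n : ℝ) ^ (2 * α) := Real.rpow_pos_of_pos hn0 _
  have hR2 := radius_sq_le_latticeBallCard q hR
  simp only [Function.comp_apply] at hVb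
  rw [div_le_iff₀ (by positivity)] at hVb
  rw [lt_div_iff₀ hp] at hsize
  have h8 : 8 ≤ 4 / η := by rw [le_div_iff₀ hη0]; linarith
  have hR1 : 1 ≤ (1 - η) * R n := by nlinarith
  have hΛ : 0 ≤ Real.logb 2 (((1 - η) * R n) ^ 2) :=
    Real.logb_nonneg one_lt_two (one_le_pow₀ hR1)
  obtain ⟨ℓ, f, hf1, hf2, hlow, hup⟩ := exists_level hΛ hη0 (by linarith)
  have h2Λ : (2 : ℝ) ^ Real.logb 2 (((1 - η) * R n) ^ 2) = ((1 - η) * R n) ^ 2 :=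
    Real.rpow_logb two_pos (by norm_num) (by positivity)
  have hup2 : (2 : ℝ) ^ ℓ ≤ 2 * R n ^ 2 := by
    have h1 := Real.rpow_le_rpow_of_exponent_le one_le_two
      (by linarith : (ℓ : ℝ) - 1 ≤ Real.logb 2 (((1 - η) * R n) ^ 2))
    rw [two_rpow_sub_one, h2Λ] at h1
    have h2 : ((1 - η) * R n) ^ 2 ≤ R n ^ 2 :=
      pow_le_pow_left₀ (by linarith) (by nlinarith) 2
    linarith
  have hlow2 : R n ^ 2 ≤ 8 * 2 ^ ℓ := by
    have h1 := Real.rpow_le_rpow_of_exponent_le one_le_two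
      (by linarith : Real.logb 2 (((1 - η) * R n) ^ 2) - 1 ≤ (ℓ : ℝ))
    rw [Real.rpow_sub two_pos, h2Λ, Real.rpow_one, Real.rpow_natCast] at h1
    have h2 : (1 / 2 * R n) ^ 2 ≤ ((1 - η) * R n) ^ 2 :=
      pow_le_pow_left₀ (by positivity) (by nlinarith) 2
    linarith
  have h2ℓ : (2 : ℝ) ^ ℓ ≤ 16 * (n : ℝ) ^ (2 * α) := by linarith
  have hℓ : ℓ ≤ levelMax n := le_levelMax (by linarith)
  have hL : 4 / η ≤ levelRate n ℓ := by
    refine levelRate_ge hn3 hℓ ?_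
    have h1 : (2 : ℝ) ^ ((4 / η) ^ 2) * 2 ^ ℓ ≤
        2 ^ ((4 / η) ^ 2) * (16 * (n : ℝ) ^ (2 * α)) := by gcongr
    linarith
  refine ⟨ℓ, hℓ, ?_, ?_, fun c hc => ?_⟩
  · refine h2ℓ.trans ?_
    gcongr
    linarith
  · have h1 : (V + 1) * R n ^ 2 ≤ (V + 1) * (8 * 2 ^ ℓ) := by gcongr
    have h2 : (0 : ℝ) < 2 ^ ℓ := by positivity
    linarith
  · obtain ⟨B, hB1, hB2, hB3, hB4⟩ := exists_close_balls q hn3 hℓ hη0 hη1 hf1 hf2 hlow hup hL hRη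
      (mem_centers.1 hc)
    refine ⟨B, ⟨hB1, fun b hb => (hB4 b hb).2.2, fun b hb => ?_⟩, hB2, hB3⟩
    obtain ⟨h1, h2, -⟩ := hB4 b hb
    refine calibratedMean_le (by omega) hr'.le hr0 ?_
    rw [card_ball q h1]
    have h3 : (latticeBallCard q ((1 - η) * 2 ^ (-η) * R n) : ℝ) ≤
        latticeBallCard q (radius n ℓ b.1) := by
      exact_mod_cast latticeBallCard_mono q h2
    have h4 : r' / r = a * (r' / r / a) := by field_simp
    have h5 := mul_le_mul_of_nonneg_left hsize.le ha0.le
    rw [h4, mul_assoc]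
    linarith

/-- The approximating set has sufficiently many elements that approximate the clusters. -/
lemma exists_approximants (h : SparseClusterModel q α β m R) {r r' : ℝ} (hr' : 0 < r')
    (hr : r' < r) : ∃ κ C : ℝ, 0 < κ ∧ 0 < C ∧ ∀ᶠ n : ℕ in atTop, ∃ ℓ ≤ levelMax n,
      (2 : ℝ) ^ ℓ ≤ C * (n : ℝ) ^ (2 * α) ∧ (n : ℝ) ^ (2 * α) ≤ C * 2 ^ ℓ ∧
      ∀ c ∈ centers n (R n), ∃ B : Finset (ℕ × Site n),
        IsApproximant q ℓ (R n) (signalMean α r n) (calibratedMean r' n) c B ∧ B.Nonempty ∧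
        κ * (2 ^ ℓ * (approxSet n ℓ).card / (n : ℝ) ^ 2) ≤ B.card := by
  rcases h.alpha_nonneg.eq_or_lt with hα | hα
  · subst hα
    exact h.exists_approximants_of_eq_zero hr' hr
  · exact h.exists_approximants_of_pos hα hr' hr

end SparseClusterModel

/-! ### Above the detection boundary -/

lemma detectionBoundary_nonneg {α β : ℝ} (hAB : 2 * (1 - α - β) < 1 - α) :
    0 ≤ detectionBoundary α β := by
  unfold detectionBoundary
  split_ifs
  · linarith
  · positivity

/-- The exponent `s` of the level of the p-values at which the clusters are detected. -/
lemma exists_exponents {α β r : ℝ} (hA : 0 < 1 - α) (hB : 0 < 1 - α - β)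
    (hr0 : 0 < r) (hr : detectionBoundary α β < r) :
    ∃ s δ : ℝ, 0 ≤ δ ∧ √s - √r ≤ δ ∧ δ ^ 2 < s ∧ δ ^ 2 < 1 - α - β ∧
      1 - α - s < 2 * (1 - α - β - δ ^ 2) := by
  set A := 1 - α with hAdef
  set B := A - β with hBdef
  have hβ : β = A - B := by ring
  obtain ⟨x, hx, rfl⟩ : ∃ x : ℝ, 0 < x ∧ r = x ^ 2 :=
    ⟨√r, Real.sqrt_pos.2 hr0, (Real.sq_sqrt hr0.le).symm⟩
  obtain ⟨a, ha, hae⟩ : ∃ a : ℝ, 0 < a ∧ A = a ^ 2 :=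
    ⟨√A, Real.sqrt_pos.2 hA, (Real.sq_sqrt hA.le).symm⟩
  obtain ⟨b, hb, hbe⟩ : ∃ b : ℝ, 0 < b ∧ B = b ^ 2 :=
    ⟨√B, Real.sqrt_pos.2 hB, (Real.sq_sqrt hB.le).symm⟩
  change (if β / A < 3 / 4 then β - A / 2 else (√A - √B) ^ 2) < x ^ 2 at hr
  rw [hβ, hae, hbe, Real.sqrt_sq ha.le, Real.sqrt_sq hb.le] at hr
  rw [hae, hbe, Real.sqrt_sq hx.le]
  have ha2 : 0 < a ^ 2 := by positivity
  simp only [div_lt_iff₀ ha2] at hr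
  -- In the moderately sparse regime with 4r ≤ A the best threshold is s = 4r, with δ = √r.
  -- Otherwise s = A, the level of the largest noise scans, and δ is the positive part of √A - √r.
  by_cases hcase : a ^ 2 - b ^ 2 < 3 / 4 * a ^ 2 ∧ 4 * x ^ 2 ≤ a ^ 2
  · rw [if_pos hcase.1] at hr
    have h2 := hcase.2
    have h1 := hcase.1
    refine ⟨(2 * x) ^ 2, x, hx.le, ?_, by nlinarith, by linarith, by nlinarith⟩
    rw [Real.sqrt_sq (by linarith)]
    linarith
  · have hab : a - x < b := by
      split_ifs at hr with h1
      · have h2 : a < 2 * x := by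
          refine lt_of_pow_lt_pow_left₀ 2 (by linarith) ?_
          have := not_and.1 hcase h1
          nlinarith
        have h3 : a < 2 * b := lt_of_pow_lt_pow_left₀ 2 (by linarith) (by nlinarith)
        linarith
      · have h2 : 2 * b ≤ a := by
          refine le_of_sq_le_sq ?_ ha.le
          nlinarith
        have h3 : a - b < x := lt_of_pow_lt_pow_left₀ 2 hx.le hr
        linarith
    have h0 := le_max_right (a - x) 0
    have hδb : max (a - x) 0 < b := max_lt hab hb
    have hδa : max (a - x) 0 < a := max_lt (by linarith) ha
    refine ⟨a ^ 2, max (a - x) 0, h0, ?_, ?_, ?_, ?_⟩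
    · rw [Real.sqrt_sq ha.le]; exact le_max_left _ _
    · nlinarith
    · nlinarith
    · nlinarith

lemma tendsto_pow_mul_exp_log {s b : ℝ} (hb : 0 < b) :
    Tendsto (fun n : ℕ => Real.log n ^ s * Real.exp (-b * Real.log n)) atTop (𝓝 0) :=
  (tendsto_rpow_mul_exp_neg_mul_atTop_nhds_zero s b hb).comp tendsto_log_natCast

lemma log_sq_eq (n : ℕ) : Real.log ((n : ℝ) ^ 2) = 2 * Real.log n := by
  rw [Real.log_pow]; push_cast; ring

/-- The level contains many balls. -/
lemma sq_le_mul_card_approxSet {n ℓ : ℕ} (hn : 3 ≤ n) (hℓ : ℓ ≤ levelMax n)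
    (h : 0 < (approxSet n ℓ).card) :
    (n : ℝ) ^ 2 ≤ 110592 * (2 ^ ℓ * (approxSet n ℓ).card) := by
  have h1 := classCount_mul_le hn hℓ h
  have h2 : 1 ≤ classCount n ℓ :=
    Nat.mul_pos one_le_radiiCount (pow_pos (separation_pos hn hℓ) 2)
  have h3 : (1 : ℝ) ≤ classCount n ℓ := by exact_mod_cast h2
  have h4 : 0 ≤ (n : ℝ) ^ 2 := sq_nonneg _
  nlinarith

namespace SparseClusterModel

variable {q : PlaneNorm} {α β : ℝ} {m : ℕ → ℕ} {R : ℕ → ℝ}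

/-- The power tends to one if the errors for fixed locations tend to zero uniformly. -/
lemma tendsto_power (h : SparseClusterModel q α β m R) {r : ℝ} {ε : ℕ → ℝ}
    (hε : Tendsto ε atTop (𝓝 0))
    (hb : ∀ᶠ n : ℕ in atTop, ∀ c ∈ configs q n (m n) (R n),
      (obsLaw (signal q (R n) (signalMean α r n) c)).real
        {X | ¬(Real.log n ^ 3 < sHC q n X ∧ √(Real.log n) < sBJ q n X)} ≤ ε n) :
    Tendsto (fun n => (altLaw q n (m n) (R n) (signalMean α r n)).real
      {X | Real.log n ^ 3 < sHC q n X}) atTop (𝓝 1) ∧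
    Tendsto (fun n => (altLaw q n (m n) (R n) (signalMean α r n)).real
      {X | √(Real.log n) < sBJ q n X}) atTop (𝓝 1) := by
  have key : ∀ S : ∀ n, Set (Site n → ℝ),
      (∀ n : ℕ, {X | Real.log n ^ 3 < sHC q n X ∧ √(Real.log n) < sBJ q n X} ⊆ S n) →
      Tendsto (fun n => (altLaw q n (m n) (R n) (signalMean α r n)).real (S n)) atTop (𝓝 1) := by
    intro S hS
    have h1 : Tendsto (fun n => 1 - ε n) atTop (𝓝 1) := by
      simpa using hε.const_sub 1
    have h2 : ∀ᶠ n in atTop, 1 - ε n ≤ (altLaw q n (m n) (R n) (signalMean α r n)).real (S n) ∧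
        (altLaw q n (m n) (R n) (signalMean α r n)).real (S n) ≤ 1 := by
      filter_upwards [h.configs_nonempty, hb] with n hC hb
      refine altLaw_compl_le hC fun c hc => ?_
      refine (measureReal_mono ?_ (measure_ne_top _ _)).trans (hb c hc)
      intro X hX hcon
      exact hX (hS n hcon)
    exact tendsto_of_tendsto_of_tendsto_of_le_of_le' h1 tendsto_const_nhds
      (h2.mono fun n hn => hn.1) (h2.mono fun n hn => hn.2)
  exact ⟨key _ fun n X hX => hX.1, key _ fun n X hX => hX.2⟩

/-- The power above the boundary if the number of clusters tends to infinity. -/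
lemma tendsto_power_of_many (h : SparseClusterModel q α β m R) (hB : 0 < 1 - α - β) {r r' : ℝ}
    (hr' : 0 < r') (hbd : detectionBoundary α β < r') (hr : r' < r) :
    Tendsto (fun n => (altLaw q n (m n) (R n) (signalMean α r n)).real
      {X | Real.log n ^ 3 < sHC q n X}) atTop (𝓝 1) ∧
    Tendsto (fun n => (altLaw q n (m n) (R n) (signalMean α r n)).real
      {X | √(Real.log n) < sBJ q n X}) atTop (𝓝 1) := by
  obtain ⟨hA, _, hAB⟩ := h.exponents
  obtain ⟨κ, C, hκ, hC, happ⟩ := h.exists_approximants hr' hr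
  obtain ⟨s, δ, hδ0, hδ, hδs, hδB, hs⟩ := exists_exponents hA hB hr' hbd
  set A := 1 - α with hAdef
  set B := A - β with hBdef
  have hs0 : 0 < s := lt_of_le_of_lt (sq_nonneg δ) hδs
  -- The margins of the exponents: Q will be exp(-σL) = n^(-2σ), each of its two terms contributing
  -- at most half.
  obtain ⟨σ, hσ0, hσ1, hσ2⟩ : ∃ σ : ℝ, 0 < σ ∧ σ < B - δ ^ 2 ∧
      σ < 2 * (B - δ ^ 2) - (A - s) := by
    obtain ⟨σ, h1, h2⟩ := exists_between (show 0 < min (B - δ ^ 2) (2 * (B - δ ^ 2) - (A - s)) from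
      lt_min (by linarith) (by linarith))
    exact ⟨σ, h1, h2.trans_le (min_le_left _ _), h2.trans_le (min_le_right _ _)⟩
  let Lg : ℕ → ℝ := fun n => Real.log ((n : ℝ) ^ 2)
  -- The correction from the shift by one in `exp_le_pValue`: (√(2L) δ + 1)² / 2 = (δ² + u)L + 1/2.
  let u : ℕ → ℝ := fun n => δ * √2 / √(Lg n)
  have hu : Tendsto u atTop (𝓝 0) :=
    tendsto_const_nhds.div_atTop (Real.tendsto_sqrt_atTop.comp tendsto_log_sq)
  set c₁ : ℝ := (√(2 * Real.pi))⁻¹ * Real.exp (-(1 / 2)) with hc₁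
  have hc₁0 : 0 < c₁ := by positivity
  set c₂ : ℝ := κ * c₁ / 2 with hc₂
  have hc₂0 : 0 < c₂ := by positivity
  have hexp : ∀ (e : ℕ → ℝ) (e₀ K : ℝ), Tendsto e atTop (𝓝 e₀) → e₀ < 0 → ∀ ε : ℝ, 0 < ε →
      ∀ᶠ n : ℕ in atTop, K * Real.exp (e n * Lg n) ≤ ε := by
    intro e e₀ K he he0 ε hε
    have h1 := (tendsto_exp_mul_log_sq he he0).const_mul K
    rw [mul_zero] at h1
    exact h1.eventually (ge_mem_nhds hε)
  have hE1 := hexp (fun n => A - s - 2 * (B - δ ^ 2 - u n) + σ) (A - s - 2 * (B - δ ^ 2) + σ)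
    (4 * C / c₂ ^ 2) (by
      have h1 := ((hu.const_sub (B - δ ^ 2)).const_mul 2).const_sub (A - s)
      rw [sub_zero] at h1
      exact h1.add_const σ) (by linarith) (1 / 2) (by norm_num)
  have hE2 := hexp (fun n => σ - (B - δ ^ 2 - u n)) (σ - (B - δ ^ 2)) (2 / c₂) (by
      have h1 := (hu.const_sub (B - δ ^ 2)).const_sub σ
      rwa [sub_zero] at h1) (by linarith) (1 / 2) (by norm_num)
  have hE3 := hexp (fun _ => -s) (-s) 1 tendsto_const_nhds (by linarith) (1 / 8) (by norm_num)
  have hE4 := hexp (fun n => δ ^ 2 + u n - s) (δ ^ 2 - s) (2 / c₁) (by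
      have h1 := (hu.const_add (δ ^ 2)).sub_const s
      rwa [add_zero] at h1) (by linarith) 1 one_pos
  have hE5 := hexp (fun _ => B - A) (B - A) (2 * κ * C) tendsto_const_nhds (by linarith) (1 / 2)
    (by norm_num)
  have hT1 := (tendsto_pow_mul_exp_log (s := (3 : ℕ)) hσ0).eventually
    (gt_mem_nhds (by norm_num : (0 : ℝ) < 1 / 2))
  have hT2 := (tendsto_pow_mul_exp_log (s := 1 / 2) (by positivity : 0 < 2 * σ)).eventually
    (gt_mem_nhds (by norm_num : (0 : ℝ) < 1 / 8))
  have hε : Tendsto (fun n : ℕ => 1769472 * Real.exp (-σ * Lg n)) atTop (𝓝 0) := by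
    have h1 := (tendsto_exp_mul_log_sq (e := fun _ => -σ) tendsto_const_nhds
      (by linarith)).const_mul 1769472
    rwa [mul_zero] at h1
  refine h.tendsto_power hε ?_
  filter_upwards [happ, hE1, hE2, hE3, hE4, hE5, hT1, hT2, h.card_bounds,
    h.eventually_mul_rpow_le (8 * 110592 * C),
    tendsto_log_sq.eventually_gt_atTop 0] with n ⟨ℓ, hℓ, hℓ1, hℓ2, happ⟩ hE1 hE2 hE3 hE4 hE5 hT1 hT2
      ⟨hn, hm, hm2, hm3, _, _, hR, _⟩ h8 hLg c hc
  have hn3 : 3 ≤ n := by omega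
  have hn0 : (0 : ℝ) < n := by exact_mod_cast (by omega : 0 < n)
  have hm0 : (0 : ℝ) < m n := by exact_mod_cast hm
  change 0 < Lg n at hLg
  have hn2 : (n : ℝ) ^ 2 = Real.exp (Lg n) := (Real.exp_log (by positivity)).symm
  have hα2 : (n : ℝ) ^ (2 * α) = Real.exp (α * Lg n) := rpow_two_mul_eq_exp (by omega) α
  have hB2 : (n : ℝ) ^ (2 * B) = Real.exp (B * Lg n) := rpow_two_mul_eq_exp (by omega) B
  rw [hα2] at hℓ1 hℓ2
  rw [hB2] at hm2 hm3
  have hcc := mem_configs.1 hc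
  choose Bf hBa hBn hBk using fun g => happ (c g) (hcc.1 g)
  have hN : 0 < (approxSet n ℓ).card := Finset.card_pos.2
    ((hBn ⟨0, hm⟩).mono (hBa ⟨0, hm⟩).subset)
  have h2ℓ : (0 : ℝ) < 2 ^ ℓ := by positivity
  have hN8 : 8 ≤ (approxSet n ℓ).card := by
    have h1 := sq_le_mul_card_approxSet hn3 hℓ hN
    have h2 : 8 * 110592 * 2 ^ ℓ ≤ (n : ℝ) ^ 2 := by
      rw [hα2] at h8
      refine le_trans ?_ h8
      rw [mul_assoc (8 * 110592 : ℝ)]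
      gcongr
    have h3 : (8 : ℝ) * (110592 * 2 ^ ℓ) ≤ (approxSet n ℓ).card * (110592 * 2 ^ ℓ) := by linarith
    exact_mod_cast le_of_mul_le_mul_right h3 (by positivity)
  -- the tail probabilities
  set z : ℝ := calibratedMean s n with hz
  set y : ℝ := calibratedMean r' n with hy
  have hsL : √(2 * Lg n) ^ 2 = 2 * Lg n := Real.sq_sqrt (by positivity)
  have ht : pValue z ≤ Real.exp (-s * Lg n) := by
    have hz0 : 0 ≤ z := mul_nonneg (Real.sqrt_nonneg _) (Real.sqrt_nonneg _)
    refine (pValue_le_exp hz0).trans_eq ?_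
    rw [hz, calibratedMean, mul_pow, hsL, Real.sq_sqrt hs0.le]
    congr 1; ring
  have huL : u n * Lg n = √(2 * Lg n) * δ := by
    have h1 : √(Lg n) ≠ 0 := (Real.sqrt_pos.2 hLg).ne'
    have h2 : Lg n = √(Lg n) * √(Lg n) := (Real.mul_self_sqrt hLg.le).symm
    simp only [u]
    rw [Real.sqrt_mul zero_le_two]
    nth_rewrite 2 [h2]
    field_simp
  have hπ : c₁ * Real.exp (-(δ ^ 2 + u n) * Lg n) ≤ pValue (z - y) := by
    have h0 : 0 ≤ √(2 * Lg n) * δ := mul_nonneg (Real.sqrt_nonneg _) hδ0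
    have h1 : pValue (√(2 * Lg n) * δ) ≤ pValue (z - y) := by
      refine pValue_strictAnti.antitone ?_
      rw [hz, hy, calibratedMean, calibratedMean, ← mul_sub]
      exact mul_le_mul_of_nonneg_left hδ (Real.sqrt_nonneg _)
    refine le_trans (le_trans (le_of_eq ?_) (exp_le_pValue h0)) h1
    rw [hc₁, mul_assoc, ← Real.exp_add]
    congr 2
    have h2 : (√(2 * Lg n) * δ + 1) ^ 2 = √(2 * Lg n) ^ 2 * δ ^ 2 + 2 * (√(2 * Lg n) * δ) + 1 := by
      ring
    rw [h2, hsL, ← huL]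
    ring
  have hp : c₂ * Real.exp ((B - δ ^ 2 - u n) * Lg n) ≤ m n * κ * pValue (z - y) := by
    have h1 : Real.exp (B * Lg n) / 2 ≤ m n := by linarith
    calc _ = Real.exp (B * Lg n) / 2 * κ * (c₁ * Real.exp (-(δ ^ 2 + u n) * Lg n)) := by
          have : (B - δ ^ 2 - u n) * Lg n = B * Lg n + -(δ ^ 2 + u n) * Lg n := by ring
          rw [this, Real.exp_add, hc₂]; ring
      _ ≤ _ := by gcongr
  have hp0 : 0 < c₂ * Real.exp ((B - δ ^ 2 - u n) * Lg n) := by positivity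
  set Q := Real.exp (-σ * Lg n) with hQ
  have hzy : pValue z ≤ pValue (z - y) / 2 := by
    have h1 : Real.exp (-s * Lg n) ≤ c₁ / 2 * Real.exp (-(δ ^ 2 + u n) * Lg n) := by
      have h2 : Real.exp (-s * Lg n) = c₁ / 2 * Real.exp (-(δ ^ 2 + u n) * Lg n) *
          (2 / c₁ * Real.exp ((δ ^ 2 + u n - s) * Lg n)) := by
        have : -s * Lg n = -(δ ^ 2 + u n) * Lg n + (δ ^ 2 + u n - s) * Lg n := by ring
        rw [this, Real.exp_add]
        field_simp
      rw [h2]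
      exact mul_le_of_le_one_right (by positivity) hE4
    linarith
  have hz8 : pValue z ≤ 1 / 8 := by
    rw [one_mul] at hE3
    exact ht.trans hE3
  have hmκ : m n * κ * (2 ^ ℓ / (n : ℝ) ^ 2) ≤ 1 / 2 := by
    refine le_trans ?_ hE5
    calc m n * κ * (2 ^ ℓ / (n : ℝ) ^ 2)
        ≤ 2 * Real.exp (B * Lg n) * κ * (C * Real.exp (α * Lg n) / Real.exp (Lg n)) := by
          rw [hn2]; gcongr
      _ = 2 * κ * C * (Real.exp (B * Lg n) * Real.exp (α * Lg n) / Real.exp (Lg n)) := by ring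
      _ = _ := by
          rw [← Real.exp_add, ← Real.exp_sub]
          congr 2
          rw [hAdef]; ring
  have hn2ℓ : (n : ℝ) ^ 2 / 2 ^ ℓ ≤ C * Real.exp (A * Lg n) := by
    rw [div_le_iff₀ h2ℓ, hn2]
    have h1 : Real.exp (Lg n) = Real.exp (A * Lg n) * Real.exp (α * Lg n) := by
      rw [← Real.exp_add]; congr 1; rw [hAdef]; ring
    rw [h1]
    calc _ ≤ Real.exp (A * Lg n) * (C * 2 ^ ℓ) := by gcongr
      _ = _ := by ring
  have hQb : 4 * ((n : ℝ) ^ 2 / 2 ^ ℓ) * pValue z / (m n * κ * pValue (z - y)) ^ 2 +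
      2 / (m n * κ * pValue (z - y)) ≤ Q := by
    have h0 := pValue_nonneg z
    have h1 : 4 * ((n : ℝ) ^ 2 / 2 ^ ℓ) * pValue z / (m n * κ * pValue (z - y)) ^ 2 ≤
        4 * (C * Real.exp (A * Lg n)) * Real.exp (-s * Lg n) /
          (c₂ * Real.exp ((B - δ ^ 2 - u n) * Lg n)) ^ 2 := by gcongr
    have h2 : 4 * (C * Real.exp (A * Lg n)) * Real.exp (-s * Lg n) /
        (c₂ * Real.exp ((B - δ ^ 2 - u n) * Lg n)) ^ 2 =
        Q * (4 * C / c₂ ^ 2 * Real.exp ((A - s - 2 * (B - δ ^ 2 - u n) + σ) * Lg n)) := by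
      have h3 : (A - s - 2 * (B - δ ^ 2 - u n) + σ) * Lg n = A * Lg n + -s * Lg n -
          (2 : ℕ) * ((B - δ ^ 2 - u n) * Lg n) - (-σ * Lg n) := by push_cast; ring
      rw [h3, Real.exp_sub, Real.exp_sub, Real.exp_add, Real.exp_nat_mul, hQ]
      field_simp
    have h4 : 2 / (m n * κ * pValue (z - y)) ≤
        2 / (c₂ * Real.exp ((B - δ ^ 2 - u n) * Lg n)) := by gcongr
    have h5 : 2 / (c₂ * Real.exp ((B - δ ^ 2 - u n) * Lg n)) =
        Q * (2 / c₂ * Real.exp ((σ - (B - δ ^ 2 - u n)) * Lg n)) := by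
      have h6 : (σ - (B - δ ^ 2 - u n)) * Lg n = -(-σ * Lg n) - (B - δ ^ 2 - u n) * Lg n := by ring
      rw [h6, Real.exp_sub, Real.exp_neg, hQ]
      field_simp
    have hQ0 : 0 < Q := Real.exp_pos _
    have h7 := mul_le_mul_of_nonneg_left hE1 hQ0.le
    have h8 := mul_le_mul_of_nonneg_left hE2 hQ0.le
    linarith
  refine (measureReal_mono ?_ (measure_ne_top _ _)).trans (obsLaw_signal_small_le hn3 hℓ hN hm
    (signalMean_nonneg α r n) hκ hc hBa hBk hzy hz8 hN8 hmκ hQb)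
  intro X hX hcon
  refine hX ⟨lt_of_lt_of_le ?_ hcon.1, lt_of_lt_of_le ?_ hcon.2⟩
  · have h1 : √Q = Real.exp (-σ * Real.log n) := by
      rw [hQ, Real.sqrt_eq_rpow, ← Real.exp_mul]
      congr 1
      change -σ * Real.log ((n : ℝ) ^ 2) * (1 / 2) = _
      rw [log_sq_eq]; ring
    rw [Real.rpow_natCast] at hT1
    rw [h1, lt_div_iff₀ (by positivity)]
    linarith
  · have h1 : Q = Real.exp (-(2 * σ) * Real.log n) := by
      rw [hQ]
      congr 1
      change -σ * Real.log ((n : ℝ) ^ 2) = _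
      rw [log_sq_eq]; ring
    rw [← Real.sqrt_eq_rpow] at hT2
    rw [h1, lt_div_iff₀ (by positivity)]
    linarith

/-- The power if a single cluster is detectable. -/
lemma tendsto_power_of_large (h : SparseClusterModel q α β m R) {r r' : ℝ}
    (hbd : 1 - α < r') (hr : r' < r) :
    Tendsto (fun n => (altLaw q n (m n) (R n) (signalMean α r n)).real
      {X | Real.log n ^ 3 < sHC q n X}) atTop (𝓝 1) ∧
    Tendsto (fun n => (altLaw q n (m n) (R n) (signalMean α r n)).real
      {X | √(Real.log n) < sBJ q n X}) atTop (𝓝 1) := by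
  obtain ⟨hA, _, _⟩ := h.exponents
  obtain ⟨κ, C, hκ, hC, happ⟩ := h.exists_approximants (hA.trans hbd) hr
  -- A threshold between the noise level A and the mean r': the small p-values are then below 2^ℓ /
  -- n² by a factor of order n^(2τ), and a cluster ball still misses the threshold with vanishing
  -- probability.
  obtain ⟨s, hs1, hs2⟩ := exists_between hbd
  set A := 1 - α with hAdef
  have hs0 : 0 < s := hA.trans hs1
  have hsr : 0 < √r' - √s := sub_pos.2 (Real.sqrt_lt_sqrt hs0.le hs2)
  set τ := s - A with hτ
  have hτ0 : 0 < τ := by linarith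
  let Lg : ℕ → ℝ := fun n => Real.log ((n : ℝ) ^ 2)
  let w : ℕ → ℝ := fun n => Real.exp (2 * τ * Real.log n) / C
  have hw : Tendsto w atTop atTop :=
    (Real.tendsto_exp_atTop.comp (tendsto_log_natCast.const_mul_atTop
      (by positivity : 0 < 2 * τ))).atTop_div_const hC
  have hT1 := (tendsto_pow_mul_exp_log (s := (3 : ℕ)) hτ0).eventually
    (gt_mem_nhds (by positivity : (0 : ℝ) < κ / 4 / √C))
  have hT2 := (Real.tendsto_sqrt_atTop.comp tendsto_log_natCast).eventually_gt_atTop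
    (2 / (κ * τ))
  have hT3 := (tendsto_log_natCast.const_mul_atTop hτ0).eventually_gt_atTop
    (1 - Real.log (κ / (2 * C)))
  have hε : Tendsto (fun n : ℕ => 2 * Real.exp (-(√r' - √s) ^ 2 * Lg n)) atTop (𝓝 0) := by
    have h1 := (tendsto_exp_mul_log_sq (e := fun _ => -(√r' - √s) ^ 2) tendsto_const_nhds
      (by have := pow_pos hsr 2; linarith)).const_mul 2
    rwa [mul_zero] at h1
  refine h.tendsto_power hε ?_
  filter_upwards [happ, hw.eventually_ge_atTop (6 / κ), hT1, hT2, hT3, h.card_bounds,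
    h.eventually_mul_rpow_le (8 * 110592 * C), h.eventually_mul_rpow_le (2 * κ * C),
    tendsto_log_sq.eventually_gt_atTop 0] with n ⟨ℓ, hℓ, hℓ1, hℓ2, happ⟩ hw6 hT1 hT2 hT3
      ⟨hn, hm, _, _, _, _, hR, _⟩ h8 hκ2 hLg c hc
  have hn3 : 3 ≤ n := by omega
  have hn0 : (0 : ℝ) < n := by exact_mod_cast (by omega : 0 < n)
  change 0 < Lg n at hLg
  have hn2 : (n : ℝ) ^ 2 = Real.exp (Lg n) := (Real.exp_log (by positivity)).symm
  have hα2 : (n : ℝ) ^ (2 * α) = Real.exp (α * Lg n) := rpow_two_mul_eq_exp (by omega) α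
  have hlog2 : Lg n = 2 * Real.log n := log_sq_eq n
  have hlog0 : 0 < Real.log n := by linarith
  have hcc := mem_configs.1 hc
  obtain ⟨B, hBa, hBn, hBk⟩ := happ (c ⟨0, hm⟩) (hcc.1 ⟨0, hm⟩)
  have hN : 0 < (approxSet n ℓ).card := Finset.card_pos.2 (hBn.mono hBa.subset)
  have h2ℓ : (0 : ℝ) < 2 ^ ℓ := by positivity
  have hN8 : 8 ≤ (approxSet n ℓ).card := by
    have h1 := sq_le_mul_card_approxSet hn3 hℓ hN
    have h2 : 8 * 110592 * 2 ^ ℓ ≤ (n : ℝ) ^ 2 := by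
      refine le_trans ?_ h8
      rw [mul_assoc (8 * 110592 : ℝ)]
      gcongr
    have h3 : (8 : ℝ) * (110592 * 2 ^ ℓ) ≤ (approxSet n ℓ).card * (110592 * 2 ^ ℓ) := by linarith
    exact_mod_cast le_of_mul_le_mul_right h3 (by positivity)
  have hκn : κ * (2 ^ ℓ / (n : ℝ) ^ 2) ≤ 1 / 2 := by
    rw [← mul_div_assoc, div_le_iff₀ (by positivity)]
    have h1 : κ * 2 ^ ℓ ≤ κ * (C * (n : ℝ) ^ (2 * α)) := by gcongr
    linarith
  set z : ℝ := calibratedMean s n with hz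
  set y : ℝ := calibratedMean r' n with hy
  have hsL : √(2 * Lg n) ^ 2 = 2 * Lg n := Real.sq_sqrt (by positivity)
  have ht : pValue z ≤ Real.exp (-s * Lg n) := by
    have hz0 : 0 ≤ z := mul_nonneg (Real.sqrt_nonneg _) (Real.sqrt_nonneg _)
    refine (pValue_le_exp hz0).trans_eq ?_
    rw [hz, calibratedMean, mul_pow, hsL, Real.sq_sqrt hs0.le]
    congr 1; ring
  have ht0 := pValue_pos z
  have hyz : pValue (y - z) ≤ Real.exp (-(√r' - √s) ^ 2 * Lg n) := by
    have h1 : y - z = √(2 * Lg n) * (√r' - √s) := by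
      rw [hz, hy, calibratedMean, calibratedMean, ← mul_sub]
    rw [h1]
    refine (pValue_le_exp (mul_nonneg (Real.sqrt_nonneg _) hsr.le)).trans_eq ?_
    rw [mul_pow, hsL]
    congr 1; ring
  set W := 2 ^ ℓ / ((n : ℝ) ^ 2 * pValue z) with hW
  have hwW : w n ≤ W := by
    rw [hW, le_div_iff₀ (by positivity)]
    have h1 : w n = Real.exp (s * Lg n) * Real.exp (α * Lg n) / Real.exp (Lg n) / C := by
      rw [← Real.exp_add, ← Real.exp_sub]
      simp only [w]
      congr 2
      rw [hlog2, hτ, hAdef]; ring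
    have h2 : Real.exp (s * Lg n) * Real.exp (-s * Lg n) = 1 := by
      rw [← Real.exp_add, ← add_mul, add_neg_cancel, zero_mul, Real.exp_zero]
    calc w n * ((n : ℝ) ^ 2 * pValue z)
        ≤ w n * (Real.exp (Lg n) * Real.exp (-s * Lg n)) := by
          rw [hn2]
          have : 0 ≤ w n := by positivity
          gcongr
      _ = Real.exp (α * Lg n) / C * (Real.exp (s * Lg n) * Real.exp (-s * Lg n)) := by
          rw [h1]; field_simp
      _ = Real.exp (α * Lg n) / C := by rw [h2, mul_one]
      _ ≤ 2 ^ ℓ := by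
          rw [div_le_iff₀ hC, ← hα2]; linarith
  have hw0 : 0 < w n := by positivity
  have hW6 : 6 ≤ κ * W := by
    rw [div_le_iff₀ hκ] at hw6
    nlinarith
  refine (measureReal_mono ?_ (measure_ne_top _ _)).trans
    ((obsLaw_signal_small_le_of_large_mean hn3 hℓ hN hκ ⟨0, hm⟩ hBa hBk hN8 hκn hW6).trans
      (mul_le_mul_of_nonneg_left hyz zero_le_two))
  intro X hX hcon
  refine hX ⟨lt_of_lt_of_le ?_ hcon.1, lt_of_lt_of_le ?_ hcon.2⟩
  · have h1 : √(w n) = Real.exp (τ * Real.log n) / √C := by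
      simp only [w]
      rw [Real.sqrt_div' _ hC.le, Real.sqrt_eq_rpow (Real.exp _), ← Real.exp_mul]
      congr 2
      ring
    have h2 : √(w n) ≤ √W := Real.sqrt_le_sqrt hwW
    rw [Real.rpow_natCast, neg_mul, Real.exp_neg, ← div_eq_mul_inv,
      div_lt_iff₀ (Real.exp_pos _)] at hT1
    calc Real.log n ^ 3 < κ / 4 / √C * Real.exp (τ * Real.log n) := hT1
      _ = κ / 4 * √(w n) := by rw [h1]; ring
      _ ≤ _ := by gcongr
  · have h1 : Real.log (κ / 2 * w n) = Real.log (κ / (2 * C)) + 2 * τ * Real.log n := by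
      have h2 : κ / 2 * w n = κ / (2 * C) * Real.exp (2 * τ * Real.log n) := by
        simp only [w]; field_simp
      rw [h2, Real.log_mul (by positivity) (Real.exp_pos _).ne', Real.log_exp]
    have h2 : Real.log (κ / 2 * w n) ≤ Real.log (κ / 2 * W) :=
      Real.log_le_log (by positivity) (by gcongr)
    have h3 : √(Real.log n) ≤ κ / 2 * (τ * Real.log n) := by
      have h4 : √(Real.log n) * √(Real.log n) = Real.log n := Real.mul_self_sqrt hlog0.le
      simp only [Function.comp_apply] at hT2
      rw [div_lt_iff₀ (by positivity)] at hT2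
      have h5 := mul_le_mul_of_nonneg_left hT2.le (Real.sqrt_nonneg (Real.log n))
      rw [← mul_assoc, h4] at h5
      linarith
    calc √(Real.log n) ≤ κ / 2 * (τ * Real.log n) := h3
      _ < κ / 2 * (Real.log (κ / 2 * w n) - 1) := by
        refine mul_lt_mul_of_pos_left ?_ (by positivity)
        rw [h1]; linarith
      _ ≤ _ := by gcongr

/-- For B = 0 the number of clusters tends to 1 and the boundary equals A, so one cluster must
suffice. The intermediate r' absorbs the approximation of clusters by balls of the levels. -/
theorem tendsto_power_of_gt (h : SparseClusterModel q α β m R) {r : ℝ}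
    (hr : detectionBoundary α β < r) :
    Tendsto (fun n => (altLaw q n (m n) (R n) (signalMean α r n)).real
      {X | Real.log n ^ 3 < sHC q n X}) atTop (𝓝 1) ∧
    Tendsto (fun n => (altLaw q n (m n) (R n) (signalMean α r n)).real
      {X | √(Real.log n) < sBJ q n X}) atTop (𝓝 1) := by
  obtain ⟨hA, hB, hAB⟩ := h.exponents
  obtain ⟨r', h1, h2⟩ := exists_between hr
  rcases hB.eq_or_lt with hB | hB
  · refine h.tendsto_power_of_large ?_ h2
    have h3 : β = 1 - α := by linarith
    rw [detectionBoundary, h3, div_self hA.ne', if_neg (by norm_num), sub_self, Real.sqrt_zero,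
      sub_zero, Real.sq_sqrt hA.le] at h1
    exact h1
  · exact h.tendsto_power_of_many hB ((detectionBoundary_nonneg hAB).trans_lt h1) h1 h2

end SparseClusterModel

end NetworkClusters

end

theorem theorem13 (q : NetworkClusters.PlaneNorm) :
    -- the null distribution
    (∃ C : ℝ, 0 < C ∧
      NetworkClusters.AsympLeInProb NetworkClusters.nullLaw
        (fun n X => NetworkClusters.sBJ q n X / Real.log (Real.log n)) C) ∧
    NetworkClusters.IsBigOInProb NetworkClusters.nullLaw
      (fun n X => NetworkClusters.sHC q n X) (fun n => Real.log n ^ (5 / 2 : ℝ)) ∧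
    -- the lower bound
    (∀ (α β r : ℝ) (m : ℕ → ℕ) (R : ℕ → ℝ), NetworkClusters.SparseClusterModel q α β m R →
      0 < r → r < NetworkClusters.detectionBoundary α β →
      NetworkClusters.MergeAsymptotically NetworkClusters.nullLaw
        (fun n => NetworkClusters.altLaw q n (m n) (R n) (NetworkClusters.signalMean α r n))) ∧
    -- asymptotic power 1, with critical values that do not depend on the alternative
    (∃ tHC tBJ : ℕ → ℝ,
      Tendsto (fun n => (NetworkClusters.nullLaw n).real
        {X | tHC n < NetworkClusters.sHC q n X}) atTop (𝓝 0) ∧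
      Tendsto (fun n => (NetworkClusters.nullLaw n).real
        {X | tBJ n < NetworkClusters.sBJ q n X}) atTop (𝓝 0) ∧
      ∀ (α β r : ℝ) (m : ℕ → ℕ) (R : ℕ → ℝ), NetworkClusters.SparseClusterModel q α β m R →
        NetworkClusters.detectionBoundary α β < r →
        Tendsto (fun n => (NetworkClusters.altLaw q n (m n) (R n)
            (NetworkClusters.signalMean α r n)).real
          {X | tHC n < NetworkClusters.sHC q n X}) atTop (𝓝 1) ∧
        Tendsto (fun n => (NetworkClusters.altLaw q n (m n) (R n)
            (NetworkClusters.signalMean α r n)).real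
          {X | tBJ n < NetworkClusters.sBJ q n X}) atTop (𝓝 1)) :=
  ⟨⟨3317760, by norm_num, NetworkClusters.asympLeInProb_sBJ q⟩, NetworkClusters.isBigOInProb_sHC q,
    fun _ _ _ _ _ h hr hrb => NetworkClusters.mergeAsymptotically_of_lt q h hr hrb,
    -- Any critical values between the null orders log^(5/2) n, log log n and the sizes under the
    -- alternative would do; for Berk-Jones the latter may be only of order log n, in the case of a
    -- single cluster.
    fun n => Real.log n ^ 3, fun n => √(Real.log n), NetworkClusters.tendsto_nullLaw_sHC q,
    NetworkClusters.tendsto_nullLaw_sBJ q, fun _ _ _ _ _ h hr => h.tendsto_power_of_gt hr⟩
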